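/- Let $n\ge 4$ and $1<p<q$ satisfy $F(p,q,n)=0$, where $$F(p,q,n)=\max\Big\{\frac{q+2+p^{-1}}{pq-1},\ \frac{p+2+q^{-1}}{pq-1}\Big\}-\frac{n-1}{2}.$$ Then there is a convergent real sequence $(S_j)$, depending only on $p,q,n$, such that the following holds. Let $R>0$, let $(f_1,g_1)\in (H^1(\mathbb R^n)\cap L^q(\mathbb R^n))\times L^2(\mathbb R^n)$ and $(f_2,g_2)\in H^1(\mathbb R^n)\times L^2(\mathbb R^n)$ be non-negative functions vanishing for $|x|>R$, with neither $g_1$ nor $g_2$ identically zero. Then there is a constant $\tilde C=\tilde C(p,q,n,R,f_2,g_2)>0$ such that the following holds for every $\varepsilon>0$ and every $T\in(0,\infty]$. Suppose $(u,v)\in C([0,T);(H^1\cap L^q)\times H^1)$ with $(u_t,v_t)\in C([0,T);L^2)^2$ is a weak solution of $$u_{tt}-\Delta u=|v|^p,\qquad v_{tt}-\Delta v=|u|^q\qquad\text{in }\mathbb R^n\times[0,T)$$ with initial data $u(0)=\varepsilon f_1$, $u_t(0)=\varepsilon g_1$, $v(0)=\varepsilon f_2$, $v_t(0)=\varepsilon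 g_2$, and that $u,v,u_t,v_t$ are supported in $\{|x|\le t+R\}$. Then $U(t)=\int_{\mathbb R^n}u(x,t)\,dx$ belongs to $C^2([0,T))$ and, for every $j\ge1$ and every $t\in[0,T)$ with $t\ge a_jR$, $$U''(t)\ \ge\ C_j\,(t-a_jR)^{\,n-1-(n-1)p/2}\left(\log\frac{t+(a_j^2-2)R}{(a_j+2)(a_j-1)R}\right)^{\frac{(pq)^j-1}{pq-1}},$$ where $a_j=6\cdot4^{j-1}-2$, $C_1=\tilde C\varepsilon^{p^2q}$, and $C_j=\exp\{(pq)^{j-1}(\log C_1+S_j)\}$ for $j\ge2$. -/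

import Mathlib

open MeasureTheory Filter Topology
open scoped ContDiff

namespace WaveSystem

/-- The critical quantity
`F(p,q,n) = max{(q + 2 + p⁻¹)/(pq - 1), (p + 2 + q⁻¹)/(pq - 1)} - (n - 1)/2`. -/
noncomputable def criticalF (p q : ℝ) (n : ℕ) : ℝ :=
  max ((q + 2 + p⁻¹) / (p * q - 1)) ((p + 2 + q⁻¹) / (p * q - 1)) - ((n : ℝ) - 1) / 2

/-- The time interval `[0, T)`, where `T = ∞` is allowed. -/
def timeInterval (T : EReal) : Set ℝ := {t : ℝ | 0 ≤ t ∧ (t : EReal) < T}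

/-- `G` is the weak (distributional) gradient of `f` on `ℝⁿ`: every directional derivative is
tested against smooth compactly supported functions. -/
def HasWeakGradient {n : ℕ} (f : EuclideanSpace ℝ (Fin n) → ℝ)
    (G : EuclideanSpace ℝ (Fin n) → EuclideanSpace ℝ (Fin n)) : Prop :=
  LocallyIntegrable f volume ∧ LocallyIntegrable G volume ∧
    ∀ φ : EuclideanSpace ℝ (Fin n) → ℝ, ContDiff ℝ ∞ φ → HasCompactSupport φ →
      ∀ e : EuclideanSpace ℝ (Fin n),
        ∫ x, f x * fderiv ℝ φ x e = -∫ x, inner ℝ (G x) e * φ x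

/-- The Sobolev space `H¹(ℝⁿ)`. -/
def MemH1 {n : ℕ} (f : EuclideanSpace ℝ (Fin n) → ℝ) : Prop :=
  MemLp f 2 volume ∧
    ∃ G : EuclideanSpace ℝ (Fin n) → EuclideanSpace ℝ (Fin n),
      MemLp G 2 volume ∧ HasWeakGradient f G

/-- `w ∈ C([0,T); L^r(ℝⁿ))`. -/
def ContinuousInLp {n : ℕ} {F : Type} [NormedAddCommGroup F] (T : EReal) (r : ENNReal)
    (w : ℝ → EuclideanSpace ℝ (Fin n) → F) : Prop :=
  (∀ t ∈ timeInterval T, MemLp (w t) r volume) ∧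
    ∀ t₀ ∈ timeInterval T,
      Tendsto (fun t => eLpNorm (fun x => w t x - w t₀ x) r volume)
        (𝓝[timeInterval T] t₀) (𝓝 0)

/-- `wt` is the time derivative of `w` on `[0,T)`, as a limit of difference quotients in
`L²(ℝⁿ)` (one-sided at `t = 0`). -/
def HasTimeDerivative {n : ℕ} (T : EReal) (w wt : ℝ → EuclideanSpace ℝ (Fin n) → ℝ) : Prop :=
  ∀ t₀ ∈ timeInterval T,
    Tendsto
      (fun t => eLpNorm (fun x => (t - t₀)⁻¹ * (w t x - w t₀ x) - wt t₀ x) 2 volume)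
      (𝓝[timeInterval T \ {t₀}] t₀) (𝓝 0)

/-- `w` is a weak solution on `ℝⁿ × [0,T)` of `w_tt - Δw = h`, `w(0) = w₀`, `w_t(0) = w₁`, with
`w ∈ C([0,T); H¹)` and `w_t = wt ∈ C([0,T); L²)`. The equation is tested against
`ψ ∈ C_c^∞(ℝⁿ)` and integrated in time; `fderiv ℝ ψ x (Dw s x)` is `∇w(x,s) · ∇ψ(x)`. -/
def SolvesWave {n : ℕ} (T : EReal) (h : ℝ → EuclideanSpace ℝ (Fin n) → ℝ)
    (w₀ w₁ : EuclideanSpace ℝ (Fin n) → ℝ) (w wt : ℝ → EuclideanSpace ℝ (Fin n) → ℝ) : Prop :=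
  ContinuousInLp T 2 w ∧ ContinuousInLp T 2 wt ∧ HasTimeDerivative T w wt ∧
    w 0 =ᵐ[volume] w₀ ∧ wt 0 =ᵐ[volume] w₁ ∧
    ∃ Dw : ℝ → EuclideanSpace ℝ (Fin n) → EuclideanSpace ℝ (Fin n),
      ContinuousInLp T 2 Dw ∧ (∀ t ∈ timeInterval T, HasWeakGradient (w t) (Dw t)) ∧
      ∀ ψ : EuclideanSpace ℝ (Fin n) → ℝ, ContDiff ℝ ∞ ψ → HasCompactSupport ψ →
        ∀ t ∈ timeInterval T,
          ∫ x, wt t x * ψ x =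
            (∫ x, wt 0 x * ψ x) +
              ∫ s in (0 : ℝ)..t, ((∫ x, h s x * ψ x) - ∫ x, fderiv ℝ ψ x (Dw s x))

/-- `(u, v)`, with time derivatives `(ut, vt)`, is a solution on `ℝⁿ × [0,T)` of
`u_tt - Δu = |v|^p`, `v_tt - Δv = |u|^q` with initial data `ε f₁, ε g₁, ε f₂, ε g₂`, where
`u ∈ C([0,T); H¹ ∩ L^q)`, `v ∈ C([0,T); H¹)`, `u_t, v_t ∈ C([0,T); L²)`. -/
structure IsSolution {n : ℕ} (p q ε : ℝ) (f₁ g₁ f₂ g₂ : EuclideanSpace ℝ (Fin n) → ℝ)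
    (T : EReal) (u ut v vt : ℝ → EuclideanSpace ℝ (Fin n) → ℝ) : Prop where
  continuous_Lq : ContinuousInLp T (ENNReal.ofReal q) u
  eq_u : SolvesWave T (fun t x => |v t x| ^ p) (fun x => ε * f₁ x) (fun x => ε * g₁ x) u ut
  eq_v : SolvesWave T (fun t x => |u t x| ^ q) (fun x => ε * f₂ x) (fun x => ε * g₂ x) v vt

/-- `supp (u, v, u_t, v_t) ⊂ {(x,t) : |x| ≤ t + R}`. -/
def SupportedInCone {n : ℕ} (R : ℝ) (T : EReal)
    (u ut v vt : ℝ → EuclideanSpace ℝ (Fin n) → ℝ) : Prop :=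
  ∀ t ∈ timeInterval T, ∀ᵐ x : EuclideanSpace ℝ (Fin n), t + R < ‖x‖ →
    u t x = 0 ∧ v t x = 0 ∧ ut t x = 0 ∧ vt t x = 0

/-- Assumptions on a pair of initial data `(f, g)`: it lies in `H¹ × L²`, vanishes for `|x| > R`,
is non-negative, and `g` does not vanish identically. -/
structure AdmissibleData {n : ℕ} (R : ℝ) (f g : EuclideanSpace ℝ (Fin n) → ℝ) : Prop where
  memH1 : MemH1 f
  memL2 : MemLp g 2 volume
  vanish : ∀ᵐ x : EuclideanSpace ℝ (Fin n), R < ‖x‖ → f x = 0 ∧ g x = 0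
  nonneg : ∀ᵐ x : EuclideanSpace ℝ (Fin n), 0 ≤ f x ∧ 0 ≤ g x
  ne_zero : ¬ g =ᵐ[volume] 0

/-- `a_j = 6 · 4^{j-1} - 2` for `j ≥ 1`. -/
noncomputable def a (j : ℕ) : ℝ := 6 * 4 ^ (j - 1) - 2

/-- `C_1 = Ct ε^{p²q}` and `C_j = exp{(pq)^{j-1} (log C_1 + S_j)}` for `j ≥ 2`. -/
noncomputable def C (p q Ct ε : ℝ) (S : ℕ → ℝ) (j : ℕ) : ℝ :=
  if j = 1 then Ct * ε ^ (p ^ 2 * q)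
  else Real.exp ((p * q) ^ (j - 1) * (Real.log (Ct * ε ^ (p ^ 2 * q)) + S j))

/-- `U(t) = ∫ u(x,t) dx`. -/
noncomputable def mean {n : ℕ} (u : ℝ → EuclideanSpace ℝ (Fin n) → ℝ) (t : ℝ) : ℝ :=
  ∫ x, u t x

end WaveSystem

/-!
The mean `U` of `u` has second derivative `∫ |v|^p`, so the claim is a sequence of lower bounds for
this integral, which are proved by iteration.

Write `k = n - 1`. Testing the wave equation with plane waves `f (x · e ± t)` reduces it to the
one-dimensional wave equation for the Radon transform in each direction `e`
(`SolvesWave.integral_planeWave`). Comparing the two travelling waves gives, for non-negative data and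
source and solutions supported in the cone `|x| ≤ t + R`, a lower bound for the average of the solution
over the plane `x · e = ρ` by the mass emitted by the source up to the time `(t - ρ - R) / 2`
(`SolvesWave.le_integral_planeWave`). This bound is the same for all directions `e` and holds in every
dimension, although the fundamental solution is not positive for `n ≥ 4`.

Plane averages that are large in all directions force the `Lᵖ` norm to be large
(`rpow_le_of_le_plane_averages`). The proof integrates over all directions and uses Hölder's
inequality on pairs of a direction and a point, with a weight adapted to the distribution of `x · ω`
for a random direction `ω` (`lintegral_ball_direction_le`).

One step of the iteration (`iteration_step`) goes from a lower bound for `∫ |v|^p` to one for `U` by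
two integrations in time, to one for `∫ |u|^q` by Hölder's inequality (`kato_lower_bound`), to one for
the plane averages of `v`, and back to `∫ |v|^p`. The power of `t` reproduces itself, and for `p < q`
the condition `criticalF p q n = 0` says exactly that the weight in the last integral, over the
distance `y` to the light cone, is `1 / y`; it yields one more logarithm (`log_rpow_le_integral`). The exponents of the
logarithm therefore obey `b ↦ pq b + 1`, and the constants `C ↦ c C^(pq) / (pq b + 1)`, whose logarithms
divided by `(pq)^j` converge (`tendsto_lossSum`). The iteration starts from the free wave with initial
velocity `g₂` (`first_lower_bound`).
-/

namespace WaveSystem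
open scoped ENNReal

/-! ### Directions and the unit ball -/

/-- The substitution `a = s τ / √(1 - τ²)`, which replaces the coordinate `a` of the point `(a, y)`
with `|y| = s` by the cosine `τ` of its angle with the first axis. -/
theorem lintegral_line_eq_lintegral_cos {s : ℝ} (hs : 0 < s) (r : ℝ) (κ : ℝ → ℝ≥0∞) :
    ∫⁻ a : ℝ, (if a ^ 2 + s ^ 2 < 1 then κ (r * (a / √(a ^ 2 + s ^ 2))) else 0) =
      ∫⁻ τ in Set.Ioo (-1 : ℝ) 1, ENNReal.ofReal (s / √(1 - τ ^ 2) ^ 3) *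
        (if s ^ 2 < 1 - τ ^ 2 then κ (r * τ) else 0) := by
  have hpos : ∀ τ ∈ Set.Ioo (-1 : ℝ) 1, 0 < 1 - τ ^ 2 := fun τ hτ => by
    nlinarith [hτ.1, hτ.2]
  have hsq : ∀ τ ∈ Set.Ioo (-1 : ℝ) 1,
      (s * (τ / √(1 - τ ^ 2))) ^ 2 + s ^ 2 = s ^ 2 / (1 - τ ^ 2) := fun τ hτ => by
    have h := hpos τ hτ
    rw [mul_pow, div_pow, Real.sq_sqrt h.le]
    field_simp
    ring
  have hinv : ∀ τ ∈ Set.Ioo (-1 : ℝ) 1,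
      s * (τ / √(1 - τ ^ 2)) / √((s * (τ / √(1 - τ ^ 2))) ^ 2 + s ^ 2) = τ := fun τ hτ => by
    have h := hpos τ hτ
    have h' : 0 < √(1 - τ ^ 2) := Real.sqrt_pos.2 h
    rw [hsq τ hτ, Real.sqrt_div (sq_nonneg s), Real.sqrt_sq hs.le]
    field_simp
  have hderiv : ∀ τ ∈ Set.Ioo (-1 : ℝ) 1,
      HasDerivWithinAt (fun τ => s * (τ / √(1 - τ ^ 2))) (s / √(1 - τ ^ 2) ^ 3)
        (Set.Ioo (-1 : ℝ) 1) τ := fun τ hτ => by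
    have h := hpos τ hτ
    have h' : 0 < √(1 - τ ^ 2) := Real.sqrt_pos.2 h
    have h1 : HasDerivAt (fun τ : ℝ => √(1 - τ ^ 2)) ((-(2 * τ)) / (2 * √(1 - τ ^ 2))) τ := by
      refine HasDerivAt.sqrt ?_ h.ne'
      have := ((hasDerivAt_id τ).pow 2).const_sub 1
      refine this.congr_deriv ?_
      simp
    refine (((hasDerivAt_id τ).div h1 h'.ne').const_mul s).hasDerivWithinAt.congr_deriv ?_
    have e : √(1 - τ ^ 2) ^ 2 = 1 - τ ^ 2 := Real.sq_sqrt h.le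
    simp only [id]
    field_simp
    rw [e]
    ring
  have himage : (fun τ => s * (τ / √(1 - τ ^ 2))) '' Set.Ioo (-1 : ℝ) 1 = Set.univ := by
    refine Set.eq_univ_of_forall fun a => ?_
    have h0 : 0 < a ^ 2 + s ^ 2 := by positivity
    have e : 1 - (a / √(a ^ 2 + s ^ 2)) ^ 2 = s ^ 2 / (a ^ 2 + s ^ 2) := by
      rw [div_pow, Real.sq_sqrt h0.le]
      field_simp
      ring
    have hlt : (a / √(a ^ 2 + s ^ 2)) ^ 2 < 1 := by
      have : 0 < s ^ 2 / (a ^ 2 + s ^ 2) := by positivity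
      linarith
    refine ⟨a / √(a ^ 2 + s ^ 2), ?_, ?_⟩
    · exact abs_lt.1 ((sq_lt_one_iff_abs_lt_one _).1 hlt)
    · simp only [e]
      rw [Real.sqrt_div (sq_nonneg s), Real.sqrt_sq hs.le]
      field_simp
  rw [← setLIntegral_univ, ← himage, lintegral_image_eq_lintegral_abs_deriv_mul
    measurableSet_Ioo hderiv]
  · refine setLIntegral_congr_fun measurableSet_Ioo fun τ hτ => ?_
    have h := hpos τ hτ
    have h' : 0 < √(1 - τ ^ 2) := Real.sqrt_pos.2 h
    have e : (s * (τ / √(1 - τ ^ 2))) ^ 2 + s ^ 2 < 1 ↔ s ^ 2 < 1 - τ ^ 2 := by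
      rw [hsq τ hτ, div_lt_one h]
    simp only [hinv τ hτ, e]
    rw [abs_of_nonneg (by positivity)]
  · intro τ hτ τ' hτ' hEq
    have h1 := hinv τ hτ
    have h2 := hinv τ' hτ'
    simp only at hEq
    rw [hEq] at h1
    exact h1.symm.trans h2

/-- A crude bound for the first moment of a Euclidean ball, by that of the enclosing cube. -/
theorem lintegral_sqrt_sum_sq_le (k : ℕ) {c : ℝ} (hc : 0 < c) :
    ∫⁻ y : Fin k → ℝ, (if √(∑ i, y i ^ 2) ^ 2 < c ^ 2 then ENNReal.ofReal √(∑ i, y i ^ 2) else 0) ≤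
      ENNReal.ofReal (2 ^ k * c ^ (k + 1)) := by
  calc _ ≤ ∫⁻ y in Metric.ball (0 : Fin k → ℝ) c, ENNReal.ofReal c := by
        rw [← lintegral_indicator measurableSet_ball]
        refine lintegral_mono fun y => ?_
        by_cases h : √(∑ i, y i ^ 2) ^ 2 < c ^ 2
        · have h1 : √(∑ i, y i ^ 2) < c := lt_of_pow_lt_pow_left₀ 2 hc.le h
          have hy : y ∈ Metric.ball (0 : Fin k → ℝ) c := by
            rw [mem_ball_zero_iff, pi_norm_lt_iff hc]
            intro i
            refine lt_of_le_of_lt ?_ h1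
            rw [Real.norm_eq_abs, ← Real.sqrt_sq_eq_abs]
            exact Real.sqrt_le_sqrt
              (Finset.single_le_sum (f := fun i => y i ^ 2) (fun j _ => sq_nonneg _)
                (Finset.mem_univ i))
          simp only [h, if_true, Set.indicator_of_mem hy]
          exact ENNReal.ofReal_le_ofReal h1.le
        · simp [h]
    _ = ENNReal.ofReal (2 ^ k * c ^ (k + 1)) := by
        rw [setLIntegral_const, Real.volume_pi_ball _ hc, ← ENNReal.ofReal_mul hc.le]
        congr 1
        rw [Fintype.card_fin]
        ring

/-- Push-forward of the uniform measure on the unit ball under `z ↦ ⟪x, z / |z|⟫`: its density with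
respect to `τ ↦ |x| τ` is at most a multiple of `(1 - τ²)^((n-3)/2)`. This is the case
where `x` lies on the first axis. -/
theorem lintegral_ball_axis_le (k : ℕ) (hk : 2 ≤ k) (r : ℝ) (κ : ℝ → ℝ≥0∞) (hκ : Measurable κ) :
    ∫⁻ z in Metric.ball (0 : EuclideanSpace ℝ (Fin (k + 1))) 1, κ (r * (z 0 / ‖z‖)) ≤
      ENNReal.ofReal (2 ^ k) * ∫⁻ τ in Set.Ioo (-1 : ℝ) 1,
        κ (r * τ) * ENNReal.ofReal ((1 - τ ^ 2) ^ (((k : ℝ) - 2) / 2)) := by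
  have hnorm : ∀ z : EuclideanSpace ℝ (Fin (k + 1)),
      ‖z‖ = √((z 0) ^ 2 + √(∑ i : Fin k, (z i.succ) ^ 2) ^ 2) := fun z => by
    rw [EuclideanSpace.norm_eq, Fin.sum_univ_succ,
      Real.sq_sqrt (Finset.sum_nonneg fun i _ => sq_nonneg _)]
    simp
  set g : ℝ × (Fin k → ℝ) → ℝ≥0∞ := fun w =>
    if w.1 ^ 2 + √(∑ i, w.2 i ^ 2) ^ 2 < 1 then
      κ (r * (w.1 / √(w.1 ^ 2 + √(∑ i, w.2 i ^ 2) ^ 2))) else 0 with hg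
  have hgm : Measurable g := by
    refine Measurable.ite (measurableSet_lt (by fun_prop) measurable_const) ?_ measurable_const
    exact hκ.comp (by fun_prop)
  have hmp := (volume_preserving_piFinSuccAbove (fun _ : Fin (k + 1) => ℝ) 0).comp
    (PiLp.volume_preserving_ofLp (Fin (k + 1)))
  calc ∫⁻ z in Metric.ball (0 : EuclideanSpace ℝ (Fin (k + 1))) 1, κ (r * (z 0 / ‖z‖))
      = ∫⁻ z : EuclideanSpace ℝ (Fin (k + 1)), g (z 0, fun i => z i.succ) := by
        rw [← lintegral_indicator measurableSet_ball]
        refine lintegral_congr fun z => ?_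
        have h1 : z ∈ Metric.ball (0 : EuclideanSpace ℝ (Fin (k + 1))) 1 ↔
            (z 0) ^ 2 + √(∑ i : Fin k, (z i.succ) ^ 2) ^ 2 < 1 := by
          rw [mem_ball_zero_iff, hnorm z, Real.sqrt_lt' one_pos, one_pow]
        by_cases h : z ∈ Metric.ball (0 : EuclideanSpace ℝ (Fin (k + 1))) 1
        · rw [Set.indicator_of_mem h]
          simp only [hg, if_pos (h1.1 h)]
          rw [hnorm z]
        · rw [Set.indicator_of_notMem h]
          simp only [hg, if_neg (fun h' => h (h1.2 h'))]
    _ = ∫⁻ w, g w := by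
        rw [← hmp.lintegral_comp hgm]
        rfl
    _ = ∫⁻ y : Fin k → ℝ, ∫⁻ a : ℝ, g (a, y) := by
        rw [Measure.volume_eq_prod, lintegral_prod_symm _ hgm.aemeasurable]
    _ = ∫⁻ y : Fin k → ℝ, ∫⁻ τ in Set.Ioo (-1 : ℝ) 1,
          ENNReal.ofReal (√(∑ i, y i ^ 2) / √(1 - τ ^ 2) ^ 3) *
            (if √(∑ i, y i ^ 2) ^ 2 < 1 - τ ^ 2 then κ (r * τ) else 0) := by
        have : NeZero k := ⟨by omega⟩
        have hae : ∀ᵐ y : Fin k → ℝ, y ≠ 0 := by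
          simp [ae_iff]
        refine lintegral_congr_ae (hae.mono fun y hy => ?_)
        have hs : 0 < √(∑ i, y i ^ 2) := by
          refine Real.sqrt_pos.2 ?_
          obtain ⟨i, hi⟩ := Function.ne_iff.1 hy
          have : 0 < y i ^ 2 := by
            have : y i ≠ 0 := hi
            positivity
          exact lt_of_lt_of_le this
            (Finset.single_le_sum (f := fun i => y i ^ 2) (fun j _ => sq_nonneg _)
              (Finset.mem_univ i))
        exact lintegral_line_eq_lintegral_cos hs r κ
    _ = ∫⁻ τ in Set.Ioo (-1 : ℝ) 1, ∫⁻ y : Fin k → ℝ,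
          ENNReal.ofReal (√(∑ i, y i ^ 2) / √(1 - τ ^ 2) ^ 3) *
            (if √(∑ i, y i ^ 2) ^ 2 < 1 - τ ^ 2 then κ (r * τ) else 0) := by
        refine lintegral_lintegral_swap (Measurable.aemeasurable ?_)
        refine Measurable.mul (by fun_prop) ?_
        refine Measurable.ite (measurableSet_lt (by fun_prop) (by fun_prop)) ?_ measurable_const
        exact hκ.comp (by fun_prop)
    _ ≤ ∫⁻ τ in Set.Ioo (-1 : ℝ) 1, ENNReal.ofReal (2 ^ k) *
          (κ (r * τ) * ENNReal.ofReal ((1 - τ ^ 2) ^ (((k : ℝ) - 2) / 2))) := by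
        refine setLIntegral_mono' measurableSet_Ioo fun τ hτ => ?_
        have h : 0 < 1 - τ ^ 2 := by nlinarith [hτ.1, hτ.2]
        have hc : 0 < √(1 - τ ^ 2) := Real.sqrt_pos.2 h
        have e : ∀ y : Fin k → ℝ, ENNReal.ofReal (√(∑ i, y i ^ 2) / √(1 - τ ^ 2) ^ 3) *
            (if √(∑ i, y i ^ 2) ^ 2 < 1 - τ ^ 2 then κ (r * τ) else 0) =
            (κ (r * τ) * ENNReal.ofReal (1 / √(1 - τ ^ 2) ^ 3)) *
              (if √(∑ i, y i ^ 2) ^ 2 < √(1 - τ ^ 2) ^ 2 then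
                ENNReal.ofReal √(∑ i, y i ^ 2) else 0) := fun y => by
          rw [Real.sq_sqrt h.le]
          split_ifs
          · rw [div_eq_mul_one_div, ENNReal.ofReal_mul (Real.sqrt_nonneg _)]
            ring
          · simp
        simp only [e]
        rw [lintegral_const_mul _ (Measurable.ite (measurableSet_lt (by fun_prop) (by fun_prop))
          (by fun_prop) measurable_const)]
        refine (mul_le_mul_right (lintegral_sqrt_sum_sq_le k hc) _).trans (le_of_eq ?_)
        rw [mul_assoc, ← ENNReal.ofReal_mul (by positivity),
          mul_left_comm (ENNReal.ofReal (2 ^ k)), ← ENNReal.ofReal_mul (by positivity)]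
        congr 2
        have e2 : (1 - τ ^ 2) ^ (((k : ℝ) - 2) / 2) = √(1 - τ ^ 2) ^ (k - 2) := by
          rw [Real.sqrt_eq_rpow, ← Real.rpow_mul_natCast h.le, Nat.cast_sub hk]
          congr 1
          push_cast
          ring
        rw [e2]
        obtain ⟨l, rfl⟩ := Nat.exists_eq_add_of_le hk
        have : 2 + l - 2 = l := by omega
        rw [this]
        field_simp
        ring
    _ = _ := by
        rw [lintegral_const_mul]
        exact (hκ.comp (by fun_prop)).mul (by fun_prop)

/-- Distribution of the cosine `x · ω` over random directions `ω = z / |z|`. Averaging over the ball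
instead of the sphere avoids surface measure. The general case follows from `lintegral_ball_axis_le`
by the reflection that takes `x` to the first axis. -/
theorem lintegral_ball_direction_le (k : ℕ) (hk : 2 ≤ k) (x : EuclideanSpace ℝ (Fin (k + 1)))
    (κ : ℝ → ℝ≥0∞) (hκ : Measurable κ) :
    ∫⁻ z in Metric.ball (0 : EuclideanSpace ℝ (Fin (k + 1))) 1, κ (inner ℝ x (‖z‖⁻¹ • z)) ≤
      ENNReal.ofReal (2 ^ k) * ∫⁻ τ in Set.Ioo (-1 : ℝ) 1,
        κ (‖x‖ * τ) * ENNReal.ofReal ((1 - τ ^ 2) ^ (((k : ℝ) - 2) / 2)) := by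
  set y : EuclideanSpace ℝ (Fin (k + 1)) := EuclideanSpace.single 0 ‖x‖ with hy
  have hxy : ‖x‖ = ‖y‖ := by simp [hy]
  set A := (Submodule.span ℝ {x - y})ᗮ.reflection with hA
  have hAx : A x = y := Submodule.reflection_sub hxy
  have hmp : MeasurePreserving A volume volume := A.measurePreserving
  refine le_trans (le_of_eq ?_) (lintegral_ball_axis_le k hk ‖x‖ κ hκ)
  have hm : Measurable fun z : EuclideanSpace ℝ (Fin (k + 1)) =>
      (Metric.ball (0 : EuclideanSpace ℝ (Fin (k + 1))) 1).indicator
        (fun z => κ (‖x‖ * (z 0 / ‖z‖))) z := by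
    refine Measurable.indicator (hκ.comp ?_) measurableSet_ball
    fun_prop
  rw [← lintegral_indicator measurableSet_ball, ← lintegral_indicator measurableSet_ball,
    ← hmp.lintegral_comp hm]
  refine lintegral_congr fun z => ?_
  have hb : A z ∈ Metric.ball (0 : EuclideanSpace ℝ (Fin (k + 1))) 1 ↔
      z ∈ Metric.ball (0 : EuclideanSpace ℝ (Fin (k + 1))) 1 := by
    simp
  have hin : inner ℝ x (‖z‖⁻¹ • z) = ‖x‖ * ((A z) 0 / ‖A z‖) := by
    rw [← A.inner_map_map, hAx, map_smul, inner_smul_right, hy, EuclideanSpace.inner_single_left,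
      A.norm_map]
    simp
    ring
  by_cases h : z ∈ Metric.ball (0 : EuclideanSpace ℝ (Fin (k + 1))) 1
  · rw [Set.indicator_of_mem h, Set.indicator_of_mem (hb.2 h), hin]
  · rw [Set.indicator_of_notMem h, Set.indicator_of_notMem (fun h' => h (hb.1 h'))]

/-! ### The `Lᵖ` norm and averages over planes -/

theorem inner_direction_le {n : ℕ} (x z : EuclideanSpace ℝ (Fin n)) :
    inner ℝ x (‖z‖⁻¹ • z) ≤ ‖x‖ := by
  refine (real_inner_le_norm _ _).trans ?_
  refine mul_le_of_le_one_right (norm_nonneg _) ?_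
  rw [norm_smul, norm_inv, norm_norm]
  exact inv_mul_le_one

/-- The form of `lintegral_ball_direction_le` for points `x` of a ball of radius `M` and functions of
`ρ = x · ω` supported in `ρ ≥ M / 32`, with `1 - τ²` estimated by a multiple of `(M - ρ) / M`. -/
theorem lintegral_ball_direction_le_of_support (k : ℕ) (hk : 2 ≤ k)
    (x : EuclideanSpace ℝ (Fin (k + 1))) {M : ℝ} (hM : 0 < M) (hx : ‖x‖ ≤ M)
    (κ : ℝ → ℝ≥0∞) (hκ : Measurable κ) (hκ0 : ∀ ρ < M / 32, κ ρ = 0) :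
    ∫⁻ z in Metric.ball (0 : EuclideanSpace ℝ (Fin (k + 1))) 1, κ (inner ℝ x (‖z‖⁻¹ • z)) ≤
      ENNReal.ofReal (2 ^ k * 32 * 64 ^ (((k : ℝ) - 2) / 2) * M ^ (-((k : ℝ) / 2))) *
        ∫⁻ ρ in Set.Iio ‖x‖, κ ρ * ENNReal.ofReal ((M - ρ) ^ (((k : ℝ) - 2) / 2)) := by
  have he : (0 : ℝ) ≤ ((k : ℝ) - 2) / 2 := by
    have : (2 : ℝ) ≤ k := by exact_mod_cast hk
    linarith
  set e : ℝ := ((k : ℝ) - 2) / 2 with hedef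
  rcases lt_or_ge ‖x‖ (M / 32) with hr | hr
  · have : ∀ z : EuclideanSpace ℝ (Fin (k + 1)), κ (inner ℝ x (‖z‖⁻¹ • z)) = 0 := fun z =>
      hκ0 _ ((inner_direction_le x z).trans_lt hr)
    simp [this]
  · have hr0 : 0 < ‖x‖ := lt_of_lt_of_le (by positivity) hr
    refine (lintegral_ball_direction_le k hk x κ hκ).trans ?_
    set h : ℝ → ℝ≥0∞ := fun ρ => ENNReal.ofReal (32 * 64 ^ e * M ^ (-((k : ℝ) / 2))) *
      (κ ρ * ENNReal.ofReal ((M - ρ) ^ e)) with hh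
    have hmeas : Measurable fun ρ => κ ρ * ENNReal.ofReal ((M - ρ) ^ e) :=
      hκ.mul (by fun_prop)
    have h1 : ∫⁻ τ in Set.Ioo (-1 : ℝ) 1, κ (‖x‖ * τ) * ENNReal.ofReal ((1 - τ ^ 2) ^ e) ≤
        ∫⁻ τ in Set.Ioo (-1 : ℝ) 1, ENNReal.ofReal |‖x‖| * h (‖x‖ * τ) := by
      refine setLIntegral_mono' measurableSet_Ioo fun τ hτ => ?_
      have hτ0 : 0 < 1 - τ ^ 2 := by nlinarith [hτ.1, hτ.2]
      have hY : 0 < M - ‖x‖ * τ := by nlinarith [hτ.2]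
      have hb : 1 - τ ^ 2 ≤ 64 * (M - ‖x‖ * τ) / M := by
        rw [le_div_iff₀ hM]
        have h3 : 1 - τ ^ 2 ≤ 2 * (1 - τ) := by nlinarith [sq_nonneg (1 - τ)]
        nlinarith [hτ.2]
      rw [hh, abs_of_pos hr0]
      simp only
      rw [mul_left_comm _ (κ _), mul_left_comm _ (κ _)]
      refine mul_le_mul_right ?_ _
      rw [← ENNReal.ofReal_mul (by positivity), ← ENNReal.ofReal_mul (by positivity)]
      refine ENNReal.ofReal_le_ofReal ?_
      calc (1 - τ ^ 2) ^ e ≤ (64 * (M - ‖x‖ * τ) / M) ^ e :=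
            Real.rpow_le_rpow hτ0.le hb he
        _ = 64 ^ e * (M - ‖x‖ * τ) ^ e * M ^ (-e) := by
            rw [Real.div_rpow (by positivity) hM.le, Real.mul_rpow (by norm_num) hY.le,
              Real.rpow_neg hM.le]
            rfl
        _ ≤ (32 * ‖x‖ / M) * (64 ^ e * (M - ‖x‖ * τ) ^ e * M ^ (-e)) := by
            refine le_mul_of_one_le_left (by positivity) ?_
            rw [le_div_iff₀ hM]
            linarith
        _ = _ := by
            have : M ^ (-((k : ℝ) / 2)) = M ^ (-e) / M := by
              rw [← Real.rpow_sub_one hM.ne', hedef]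
              congr 1
              ring
            rw [this]
            field_simp
    have h2 : ∫⁻ τ in Set.Ioo (-1 : ℝ) 1, ENNReal.ofReal |‖x‖| * h (‖x‖ * τ) ≤
        ∫⁻ ρ in Set.Iio ‖x‖, h ρ := by
      rw [← lintegral_image_eq_lintegral_abs_deriv_mul (f := fun τ => ‖x‖ * τ)
        (f' := fun _ => ‖x‖) measurableSet_Ioo
        (fun τ _ => by simpa using ((hasDerivAt_id τ).const_mul ‖x‖).hasDerivWithinAt)
        (fun a _ b _ hab => mul_left_cancel₀ hr0.ne' hab)]
      refine lintegral_mono_set ?_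
      rintro _ ⟨τ, hτ, rfl⟩
      simp only [Set.mem_Iio]
      nlinarith [hτ.2]
    refine (mul_le_mul_right (h1.trans h2) _).trans (le_of_eq ?_)
    rw [hh, lintegral_const_mul _ hmeas, ← mul_assoc, ← ENNReal.ofReal_mul (by positivity)]
    congr 2
    ring

theorem lintegral_Iio_rpow (M r δ : ℝ) (hr : r < M) (hδ : 0 < δ) :
    ∫⁻ ρ in Set.Iio r, ENNReal.ofReal ((M - ρ) ^ (-1 - δ)) =
      ENNReal.ofReal ((M - r) ^ (-δ) / δ) := by
  have h1 : ∫⁻ ρ in Set.Iio r, ENNReal.ofReal ((M - ρ) ^ (-1 - δ)) =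
      ∫⁻ y in Set.Ioi (M - r), ENNReal.ofReal (y ^ (-1 - δ)) := by
    rw [← lintegral_indicator measurableSet_Iio, ← lintegral_indicator measurableSet_Ioi,
      ← lintegral_sub_left_eq_self
        ((Set.Ioi (M - r)).indicator fun y => ENNReal.ofReal (y ^ (-1 - δ))) M]
    refine lintegral_congr fun ρ => ?_
    simp only [Set.indicator, Set.mem_Iio, Set.mem_Ioi, sub_lt_sub_iff_left]
  have hpos : 0 < M - r := by linarith
  rw [h1, ← ofReal_integral_eq_lintegral_ofReal
    (integrableOn_Ioi_rpow_of_lt (by linarith) hpos), integral_Ioi_rpow_of_lt (by linarith) hpos]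
  · congr 1
    have : -1 - δ + 1 = -δ := by ring
    rw [this]
    field_simp
  · filter_upwards [ae_restrict_mem measurableSet_Ioi] with y hy
    exact Real.rpow_nonneg (hpos.trans hy).le _

theorem lintegral_shell_le (k : ℕ) {M ρ : ℝ} (hρ : 0 ≤ ρ) (hM : ρ < M) :
    ∫⁻ x : EuclideanSpace ℝ (Fin (k + 1)),
        ENNReal.ofReal ((Set.Ioo ρ M).indicator (fun r => (M - r) ^ (-(1 / 2) : ℝ)) ‖x‖) ≤
      ENNReal.ofReal ((k + 1) * volume.real (Metric.ball (0 : EuclideanSpace ℝ (Fin (k + 1))) 1) *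
        (M ^ k * (2 * (M - ρ) ^ (1 / 2 : ℝ)))) := by
  set f : ℝ → ℝ := (Set.Ioo ρ M).indicator (fun r => (M - r) ^ (-(1 / 2) : ℝ)) with hf
  have hint : IntervalIntegrable (fun r => (M - r) ^ (-(1 / 2) : ℝ)) volume ρ M := by
    have h := (intervalIntegral.intervalIntegrable_rpow' (a := M - ρ) (b := M - M)
      (r := (-(1 / 2) : ℝ)) (by norm_num)).comp_sub_left M
    simpa using h
  have hval : ∫ r in ρ..M, (M - r) ^ (-(1 / 2) : ℝ) = 2 * (M - ρ) ^ (1 / 2 : ℝ) := by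
    rw [intervalIntegral.integral_comp_sub_left (fun r => r ^ (-(1 / 2) : ℝ)) M,
      integral_rpow (Or.inl (by norm_num))]
    norm_num
    ring
  have hfi : Integrable f := by
    rw [hf, integrable_indicator_iff measurableSet_Ioo]
    exact (intervalIntegrable_iff_integrableOn_Ioo_of_le hM.le).1 hint
  have hf0 : ∀ y, 0 ≤ f y := fun y => by
    refine Set.indicator_nonneg (fun r hr => ?_) y
    exact Real.rpow_nonneg (by linarith [hr.2]) _
  have hle : ∀ y ∈ Set.Ioi (0 : ℝ), y ^ k * f y ≤ M ^ k * f y := fun y hy => by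
    by_cases h : y ∈ Set.Ioo ρ M
    · exact mul_le_mul_of_nonneg_right (pow_le_pow_left₀ (le_of_lt hy) h.2.le _) (hf0 y)
    · simp [hf, h]
  have hki : IntegrableOn (fun y => y ^ k * f y) (Set.Ioi 0) := by
    refine Integrable.mono' ((hfi.const_mul (M ^ k)).integrableOn) ?_ ?_
    · exact ((measurable_id.pow_const k).aestronglyMeasurable.mul
        hfi.aestronglyMeasurable).restrict
    · filter_upwards [ae_restrict_mem measurableSet_Ioi] with y hy
      rw [Real.norm_of_nonneg (mul_nonneg (pow_nonneg (le_of_lt hy) _) (hf0 y))]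
      exact hle y hy
  have hnorm : Integrable fun x : EuclideanSpace ℝ (Fin (k + 1)) => f ‖x‖ := by
    rw [integrable_fun_norm_addHaar volume]
    simpa using hki
  rw [← ofReal_integral_eq_lintegral_ofReal hnorm (ae_of_all _ fun x => hf0 _)]
  refine ENNReal.ofReal_le_ofReal ?_
  rw [integral_fun_norm_addHaar volume]
  simp only [finrank_euclideanSpace, Fintype.card_fin, Nat.add_sub_cancel, smul_eq_mul,
    nsmul_eq_mul]
  push_cast
  rw [mul_assoc]
  refine mul_le_mul_of_nonneg_left (mul_le_mul_of_nonneg_left ?_ measureReal_nonneg)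
    (by positivity)
  calc ∫ y in Set.Ioi (0 : ℝ), y ^ k * f y ≤ ∫ y in Set.Ioi (0 : ℝ), M ^ k * f y :=
        setIntegral_mono_on hki (hfi.const_mul _).integrableOn measurableSet_Ioi hle
    _ ≤ ∫ y, M ^ k * f y :=
        setIntegral_le_integral (hfi.const_mul _)
          (ae_of_all _ fun y => mul_nonneg (pow_nonneg (hρ.trans hM.le) _) (hf0 y))
    _ = M ^ k * (2 * (M - ρ) ^ (1 / 2 : ℝ)) := by
        rw [integral_const_mul, hf, integral_indicator measurableSet_Ioo,
          ← integral_Ioc_eq_integral_Ioo, ← intervalIntegral.integral_of_le hM.le, hval]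

/-- The weight that is inserted in Hölder's inequality over pairs of a direction `ω` and a point `x`,
as a function of `ρ = x · ω` and `r = |x|`. The first factor compensates the density of `ρ` for fixed
`x`. The second one makes the remaining power of `M - ρ` integrable up to `ρ = r`; any small positive
`δ` serves. -/
noncomputable def capWeight (k : ℕ) (δ M ρ r : ℝ) : ℝ :=
  (M / (M - ρ)) ^ ((k : ℝ) / 2) * ((M - r) / (M - ρ)) ^ δ

theorem capWeight_pos (k : ℕ) (δ : ℝ) {M ρ r : ℝ} (hM : 0 < M) (hρ : ρ < M) (hr : r < M) :
    0 < capWeight k δ M ρ r := by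
  have h1 : 0 < M - ρ := by linarith
  have h2 : 0 < M - r := by linarith
  unfold capWeight
  positivity

theorem measurable_capWeight (k : ℕ) (δ M : ℝ) :
    Measurable fun w : ℝ × ℝ => capWeight k δ M w.1 w.2 := by
  unfold capWeight
  fun_prop

/-- The factor of Hölder's inequality that carries `f`: the weight has bounded average over
directions, uniformly in the point `x`. -/
theorem lintegral_capWeight_le (k : ℕ) (hk : 2 ≤ k) {δ : ℝ} (hδ : 0 < δ) :
    ∃ c : ℝ, 0 < c ∧ ∀ M : ℝ, 0 < M → ∀ x : EuclideanSpace ℝ (Fin (k + 1)), ‖x‖ < M →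
      ∫⁻ z in Metric.ball (0 : EuclideanSpace ℝ (Fin (k + 1))) 1,
        (Set.Ico (M / 32) M).indicator (fun ρ => ENNReal.ofReal (capWeight k δ M ρ ‖x‖))
          (inner ℝ x (‖z‖⁻¹ • z)) ≤ ENNReal.ofReal c := by
  refine ⟨2 ^ k * 32 * 64 ^ (((k : ℝ) - 2) / 2) * (1 / δ), by positivity, ?_⟩
  intro M hM x hx
  have hm : Measurable ((Set.Ico (M / 32) M).indicator
      (fun ρ => ENNReal.ofReal (capWeight k δ M ρ ‖x‖))) := by
    refine Measurable.indicator ?_ measurableSet_Ico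
    exact ((measurable_capWeight k δ M).comp (by fun_prop : Measurable fun ρ : ℝ => (ρ, ‖x‖))
      ).ennreal_ofReal
  refine (lintegral_ball_direction_le_of_support k hk x hM hx.le _ hm ?_).trans ?_
  · intro ρ hρ
    rw [Set.indicator_of_notMem]
    exact fun h => absurd h.1 (not_le.2 hρ)
  · have hζ : 0 < M - ‖x‖ := by linarith
    have hb : ∫⁻ ρ in Set.Iio ‖x‖, (Set.Ico (M / 32) M).indicator
          (fun ρ => ENNReal.ofReal (capWeight k δ M ρ ‖x‖)) ρ *
            ENNReal.ofReal ((M - ρ) ^ (((k : ℝ) - 2) / 2)) ≤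
        ∫⁻ ρ in Set.Iio ‖x‖, ENNReal.ofReal (M ^ ((k : ℝ) / 2) * (M - ‖x‖) ^ δ) *
          ENNReal.ofReal ((M - ρ) ^ (-1 - δ)) := by
      refine setLIntegral_mono' measurableSet_Iio fun ρ hρ => ?_
      have hY : 0 < M - ρ := by
        have : ρ < ‖x‖ := hρ
        linarith
      refine (mul_le_mul_left (Set.indicator_le_self' (fun _ _ => zero_le) ρ) _).trans
        (le_of_eq ?_)
      rw [← ENNReal.ofReal_mul (capWeight_pos k δ hM (by linarith) hx).le,
        ← ENNReal.ofReal_mul (by positivity)]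
      congr 1
      unfold capWeight
      rw [Real.div_rpow hM.le hY.le, Real.div_rpow hζ.le hY.le]
      have : (M - ρ) ^ (-1 - δ) = (M - ρ) ^ (((k : ℝ) - 2) / 2) /
          ((M - ρ) ^ ((k : ℝ) / 2) * (M - ρ) ^ δ) := by
        rw [← Real.rpow_add hY, ← Real.rpow_sub hY]
        congr 1
        ring
      rw [this]
      field_simp
    refine (mul_le_mul_right hb _).trans (le_of_eq ?_)
    rw [lintegral_const_mul _ (by fun_prop), lintegral_Iio_rpow M ‖x‖ δ hx hδ,
      ← ENNReal.ofReal_mul (by positivity), ← ENNReal.ofReal_mul (by positivity)]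
    congr 1
    rw [Real.rpow_neg hM.le, Real.rpow_neg hζ.le]
    have h1 : M ^ ((k : ℝ) / 2) ≠ 0 := by positivity
    have h2 : (M - ‖x‖) ^ δ ≠ 0 := by positivity
    field_simp

/-- The factor of Hölder's inequality that carries the test function. The exponent `γ δ = 1/2`
makes the singularity at `‖x‖ = M` integrable. -/
theorem lintegral_capWeight_neg_le (k : ℕ) (hk : 2 ≤ k) {δ γ : ℝ} (hδγ : δ * γ = 1 / 2) :
    ∃ c : ℝ, 0 < c ∧ ∀ M : ℝ, 0 < M → ∀ φ : ℝ → ℝ≥0∞, Measurable φ →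
      (∀ ρ, φ ρ ≠ 0 → M / 32 ≤ ρ ∧ ρ < M) →
      ∫⁻ x in Metric.ball (0 : EuclideanSpace ℝ (Fin (k + 1))) M,
        ∫⁻ z in Metric.ball (0 : EuclideanSpace ℝ (Fin (k + 1))) 1,
          (fun ρ => φ ρ * ENNReal.ofReal (capWeight k δ M ρ ‖x‖ ^ (-γ)))
            (inner ℝ x (‖z‖⁻¹ • z)) ≤
      ENNReal.ofReal (c * M ^ ((k : ℝ) * (1 - (γ + 1) / 2))) *
        ∫⁻ ρ, φ ρ * ENNReal.ofReal ((M - ρ) ^ ((k : ℝ) * (γ + 1) / 2)) := by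
  set V := volume.real (Metric.ball (0 : EuclideanSpace ℝ (Fin (k + 1))) 1) with hV
  have hVpos : 0 < V := by
    rw [hV, measureReal_def]
    exact ENNReal.toReal_pos (Metric.measure_ball_pos _ _ one_pos).ne' measure_ball_lt_top.ne
  refine ⟨2 ^ k * 32 * 64 ^ (((k : ℝ) - 2) / 2) * ((k + 1) * V * 2), by positivity, ?_⟩
  intro M hM φ hφ hsupp
  set c₁ := (2 ^ k * 32 * 64 ^ (((k : ℝ) - 2) / 2) * M ^ (-((k : ℝ) / 2))) with hc₁
  have hc₁0 : 0 ≤ c₁ := by positivity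
  set a : ℝ := ((k : ℝ) * γ + k - 1) / 2 with ha
  -- the integrand after integration over directions, with the dependence on `‖x‖` isolated
  have step1 : ∀ x ∈ Metric.ball (0 : EuclideanSpace ℝ (Fin (k + 1))) M,
      ∫⁻ z in Metric.ball (0 : EuclideanSpace ℝ (Fin (k + 1))) 1,
          (fun ρ => φ ρ * ENNReal.ofReal (capWeight k δ M ρ ‖x‖ ^ (-γ)))
            (inner ℝ x (‖z‖⁻¹ • z)) ≤
      ENNReal.ofReal c₁ * ∫⁻ ρ, φ ρ * ENNReal.ofReal (M ^ (-((k : ℝ) * γ / 2)) * (M - ρ) ^ a) *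
        ENNReal.ofReal ((Set.Ioo ρ M).indicator (fun r => (M - r) ^ (-(1 / 2) : ℝ)) ‖x‖) := by
    intro x hx
    rw [mem_ball_zero_iff] at hx
    have hm : Measurable (fun ρ => φ ρ * ENNReal.ofReal (capWeight k δ M ρ ‖x‖ ^ (-γ))) := by
      refine hφ.mul (Measurable.ennreal_ofReal (Measurable.pow_const ?_ _))
      exact (measurable_capWeight k δ M).comp (by fun_prop : Measurable fun ρ : ℝ => (ρ, ‖x‖))
    refine (lintegral_ball_direction_le_of_support k hk x hM hx.le _ hm ?_).trans ?_
    · intro ρ hρ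
      by_cases h0 : φ ρ = 0
      · simp [h0]
      · exact absurd (hsupp ρ h0).1 (not_le.2 hρ)
    · refine mul_le_mul_right ?_ _
      rw [← lintegral_indicator measurableSet_Iio]
      refine lintegral_mono fun ρ => ?_
      by_cases hρ : ρ < ‖x‖
      · have hY : 0 < M - ρ := by linarith
        have hζ : 0 < M - ‖x‖ := by linarith
        rw [Set.indicator_of_mem (show ρ ∈ Set.Iio ‖x‖ from hρ),
          Set.indicator_of_mem (show ‖x‖ ∈ Set.Ioo ρ M from ⟨hρ, hx⟩), mul_assoc, mul_assoc]
        refine mul_le_mul_right (le_of_eq ?_) _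
        rw [← ENNReal.ofReal_mul (Real.rpow_nonneg
            (capWeight_pos k δ hM (by linarith) hx).le _), ← ENNReal.ofReal_mul (by positivity)]
        congr 1
        unfold capWeight
        rw [Real.mul_rpow (by positivity) (by positivity), ← Real.rpow_mul (by positivity),
          ← Real.rpow_mul (by positivity), Real.div_rpow hM.le hY.le, Real.div_rpow hζ.le hY.le]
        have e1 : δ * -γ = -(1 / 2) := by rw [mul_neg, hδγ]
        have e2 : (k : ℝ) / 2 * -γ = -((k : ℝ) * γ / 2) := by ring
        have e3 : (M - ρ) ^ a = (M - ρ) ^ (((k : ℝ) - 2) / 2) /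
            ((M - ρ) ^ (-((k : ℝ) * γ / 2)) * (M - ρ) ^ (-(1 / 2) : ℝ)) := by
          rw [← Real.rpow_add hY, ← Real.rpow_sub hY, ha]
          congr 1
          ring
        rw [e1, e2, e3]
        field_simp
      · rw [Set.indicator_of_notMem (show ρ ∉ Set.Iio ‖x‖ from hρ)]
        exact zero_le
  have hmeas2 : Measurable fun w : EuclideanSpace ℝ (Fin (k + 1)) × ℝ =>
      φ w.2 * ENNReal.ofReal (M ^ (-((k : ℝ) * γ / 2)) * (M - w.2) ^ a) *
        ENNReal.ofReal ((Set.Ioo w.2 M).indicator (fun r => (M - r) ^ (-(1 / 2) : ℝ)) ‖w.1‖) := by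
    have h1 : Measurable fun w : EuclideanSpace ℝ (Fin (k + 1)) × ℝ =>
        ENNReal.ofReal (M ^ (-((k : ℝ) * γ / 2)) * (M - w.2) ^ a) := by fun_prop
    refine ((hφ.comp measurable_snd).mul h1).mul (Measurable.ennreal_ofReal ?_)
    have : (fun w : EuclideanSpace ℝ (Fin (k + 1)) × ℝ =>
        (Set.Ioo w.2 M).indicator (fun r => (M - r) ^ (-(1 / 2) : ℝ)) ‖w.1‖) =
        {w : EuclideanSpace ℝ (Fin (k + 1)) × ℝ | w.2 < ‖w.1‖ ∧ ‖w.1‖ < M}.indicator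
          (fun w => (M - ‖w.1‖) ^ (-(1 / 2) : ℝ)) := by
      funext w
      simp [Set.indicator]
    rw [this]
    refine Measurable.indicator (by fun_prop) ?_
    exact (measurableSet_lt measurable_snd measurable_fst.norm).inter
      (measurableSet_lt measurable_fst.norm measurable_const)
  calc _ ≤ ∫⁻ x in Metric.ball (0 : EuclideanSpace ℝ (Fin (k + 1))) M,
        ENNReal.ofReal c₁ * ∫⁻ ρ, φ ρ *
          ENNReal.ofReal (M ^ (-((k : ℝ) * γ / 2)) * (M - ρ) ^ a) *
            ENNReal.ofReal ((Set.Ioo ρ M).indicator (fun r => (M - r) ^ (-(1 / 2) : ℝ)) ‖x‖) :=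
        setLIntegral_mono' measurableSet_ball step1
    _ ≤ ∫⁻ x : EuclideanSpace ℝ (Fin (k + 1)), ENNReal.ofReal c₁ * ∫⁻ ρ, φ ρ *
          ENNReal.ofReal (M ^ (-((k : ℝ) * γ / 2)) * (M - ρ) ^ a) *
            ENNReal.ofReal ((Set.Ioo ρ M).indicator (fun r => (M - r) ^ (-(1 / 2) : ℝ)) ‖x‖) :=
        setLIntegral_le_lintegral _ _
    _ = ENNReal.ofReal c₁ * ∫⁻ ρ, ∫⁻ x : EuclideanSpace ℝ (Fin (k + 1)), φ ρ *
          ENNReal.ofReal (M ^ (-((k : ℝ) * γ / 2)) * (M - ρ) ^ a) *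
            ENNReal.ofReal ((Set.Ioo ρ M).indicator (fun r => (M - r) ^ (-(1 / 2) : ℝ)) ‖x‖) := by
        rw [lintegral_const_mul _ hmeas2.lintegral_prod_right',
          lintegral_lintegral_swap hmeas2.aemeasurable]
    _ ≤ ENNReal.ofReal c₁ * ∫⁻ ρ, ENNReal.ofReal ((k + 1) * V * 2 * M ^ k *
          M ^ (-((k : ℝ) * γ / 2))) *
            (φ ρ * ENNReal.ofReal ((M - ρ) ^ ((k : ℝ) * (γ + 1) / 2))) := by
        refine mul_le_mul_right (lintegral_mono fun ρ => ?_) _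
        by_cases h0 : φ ρ = 0
        · simp [h0]
        obtain ⟨hρ1, hρ2⟩ := hsupp ρ h0
        have hρ0 : 0 ≤ ρ := le_trans (by positivity) hρ1
        have hY : 0 < M - ρ := by linarith
        simp only
        have hm : Measurable fun x : EuclideanSpace ℝ (Fin (k + 1)) => ENNReal.ofReal
            ((Set.Ioo ρ M).indicator (fun r => (M - r) ^ (-(1 / 2) : ℝ)) ‖x‖) := by
          have : Measurable ((Set.Ioo ρ M).indicator (fun r => (M - r) ^ (-(1 / 2) : ℝ))) :=
            Measurable.indicator (by fun_prop) measurableSet_Ioo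
          exact (this.comp measurable_norm).ennreal_ofReal
        rw [lintegral_const_mul _ hm]
        refine (mul_le_mul_right (lintegral_shell_le k hρ0 hρ2) _).trans (le_of_eq ?_)
        rw [mul_assoc, mul_left_comm (ENNReal.ofReal _) (φ ρ),
          ← ENNReal.ofReal_mul (by positivity), ← ENNReal.ofReal_mul (by positivity)]
        congr 2
        have e3 : (M - ρ) ^ ((k : ℝ) * (γ + 1) / 2) = (M - ρ) ^ a * (M - ρ) ^ (1 / 2 : ℝ) := by
          rw [← Real.rpow_add hY, ha]
          congr 1
          ring
        rw [e3]
        ring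
    _ = _ := by
        have hm : Measurable fun ρ =>
            φ ρ * ENNReal.ofReal ((M - ρ) ^ ((k : ℝ) * (γ + 1) / 2)) := hφ.mul (by fun_prop)
        rw [lintegral_const_mul _ hm, ← mul_assoc,
          ← ENNReal.ofReal_mul hc₁0]
        congr 2
        have e4 : M ^ ((k : ℝ) * (1 - (γ + 1) / 2)) =
            M ^ (-((k : ℝ) / 2)) * M ^ k * M ^ (-((k : ℝ) * γ / 2)) := by
          rw [← Real.rpow_natCast, ← Real.rpow_add hM, ← Real.rpow_add hM]
          congr 1
          ring
        rw [e4, hc₁]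
        ring

set_option maxHeartbeats 1000000 in
/-- Lower bounds for the `Lᵖ` norm by plane averages. If `f` lives in the ball of radius `M` and
all its plane averages against `φ` are at least `J`, then `∫ fᵖ` is bounded below with the
sharp power of `M`. The weight `(M - ρ)^(k p' / 2)` reflects that the plane `x · e = ρ` meets the ball
in a disc of radius at most `√(2 M (M - ρ))`. -/
theorem rpow_le_of_le_plane_averages (k : ℕ) (hk : 2 ≤ k) {p p' : ℝ} (hp : p.HolderConjugate p') :
    ∃ c : ℝ, 0 < c ∧ ∀ M : ℝ, 0 < M → ∀ φ : ℝ → ℝ, Measurable φ → (∀ ρ, 0 ≤ φ ρ) →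
      (∀ ρ, φ ρ ≠ 0 → M / 32 ≤ ρ ∧ ρ < M) →
      ∀ f : EuclideanSpace ℝ (Fin (k + 1)) → ℝ≥0∞, Measurable f → (∀ x, M ≤ ‖x‖ → f x = 0) →
      ∀ J : ℝ≥0∞, (∀ e : EuclideanSpace ℝ (Fin (k + 1)), ‖e‖ = 1 →
        J ≤ ∫⁻ x, f x * ENNReal.ofReal (φ (inner ℝ x e))) →
      J ^ p ≤ ENNReal.ofReal (c * M ^ (-((k : ℝ) * (1 - p / 2)))) * (∫⁻ x, f x ^ p) *
        (∫⁻ ρ, ENNReal.ofReal (φ ρ ^ p' * (M - ρ) ^ ((k : ℝ) * p' / 2))) ^ (p - 1) := by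
  have hp1 : 1 < p := hp.lt
  have hp'1 : 1 < p' := hp.symm.lt
  have hconj : (p - 1) * (p' - 1) = 1 := by linarith [hp.sub_one_mul_conj]
  set δ := (p - 1) / 2 with hδ
  set γ := p' - 1 with hγ
  have hδ0 : 0 < δ := by rw [hδ]; linarith
  have hδγ : δ * γ = 1 / 2 := by rw [hδ]; linarith
  obtain ⟨c₁, hc₁, H₁⟩ := lintegral_capWeight_le k hk hδ0
  obtain ⟨c₂, hc₂, H₂⟩ := lintegral_capWeight_neg_le k hk hδγ
  set V := volume (Metric.ball (0 : EuclideanSpace ℝ (Fin (k + 1))) 1) with hV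
  have hV0 : V ≠ 0 := (Metric.measure_ball_pos _ _ one_pos).ne'
  have hVt : V ≠ ⊤ := measure_ball_lt_top.ne
  have hVr : 0 < V.toReal := ENNReal.toReal_pos hV0 hVt
  refine ⟨V.toReal ^ (-p) * c₁ * c₂ ^ (p - 1), by positivity, ?_⟩
  intro M hM φ hφ hφ0 hsupp f hf hf0 J hJ
  set B := Metric.ball (0 : EuclideanSpace ℝ (Fin (k + 1))) 1 with hB
  set μ := (volume : Measure (EuclideanSpace ℝ (Fin (k + 1)))).restrict B with hμ
  set d : EuclideanSpace ℝ (Fin (k + 1)) × EuclideanSpace ℝ (Fin (k + 1)) → ℝ :=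
    fun w => inner ℝ w.2 (‖w.1‖⁻¹ • w.1) with hd
  have hdm : Measurable d := by
    refine Measurable.inner measurable_snd ?_
    exact (measurable_fst.norm.inv).smul measurable_fst
  set K₁ : EuclideanSpace ℝ (Fin (k + 1)) × EuclideanSpace ℝ (Fin (k + 1)) → ℝ≥0∞ := fun w =>
    (Set.Ico (M / 32) M).indicator (fun ρ => ENNReal.ofReal (capWeight k δ M ρ ‖w.2‖)) (d w)
    with hK₁
  set K₂ : EuclideanSpace ℝ (Fin (k + 1)) × EuclideanSpace ℝ (Fin (k + 1)) → ℝ≥0∞ := fun w =>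
    (Metric.ball (0 : EuclideanSpace ℝ (Fin (k + 1))) M).indicator (fun _ =>
      ENNReal.ofReal (φ (d w) ^ p') * ENNReal.ofReal (capWeight k δ M (d w) ‖w.2‖ ^ (-γ))) w.2
    with hK₂
  have hWm : Measurable fun w : EuclideanSpace ℝ (Fin (k + 1)) × EuclideanSpace ℝ (Fin (k + 1)) =>
      capWeight k δ M (d w) ‖w.2‖ :=
    (measurable_capWeight k δ M).comp (hdm.prodMk measurable_snd.norm)
  have hK₁m : Measurable K₁ := by
    have : K₁ = (d ⁻¹' Set.Ico (M / 32) M).indicator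
        (fun w => ENNReal.ofReal (capWeight k δ M (d w) ‖w.2‖)) := by
      funext w
      simp [hK₁, Set.indicator]
    rw [this]
    exact hWm.ennreal_ofReal.indicator (hdm measurableSet_Ico)
  have hK₂m : Measurable K₂ := by
    have : K₂ = (Prod.snd ⁻¹' Metric.ball (0 : EuclideanSpace ℝ (Fin (k + 1))) M).indicator
        (fun w => ENNReal.ofReal (φ (d w) ^ p') *
          ENNReal.ofReal (capWeight k δ M (d w) ‖w.2‖ ^ (-γ))) := by
      funext w
      simp [hK₂, Set.indicator]
    rw [this]
    refine Measurable.indicator ?_ (measurable_snd measurableSet_ball)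
    exact ((hφ.comp hdm).pow_const p').ennreal_ofReal.mul (hWm.pow_const _).ennreal_ofReal
  have hvol : V * J ≤ ∫⁻ z in B, ∫⁻ x, f x * ENNReal.ofReal (φ (inner ℝ x (‖z‖⁻¹ • z))) := by
    rw [mul_comm, hV, ← setLIntegral_const]
    refine lintegral_mono_ae ?_
    have : ∀ᵐ z : EuclideanSpace ℝ (Fin (k + 1)), z ≠ 0 := by simp [ae_iff]
    filter_upwards [ae_restrict_of_ae this] with z hz
    refine hJ _ ?_
    rw [norm_smul, norm_inv, norm_norm, inv_mul_cancel₀ (norm_ne_zero_iff.2 hz)]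
  set F : EuclideanSpace ℝ (Fin (k + 1)) × EuclideanSpace ℝ (Fin (k + 1)) → ℝ≥0∞ := fun w =>
    f w.2 * K₁ w ^ (1 / p) with hF
  set G : EuclideanSpace ℝ (Fin (k + 1)) × EuclideanSpace ℝ (Fin (k + 1)) → ℝ≥0∞ := fun w =>
    K₂ w ^ (1 / p') with hG
  have hFm : Measurable F := (hf.comp measurable_snd).mul (hK₁m.pow_const _)
  have hGm : Measurable G := hK₂m.pow_const _
  have hFG : ∀ w, f w.2 * ENNReal.ofReal (φ (d w)) ≤ (F * G) w := by
    intro w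
    by_cases h0 : φ (d w) = 0
    · simp [h0]
    by_cases hx : ‖w.2‖ < M
    · obtain ⟨h1, h2⟩ := hsupp _ h0
      have hW := capWeight_pos k δ hM h2 hx
      have hφp : 0 < φ (d w) := lt_of_le_of_ne (hφ0 _) (Ne.symm h0)
      simp only [Pi.mul_apply, hF, hG, hK₁, hK₂]
      rw [Set.indicator_of_mem (show d w ∈ Set.Ico (M / 32) M from ⟨h1, h2⟩),
        Set.indicator_of_mem (mem_ball_zero_iff.2 hx), mul_assoc]
      refine mul_le_mul_right (le_of_eq ?_) _
      have hp0 : 0 < p := by linarith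
      have hp'0 : 0 < p' := by linarith
      rw [← ENNReal.ofReal_mul (by positivity), ENNReal.ofReal_rpow_of_pos hW,
        ENNReal.ofReal_rpow_of_pos (by positivity), ← ENNReal.ofReal_mul (by positivity)]
      congr 1
      rw [Real.mul_rpow (by positivity) (by positivity), ← Real.rpow_mul hφp.le,
        ← Real.rpow_mul hW.le, mul_one_div_cancel hp'0.ne', Real.rpow_one, mul_left_comm,
        ← Real.rpow_add hW]
      have : 1 / p + -γ * (1 / p') = 0 := by
        have := hp.inv_add_inv_eq_one
        rw [hγ]
        field_simp
        field_simp at this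
        linarith
      rw [this, Real.rpow_zero, mul_one]
    · rw [hf0 _ (not_lt.1 hx)]
      simp
  have hHold : V * J ≤ (∫⁻ w, F w ^ p ∂(μ.prod volume)) ^ (1 / p) *
      (∫⁻ w, G w ^ p' ∂(μ.prod volume)) ^ (1 / p') := by
    refine hvol.trans (le_trans ?_
      (ENNReal.lintegral_mul_le_Lp_mul_Lq _ hp hFm.aemeasurable hGm.aemeasurable))
    rw [lintegral_prod _ (hFm.mul hGm).aemeasurable]
    exact lintegral_mono fun z => lintegral_mono fun x => hFG (z, x)
  have hFint : ∫⁻ w, F w ^ p ∂(μ.prod volume) ≤ ENNReal.ofReal c₁ * ∫⁻ x, f x ^ p := by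
    rw [lintegral_prod_symm _ (hFm.pow_const _).aemeasurable,
      ← lintegral_const_mul _ (hf.pow_const p)]
    refine lintegral_mono fun x => ?_
    have hp0 : 0 < p := by linarith
    have e : ∀ z, F (z, x) ^ p = f x ^ p * K₁ (z, x) := fun z => by
      simp only [hF]
      rw [ENNReal.mul_rpow_of_nonneg _ _ hp0.le, ← ENNReal.rpow_mul, one_div_mul_cancel hp0.ne',
        ENNReal.rpow_one]
    have hmz : Measurable fun z => K₁ (z, x) := hK₁m.comp (measurable_id.prodMk measurable_const)
    simp only [e]
    rw [lintegral_const_mul _ hmz, mul_comm]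
    by_cases hx : ‖x‖ < M
    · exact mul_le_mul_left (H₁ M hM x hx) _
    · rw [hf0 _ (not_lt.1 hx), ENNReal.zero_rpow_of_pos hp0]
      simp
  have hGint : ∫⁻ w, G w ^ p' ∂(μ.prod volume) ≤
      ENNReal.ofReal (c₂ * M ^ ((k : ℝ) * (1 - p' / 2))) *
        ∫⁻ ρ, ENNReal.ofReal (φ ρ ^ p' * (M - ρ) ^ ((k : ℝ) * p' / 2)) := by
    have hp'0 : 0 < p' := by linarith
    have h := H₂ M hM (fun ρ => ENNReal.ofReal (φ ρ ^ p')) (hφ.pow_const p').ennreal_ofReal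
      (fun ρ h => hsupp ρ (fun h' => h (by
        rw [h', Real.zero_rpow hp'0.ne', ENNReal.ofReal_zero])))
    have e : γ + 1 = p' := by rw [hγ]; ring
    rw [e] at h
    have e2 : ∀ ρ, ENNReal.ofReal (φ ρ ^ p' * (M - ρ) ^ ((k : ℝ) * p' / 2)) =
        ENNReal.ofReal (φ ρ ^ p') * ENNReal.ofReal ((M - ρ) ^ ((k : ℝ) * p' / 2)) := fun ρ =>
      ENNReal.ofReal_mul (Real.rpow_nonneg (hφ0 ρ) _)
    simp only [e2]
    refine le_trans (le_of_eq ?_) h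
    rw [lintegral_prod_symm _ (hGm.pow_const _).aemeasurable, ← lintegral_indicator
      measurableSet_ball]
    refine lintegral_congr fun x => ?_
    have e3 : ∀ z, G (z, x) ^ p' = K₂ (z, x) := fun z => by
      simp only [hG]
      rw [← ENNReal.rpow_mul, one_div_mul_cancel hp'0.ne', ENNReal.rpow_one]
    simp only [e3]
    by_cases hx : x ∈ Metric.ball (0 : EuclideanSpace ℝ (Fin (k + 1))) M
    · simp only [hK₂, Set.indicator_of_mem hx]
      rfl
    · simp only [hK₂, Set.indicator_of_notMem hx]
      simp
  have hp0 : 0 < p := by linarith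
  have hmain : (V * J) ^ p ≤ (ENNReal.ofReal c₁ * ∫⁻ x, f x ^ p) *
      (ENNReal.ofReal (c₂ * M ^ ((k : ℝ) * (1 - p' / 2))) *
        ∫⁻ ρ, ENNReal.ofReal (φ ρ ^ p' * (M - ρ) ^ ((k : ℝ) * p' / 2))) ^ (p - 1) := by
    refine (ENNReal.rpow_le_rpow hHold hp0.le).trans ?_
    rw [ENNReal.mul_rpow_of_nonneg _ _ hp0.le, ← ENNReal.rpow_mul, ← ENNReal.rpow_mul,
      one_div_mul_cancel hp0.ne', ENNReal.rpow_one]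
    have : 1 / p' * p = p - 1 := by
      have h1 : p' ≠ 0 := by linarith
      field_simp
      linarith
    rw [this]
    exact mul_le_mul' hFint (ENNReal.rpow_le_rpow hGint (by linarith))
  have hJeq : J ^ p = ENNReal.ofReal (V.toReal ^ (-p)) * (V * J) ^ p := by
    rw [ENNReal.mul_rpow_of_nonneg _ _ hp0.le, ← mul_assoc]
    nth_rewrite 2 [← ENNReal.ofReal_toReal hVt]
    rw [ENNReal.ofReal_rpow_of_pos hVr, ← ENNReal.ofReal_mul (by positivity),
      ← Real.rpow_add hVr, neg_add_cancel, Real.rpow_zero, ENNReal.ofReal_one, one_mul]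
  rw [hJeq]
  refine (mul_le_mul_right hmain _).trans (le_of_eq ?_)
  rw [ENNReal.mul_rpow_of_nonneg _ _ (by linarith : (0 : ℝ) ≤ p - 1),
    ENNReal.ofReal_rpow_of_pos (by positivity)]
  have hre : V.toReal ^ (-p) * c₁ * c₂ ^ (p - 1) * M ^ (-((k : ℝ) * (1 - p / 2))) =
      V.toReal ^ (-p) * c₁ * (c₂ * M ^ ((k : ℝ) * (1 - p' / 2))) ^ (p - 1) := by
    rw [Real.mul_rpow hc₂.le (by positivity), ← Real.rpow_mul hM.le]
    have : (k : ℝ) * (1 - p' / 2) * (p - 1) = -((k : ℝ) * (1 - p / 2)) := by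
      have : p' * (p - 1) = p := by linarith
      linear_combination (-(k : ℝ) / 2) * this
    rw [this]
    ring
  rw [hre, ENNReal.ofReal_mul (by positivity), ENNReal.ofReal_mul (by positivity)]
  ring

/-! ### Testing functions supported in the cone -/

/-- `m(t)` vanishes for `|x| > t + R`. -/
def VanishesOutsideCone {n : ℕ} {F : Type} [Zero F] (R : ℝ) (T : EReal)
    (m : ℝ → EuclideanSpace ℝ (Fin n) → F) : Prop :=
  ∀ t ∈ timeInterval T, ∀ᵐ x : EuclideanSpace ℝ (Fin n), t + R < ‖x‖ → m t x = 0

theorem mem_timeInterval_of_le {T : EReal} {s t : ℝ} (ht : t ∈ timeInterval T) (hs : 0 ≤ s)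
    (hst : s ≤ t) : s ∈ timeInterval T :=
  ⟨hs, lt_of_le_of_lt (EReal.coe_le_coe_iff.2 hst) ht.2⟩

theorem Icc_subset_timeInterval {T : EReal} {t : ℝ} (ht : t ∈ timeInterval T) :
    Set.Icc 0 t ⊆ timeInterval T := fun _ hs => mem_timeInterval_of_le ht hs.1 hs.2

theorem exists_lt_mem_timeInterval {T : EReal} {t : ℝ} (ht : t ∈ timeInterval T) :
    ∃ t', t < t' ∧ t' ∈ timeInterval T := by
  obtain ⟨t', h1, h2⟩ := EReal.lt_iff_exists_real_btwn.1 ht.2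
  have h1' : t < t' := EReal.coe_lt_coe_iff.1 h1
  exact ⟨t', h1', ht.1.trans h1'.le, h2⟩

theorem tendsto_integral_mul_of_eLpNorm {α ι : Type*} [MeasurableSpace α] {μ : Measure α}
    {l : Filter ι} {a : ι → α → ℝ} {a₀ g : α → ℝ} (ha : ∀ᶠ i in l, MemLp (a i) 2 μ)
    (ha₀ : MemLp a₀ 2 μ) (hg : MemLp g 2 μ)
    (h : Tendsto (fun i => eLpNorm (fun x => a i x - a₀ x) 2 μ) l (𝓝 0)) :
    Tendsto (fun i => ∫ x, a i x * g x ∂μ) l (𝓝 (∫ x, a₀ x * g x ∂μ)) := by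
  refine tendsto_integral_of_L1' _ (ha₀.integrable_mul hg).aestronglyMeasurable
    (ha.mono fun i hi => hi.integrable_mul hg) ?_
  have h' : Tendsto (fun i => eLpNorm (fun x => a i x - a₀ x) 2 μ * eLpNorm g 2 μ) l (𝓝 0) := by
    simpa using ENNReal.Tendsto.mul_const h (Or.inr hg.2.ne)
  refine tendsto_of_tendsto_of_tendsto_of_le_of_le' tendsto_const_nhds h'
    (Eventually.of_forall fun _ => zero_le) (ha.mono fun i hi => ?_)
  have e : ((fun x => a i x * g x) - a₀ * g) =
      (fun x => a i x - a₀ x) • g := by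
    funext x
    simp [sub_mul]
  rw [e]
  exact eLpNorm_smul_le_mul_eLpNorm hg.1 (hi.1.sub ha₀.1)

section Cone

variable {n : ℕ} {R : ℝ} {T : EReal}

theorem memLp_indicator_ball (r : ℝ) {g : EuclideanSpace ℝ (Fin n) → ℝ} (hg : Continuous g)
    (p : ℝ≥0∞) : MemLp ((Metric.closedBall 0 r).indicator g) p volume := by
  rw [memLp_indicator_iff_restrict measurableSet_closedBall]
  obtain ⟨c, hc⟩ := (isCompact_closedBall (0 : EuclideanSpace ℝ (Fin n)) r).exists_bound_of_continuousOn
    hg.continuousOn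
  have : IsFiniteMeasure (volume.restrict (Metric.closedBall (0 : EuclideanSpace ℝ (Fin n)) r)) :=
    ⟨by simpa using measure_closedBall_lt_top⟩
  refine MemLp.of_bound hg.aestronglyMeasurable c ?_
  filter_upwards [ae_restrict_mem measurableSet_closedBall] with x hx
  exact hc x hx

theorem ae_mul_eq_mul_indicator {m : EuclideanSpace ℝ (Fin n) → ℝ} {r r' : ℝ}
    (hm : ∀ᵐ x, r < ‖x‖ → m x = 0) (hr : r ≤ r') (g : EuclideanSpace ℝ (Fin n) → ℝ) :
    (fun x => m x * g x) =ᵐ[volume] fun x => m x * (Metric.closedBall 0 r').indicator g x := by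
  filter_upwards [hm] with x hx
  by_cases h : x ∈ Metric.closedBall (0 : EuclideanSpace ℝ (Fin n)) r'
  · rw [Set.indicator_of_mem h]
  · rw [hx (by rw [mem_closedBall_zero_iff, not_le] at h; linarith)]
    simp

theorem integrable_mul_of_cone {m : EuclideanSpace ℝ (Fin n) → ℝ} {r : ℝ} (hm2 : MemLp m 2 volume)
    (hm : ∀ᵐ x, r < ‖x‖ → m x = 0) {g : EuclideanSpace ℝ (Fin n) → ℝ} (hg : Continuous g) :
    Integrable fun x => m x * g x :=
  (hm2.integrable_mul (memLp_indicator_ball r hg 2)).congr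
    (ae_mul_eq_mul_indicator hm le_rfl g).symm

theorem integrable_of_cone {m : EuclideanSpace ℝ (Fin n) → ℝ} {r : ℝ} (hm2 : MemLp m 2 volume)
    (hm : ∀ᵐ x, r < ‖x‖ → m x = 0) : Integrable m := by
  simpa using integrable_mul_of_cone hm2 hm (continuous_const (y := (1 : ℝ)))

theorem continuousOn_integral_mul {m : ℝ → EuclideanSpace ℝ (Fin n) → ℝ}
    (hm : ContinuousInLp T 2 m) (hc : VanishesOutsideCone R T m)
    {g : EuclideanSpace ℝ (Fin n) → ℝ} (hg : Continuous g) :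
    ContinuousOn (fun s => ∫ x, m s x * g x) (timeInterval T) := by
  intro t ht
  have hev : ∀ᶠ s in 𝓝[timeInterval T] t, s ∈ timeInterval T ∧ s < t + 1 :=
    (eventually_mem_nhdsWithin).and
      (eventually_nhdsWithin_of_eventually_nhds (eventually_lt_nhds (by linarith)))
  have h := tendsto_integral_mul_of_eLpNorm (g := (Metric.closedBall 0 (t + 1 + R)).indicator g)
    (hev.mono fun s hs => hm.1 s hs.1) (hm.1 t ht) (memLp_indicator_ball _ hg 2) (hm.2 t ht)
  rw [ContinuousWithinAt, integral_congr_ae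
    (ae_mul_eq_mul_indicator (r' := t + 1 + R) (hc t ht) (by linarith) g)]
  refine h.congr' (hev.mono fun s hs => ?_)
  exact (integral_congr_ae (ae_mul_eq_mul_indicator (hc s hs.1) (by linarith [hs.2]) g)).symm

theorem ContinuousInLp.abs {m : ℝ → EuclideanSpace ℝ (Fin n) → ℝ} {r : ℝ≥0∞}
    (hm : ContinuousInLp T r m) : ContinuousInLp T r fun s x => |m s x| := by
  refine ⟨fun t ht => (hm.1 t ht).abs, fun t ht => ?_⟩
  refine tendsto_of_tendsto_of_tendsto_of_le_of_le tendsto_const_nhds (hm.2 t ht)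
    (fun _ => zero_le) fun s => eLpNorm_mono fun x => ?_
  simpa using abs_abs_sub_abs_le_abs_sub (m s x) (m t x)

/-- The time derivative may be tested against continuous functions. -/
theorem hasDerivWithinAt_integral_mul {w wt : ℝ → EuclideanSpace ℝ (Fin n) → ℝ}
    (hw : ContinuousInLp T 2 w) (hwt : ContinuousInLp T 2 wt) (hd : HasTimeDerivative T w wt)
    (hcw : VanishesOutsideCone R T w) (hct : VanishesOutsideCone R T wt)
    {g : EuclideanSpace ℝ (Fin n) → ℝ} (hg : Continuous g) {t : ℝ} (ht : t ∈ timeInterval T) :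
    HasDerivWithinAt (fun s => ∫ x, w s x * g x) (∫ x, wt t x * g x) (timeInterval T) t := by
  rw [hasDerivWithinAt_iff_tendsto_slope]
  have hev : ∀ᶠ s in 𝓝[timeInterval T \ {t}] t, s ∈ timeInterval T ∧ s < t + 1 := by
    filter_upwards [eventually_mem_nhdsWithin, eventually_nhdsWithin_of_eventually_nhds
      (eventually_lt_nhds (by linarith : t < t + 1))] with s hs hs'
    exact ⟨hs.1, hs'⟩
  have h := tendsto_integral_mul_of_eLpNorm (g := (Metric.closedBall 0 (t + 1 + R)).indicator g)
    (a := fun s x => (t - s)⁻¹ * (w t x - w s x) * (-1) * (-1))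
    (l := 𝓝[timeInterval T \ {t}] t)
    (hev.mono fun s hs => by
      have := (((hw.1 t ht).sub (hw.1 s hs.1)).const_mul (t - s)⁻¹)
      simpa using this) (hwt.1 t ht)
    (memLp_indicator_ball _ hg 2) (by
      refine (hd t ht).congr fun s => ?_
      congr 1
      funext x
      rw [← neg_sub s t, ← neg_sub (w s x) (w t x), inv_neg]
      ring)
  rw [integral_congr_ae (ae_mul_eq_mul_indicator (r' := t + 1 + R) (hct t ht) (by linarith) g)]
  refine h.congr' (hev.mono fun s hs => ?_)
  rw [slope_def_field, ← integral_sub (integrable_mul_of_cone (hw.1 s hs.1) (hcw s hs.1) hg)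
    (integrable_mul_of_cone (hw.1 t ht) (hcw t ht) hg), div_eq_inv_mul, ← integral_const_mul]
  refine integral_congr_ae ?_
  filter_upwards [ae_mul_eq_mul_indicator (r' := t + 1 + R) (hcw s hs.1) (by linarith [hs.2]) g,
    ae_mul_eq_mul_indicator (r' := t + 1 + R) (hcw t ht) (by linarith) g] with x h1 h2
  rw [h1, h2, ← neg_sub s t, inv_neg]
  ring

theorem hasDerivWithinAt_integral_timeInterval {H : ℝ → ℝ} (hH : ContinuousOn H (timeInterval T))
    {t : ℝ} (ht : t ∈ timeInterval T) :
    HasDerivWithinAt (fun t => ∫ s in (0 : ℝ)..t, H s) (H t) (timeInterval T) t := by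
  obtain ⟨t', htt', ht'⟩ := exists_lt_mem_timeInterval ht
  have h0 : (0 : ℝ) ≤ t' := ht'.1
  set H' := Set.IccExtend h0 (fun s => H s.1) with hH'
  have hc : Continuous H' :=
    ((hH.mono (Icc_subset_timeInterval ht')).domRestrict).Icc_extend'
  have heq : ∀ s ∈ Set.Icc 0 t', H' s = H s := fun s hs => Set.IccExtend_of_mem h0 _ hs
  have hder := (hc.integral_hasStrictDerivAt 0 t).hasDerivAt.hasDerivWithinAt (s := timeInterval T)
  rw [heq t ⟨ht.1, htt'.le⟩] at hder
  have heq2 : ∀ s ∈ timeInterval T, s < t' →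
      ∫ r in (0 : ℝ)..s, H r = ∫ r in (0 : ℝ)..s, H' r := fun s hs hst => by
    refine intervalIntegral.integral_congr fun r hr => ?_
    rw [Set.uIcc_of_le hs.1] at hr
    exact (heq r ⟨hr.1, hr.2.trans hst.le⟩).symm
  refine hder.congr_of_eventuallyEq ?_ (heq2 t ht htt')
  filter_upwards [eventually_mem_nhdsWithin, eventually_nhdsWithin_of_eventually_nhds
    (eventually_lt_nhds htt')] with s hs hs'
  exact heq2 s hs hs'

/-- A non-negative source supported in the cone `|x| ≤ t + R`, continuous in time when tested
against continuous functions. -/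
structure IsConeSource (R : ℝ) (T : EReal) (h : ℝ → EuclideanSpace ℝ (Fin n) → ℝ) : Prop where
  integrable : ∀ t ∈ timeInterval T, Integrable (h t)
  nonneg : ∀ t x, 0 ≤ h t x
  vanishes : VanishesOutsideCone R T h
  continuousOn : ∀ g : EuclideanSpace ℝ (Fin n) → ℝ, Continuous g →
    ContinuousOn (fun s => ∫ x, h s x * g x) (timeInterval T)

theorem IsConeSource.integrable_mul {h : ℝ → EuclideanSpace ℝ (Fin n) → ℝ}
    (hh : IsConeSource R T h) {t : ℝ} (ht : t ∈ timeInterval T)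
    {g : EuclideanSpace ℝ (Fin n) → ℝ} (hg : Continuous g) : Integrable fun x => h t x * g x := by
  refine Integrable.congr ?_ (ae_mul_eq_mul_indicator (hh.vanishes t ht) le_rfl g).symm
  obtain ⟨c, hc⟩ := (isCompact_closedBall (0 : EuclideanSpace ℝ (Fin n)) (t + R)
    ).exists_bound_of_continuousOn hg.continuousOn
  refine (hh.integrable t ht).mul_bdd (c := max c 0)
    (hg.measurable.indicator measurableSet_closedBall).aestronglyMeasurable (ae_of_all _ fun x => ?_)
  by_cases hx : x ∈ Metric.closedBall (0 : EuclideanSpace ℝ (Fin n)) (t + R)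
  · rw [Set.indicator_of_mem hx]
    exact (hc x hx).trans (le_max_left _ _)
  · rw [Set.indicator_of_notMem hx, norm_zero]
    exact le_max_right _ _

theorem IsConeSource.continuousOn_integral {h : ℝ → EuclideanSpace ℝ (Fin n) → ℝ}
    (hh : IsConeSource R T h) : ContinuousOn (fun s => ∫ x, h s x) (timeInterval T) := by
  simpa using hh.continuousOn (fun _ => 1) continuous_const

/-- The measure `|u(s)|^r dx` depends weakly continuously on `s` if `u ∈ C([0,T); Lʳ)`: with a
non-negative weight `g`, the integral is the `r`-th power of the norm of `u(s) g^(1/r)` in `Lʳ`. -/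
theorem continuousOn_integral_rpow_mul {u : ℝ → EuclideanSpace ℝ (Fin n) → ℝ} {r : ℝ} (hr : 1 ≤ r)
    (hu : ContinuousInLp T (ENNReal.ofReal r) u) {g : EuclideanSpace ℝ (Fin n) → ℝ}
    (hgm : Measurable g) (hg0 : ∀ x, 0 ≤ g x) {M : ℝ} (hM : ∀ x, g x ≤ M) :
    ContinuousOn (fun s => ∫ x, |u s x| ^ r * g x) (timeInterval T) := by
  have hr0 : 0 < r := by linarith
  set b : ℝ → EuclideanSpace ℝ (Fin n) → ℝ := fun s x => u s x * g x ^ (1 / r) with hb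
  have hbound : ∀ x, ‖g x ^ (1 / r)‖ ≤ M ^ (1 / r) := fun x => by
    rw [Real.norm_of_nonneg (Real.rpow_nonneg (hg0 x) _)]
    exact Real.rpow_le_rpow (hg0 x) (hM x) (by positivity)
  have hbm : ∀ s ∈ timeInterval T, MemLp (b s) (ENNReal.ofReal r) volume := fun s hs => by
    refine MemLp.of_le_mul (c := M ^ (1 / r)) (hu.1 s hs)
      ((hu.1 s hs).1.mul (hgm.pow_const _).aestronglyMeasurable) (ae_of_all _ fun x => ?_)
    rw [hb, norm_mul, mul_comm]
    exact mul_le_mul_of_nonneg_right (hbound x) (norm_nonneg _)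
  have hint : ∀ s ∈ timeInterval T,
      ∫ x, |u s x| ^ r * g x = (eLpNorm (b s) (ENNReal.ofReal r) volume).toReal ^ r := fun s hs => by
    have h1 : ENNReal.ofReal r ≠ 0 := by simpa using hr0
    rw [(hbm s hs).eLpNorm_eq_integral_rpow_norm h1 ENNReal.ofReal_ne_top,
      ENNReal.toReal_ofReal hr0.le, ENNReal.toReal_ofReal (by positivity),
      ← Real.rpow_mul (integral_nonneg fun x => by positivity), inv_mul_cancel₀ hr0.ne',
      Real.rpow_one]
    refine integral_congr_ae (ae_of_all _ fun x => ?_)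
    simp only [hb]
    rw [norm_mul, Real.mul_rpow (norm_nonneg _) (norm_nonneg _),
      Real.norm_of_nonneg (Real.rpow_nonneg (hg0 x) _), ← Real.rpow_mul (hg0 x),
      one_div_mul_cancel hr0.ne', Real.rpow_one, Real.norm_eq_abs]
  have hcont : ContinuousOn (fun s => (eLpNorm (b s) (ENNReal.ofReal r) volume).toReal)
      (timeInterval T) := by
    intro t ht
    have hr1 : (1 : ℝ≥0∞) ≤ ENNReal.ofReal r := by simpa using hr
    have hlim : Tendsto (fun s => (ENNReal.ofReal (M ^ (1 / r)) *
        eLpNorm (fun x => u s x - u t x) (ENNReal.ofReal r) volume).toReal)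
        (𝓝[timeInterval T] t) (𝓝 0) := by
      have h2 := ENNReal.Tendsto.const_mul (hu.2 t ht)
        (Or.inr (ENNReal.ofReal_ne_top (r := M ^ (1 / r))))
      rw [mul_zero] at h2
      have h3 := (ENNReal.tendsto_toReal ENNReal.zero_ne_top).comp h2
      rw [ENNReal.toReal_zero] at h3
      exact h3
    rw [ContinuousWithinAt, tendsto_iff_dist_tendsto_zero]
    refine tendsto_of_tendsto_of_tendsto_of_le_of_le' tendsto_const_nhds hlim
      (Eventually.of_forall fun _ => dist_nonneg) ?_
    filter_upwards [eventually_mem_nhdsWithin] with s hs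
    have h3 : eLpNorm (b s - b t) (ENNReal.ofReal r) volume ≤ ENNReal.ofReal (M ^ (1 / r)) *
        eLpNorm (fun x => u s x - u t x) (ENNReal.ofReal r) volume := by
      refine eLpNorm_le_mul_eLpNorm_of_ae_le_mul (ae_of_all _ fun x => ?_) _
      simp only [hb, Pi.sub_apply]
      rw [← sub_mul, norm_mul, mul_comm]
      exact mul_le_mul_of_nonneg_right (hbound x) (norm_nonneg _)
    have hfin : ENNReal.ofReal (M ^ (1 / r)) *
        eLpNorm (fun x => u s x - u t x) (ENNReal.ofReal r) volume ≠ ⊤ :=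
      ENNReal.mul_ne_top ENNReal.ofReal_ne_top ((hu.1 s hs).sub (hu.1 t ht)).2.ne
    have tri : ∀ s ∈ timeInterval T, ∀ t ∈ timeInterval T,
        (eLpNorm (b s) (ENNReal.ofReal r) volume).toReal ≤
          (eLpNorm (b s - b t) (ENNReal.ofReal r) volume).toReal +
            (eLpNorm (b t) (ENNReal.ofReal r) volume).toReal := fun s hs t ht => by
      rw [← ENNReal.toReal_add ((hbm s hs).sub (hbm t ht)).2.ne (hbm t ht).2.ne]
      refine ENNReal.toReal_mono (ENNReal.add_ne_top.2
        ⟨((hbm s hs).sub (hbm t ht)).2.ne, (hbm t ht).2.ne⟩) ?_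
      have := eLpNorm_add_le ((hbm s hs).sub (hbm t ht)).1 (hbm t ht).1 hr1
      simpa using this
    rw [Real.dist_eq, abs_sub_le_iff]
    have h4 := ENNReal.toReal_mono hfin h3
    have h5 := tri s hs t ht
    have h6 := tri t ht s hs
    rw [eLpNorm_sub_comm] at h6
    constructor <;> linarith
  exact (hcont.rpow_const fun _ _ => Or.inr hr0.le).congr hint

/-- Powers of a function in `C([0,T); Lʳ)` are sources. -/
theorem isConeSource_rpow {u : ℝ → EuclideanSpace ℝ (Fin n) → ℝ} {r : ℝ} (hr : 1 ≤ r)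
    (hu : ContinuousInLp T (ENNReal.ofReal r) u) (hc : VanishesOutsideCone R T u) :
    IsConeSource R T fun t x => |u t x| ^ r := by
  have hr0 : 0 < r := by linarith
  have hint : ∀ t ∈ timeInterval T, Integrable fun x => |u t x| ^ r := fun t ht => by
    have h := (hu.1 t ht).integrable_norm_rpow (by simpa using hr0) ENNReal.ofReal_ne_top
    simpa [ENNReal.toReal_ofReal hr0.le] using h
  have hvan : VanishesOutsideCone R T fun t x => |u t x| ^ r := fun t ht => by
    filter_upwards [hc t ht] with x hx hxt
    rw [hx hxt, abs_zero, Real.zero_rpow hr0.ne']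
  refine ⟨hint, fun t x => by positivity, hvan, ?_⟩
  intro g hg t ht
  -- near `t` only the values of `g` on a fixed ball matter, where `g` is bounded
  set B := Metric.closedBall (0 : EuclideanSpace ℝ (Fin n)) (t + 1 + R) with hB
  obtain ⟨c, hcb⟩ := (isCompact_closedBall (0 : EuclideanSpace ℝ (Fin n)) (t + 1 + R)
    ).exists_bound_of_continuousOn hg.continuousOn
  have hbd : ∀ x, |B.indicator g x| ≤ max c 0 := fun x => by
    by_cases hx : x ∈ B
    · rw [Set.indicator_of_mem hx]
      exact (hcb x hx).trans (le_max_left _ _)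
    · rw [Set.indicator_of_notMem hx, abs_zero]
      exact le_max_right _ _
  have hgm : Measurable (B.indicator g) := hg.measurable.indicator measurableSet_closedBall
  have h1 := continuousOn_integral_rpow_mul hr hu (g := fun x => B.indicator g x + max c 0)
    (hgm.add_const _) (fun x => by linarith [(abs_le.1 (hbd x)).1])
    (M := 2 * max c 0) (fun x => by linarith [(abs_le.1 (hbd x)).2])
  have h2 := continuousOn_integral_rpow_mul hr hu (g := fun _ => max c 0)
    measurable_const (fun x => le_max_right _ _) (M := max c 0) (fun x => le_rfl)
  have h3 := (h1.sub h2) t ht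
  have heq : ∀ s ∈ timeInterval T, s < t + 1 → ∫ x, |u s x| ^ r * g x =
      (∫ x, |u s x| ^ r * (B.indicator g x + max c 0)) - ∫ x, |u s x| ^ r * max c 0 := by
    intro s hs hst
    have hi : Integrable fun x => |u s x| ^ r * (B.indicator g x + max c 0) :=
      (hint s hs).mul_bdd (c := 2 * max c 0) (hgm.add_const _).aestronglyMeasurable
        (ae_of_all _ fun x => by
          rw [Real.norm_eq_abs, abs_le]
          constructor <;> linarith [(abs_le.1 (hbd x)).1, (abs_le.1 (hbd x)).2,
            le_max_right c 0])
    rw [← integral_sub hi ((hint s hs).mul_const _),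
      integral_congr_ae (ae_mul_eq_mul_indicator (r' := t + 1 + R) (hvan s hs) (by linarith) g)]
    refine integral_congr_ae (ae_of_all _ fun x => ?_)
    simp only [hB]
    ring
  refine h3.congr_of_eventuallyEq ?_ (heq t ht (by linarith))
  filter_upwards [eventually_mem_nhdsWithin, eventually_nhdsWithin_of_eventually_nhds
    (eventually_lt_nhds (by linarith : t < t + 1))] with s hs hs'
  exact heq s hs hs'

/-- On functions supported in the cone, convergence in `L²` implies convergence in `Lʳ`, `r ≤ 2`. -/
theorem ContinuousInLp.of_two {m : ℝ → EuclideanSpace ℝ (Fin n) → ℝ} {r : ℝ} (hr0 : 0 < r)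
    (hr2 : r ≤ 2) (hm : ContinuousInLp T 2 m) (hc : VanishesOutsideCone R T m) :
    ContinuousInLp T (ENNReal.ofReal r) m := by
  have hr : ENNReal.ofReal r ≤ 2 := by
    rw [← ENNReal.ofReal_ofNat]
    exact ENNReal.ofReal_le_ofReal hr2
  have key : ∀ (ρ : ℝ) (f : EuclideanSpace ℝ (Fin n) → ℝ), AEStronglyMeasurable f volume →
      (∀ᵐ x, ρ < ‖x‖ → f x = 0) →
      eLpNorm f (ENNReal.ofReal r) volume ≤ eLpNorm f 2 volume *
        volume (Metric.closedBall (0 : EuclideanSpace ℝ (Fin n)) ρ) ^ (1 / r - 1 / 2) := by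
    intro ρ f hf h0
    have e : f =ᵐ[volume] (Metric.closedBall (0 : EuclideanSpace ℝ (Fin n)) ρ).indicator f := by
      filter_upwards [h0] with x hx
      by_cases h : x ∈ Metric.closedBall (0 : EuclideanSpace ℝ (Fin n)) ρ
      · rw [Set.indicator_of_mem h]
      · rw [Set.indicator_of_notMem h, hx (by simpa using h)]
    rw [eLpNorm_congr_ae (p := ENNReal.ofReal r) e,
      eLpNorm_indicator_eq_eLpNorm_restrict measurableSet_closedBall]
    refine (eLpNorm_le_eLpNorm_mul_rpow_measure_univ hr hf.restrict).trans ?_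
    rw [Measure.restrict_apply_univ, ENNReal.toReal_ofReal hr0.le]
    refine mul_le_mul' (eLpNorm_mono_measure _ Measure.restrict_le_self) (le_of_eq ?_)
    norm_num
  have hfin : ∀ ρ : ℝ, volume (Metric.closedBall (0 : EuclideanSpace ℝ (Fin n)) ρ) ^
      (1 / r - 1 / 2) ≠ ⊤ := fun ρ => by
    refine ENNReal.rpow_ne_top_of_nonneg ?_ measure_closedBall_lt_top.ne
    rw [sub_nonneg]
    exact one_div_le_one_div_of_le hr0 hr2
  refine ⟨fun t ht => ⟨(hm.1 t ht).1, ?_⟩, fun t ht => ?_⟩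
  · refine (key _ _ (hm.1 t ht).1 (hc t ht)).trans_lt ?_
    exact (ENNReal.mul_ne_top (hm.1 t ht).2.ne (hfin _)).lt_top
  · have h1 : Tendsto (fun s => eLpNorm (fun x => m s x - m t x) 2 volume *
        volume (Metric.closedBall (0 : EuclideanSpace ℝ (Fin n)) (t + 1 + R)) ^ (1 / r - 1 / 2))
        (𝓝[timeInterval T] t) (𝓝 0) := by
      simpa using ENNReal.Tendsto.mul_const (hm.2 t ht) (Or.inr (hfin _))
    refine tendsto_of_tendsto_of_tendsto_of_le_of_le' tendsto_const_nhds h1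
      (Eventually.of_forall fun _ => zero_le) ?_
    filter_upwards [eventually_mem_nhdsWithin, eventually_nhdsWithin_of_eventually_nhds
      (eventually_lt_nhds (by linarith : t < t + 1))] with s hs hs'
    refine key _ _ ((hm.1 s hs).1.sub (hm.1 t ht).1) ?_
    filter_upwards [hc s hs, hc t ht] with x h1 h2 hx
    rw [h1 (by linarith), h2 (by linarith), sub_zero]

end Cone

/-! ### The wave equation tested with plane waves -/

section PlaneWave

variable {n : ℕ}

theorem hasFDerivAt_planeWave {f : ℝ → ℝ} (hf : Differentiable ℝ f)
    (e x : EuclideanSpace ℝ (Fin n)) :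
    HasFDerivAt (fun y => f (inner ℝ y e)) (deriv f (inner ℝ x e) • innerSL ℝ e) x := by
  have h1 : HasFDerivAt (fun y : EuclideanSpace ℝ (Fin n) => inner ℝ y e) (innerSL ℝ e) x := by
    have := (innerSL ℝ e).hasFDerivAt (x := x)
    refine this.congr_of_eventuallyEq (Eventually.of_forall fun y => ?_)
    simp [real_inner_comm]
  exact (hf (inner ℝ x e)).hasDerivAt.comp_hasFDerivAt x h1

/-- Integration by parts in space, against a test function that agrees with the plane wave
`x ↦ f (x · e)` on a neighbourhood of the support of `w`. -/
theorem integral_fderiv_eq_neg_integral_of_planeWave {w : EuclideanSpace ℝ (Fin n) → ℝ}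
    {Dw : EuclideanSpace ℝ (Fin n) → EuclideanSpace ℝ (Fin n)} (hw : HasWeakGradient w Dw)
    {f : ℝ → ℝ} (hf : ContDiff ℝ ∞ f) {e : EuclideanSpace ℝ (Fin n)} (he : ‖e‖ = 1)
    {ψ : EuclideanSpace ℝ (Fin n) → ℝ} (hψ : ContDiff ℝ ∞ ψ) (hψc : HasCompactSupport ψ) {r : ℝ}
    (hψr : ∀ x, ‖x‖ < r → ψ x = f (inner ℝ x e)) (hwr : ∀ᵐ x, r ≤ ‖x‖ → w x = 0) :
    ∫ x, fderiv ℝ ψ x (Dw x) = -∫ x, w x * deriv (deriv f) (inner ℝ x e) := by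
  obtain ⟨hw1, hD1, hwD⟩ := hw
  set b := EuclideanSpace.basisFun (Fin n) ℝ with hb
  have hφ : ∀ i, ContDiff ℝ ∞ fun x => fderiv ℝ ψ x (b i) := fun i =>
    (hψ.fderiv_right (m := ∞) (by simp)).clm_apply contDiff_const
  have hφc : ∀ i, HasCompactSupport fun x => fderiv ℝ ψ x (b i) := fun i =>
    hψc.fderiv_apply (𝕜 := ℝ) (b i)
  have hsum : ∀ x, fderiv ℝ ψ x (Dw x) = ∑ i, inner ℝ (Dw x) (b i) * fderiv ℝ ψ x (b i) := by
    intro x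
    conv_lhs => rw [← b.sum_repr' (Dw x)]
    rw [map_sum]
    refine Finset.sum_congr rfl fun i _ => ?_
    rw [map_smul, smul_eq_mul, real_inner_comm]
  have hint1 : ∀ i, Integrable fun x => inner ℝ (Dw x) (b i) * fderiv ℝ ψ x (b i) := fun i => by
    have h1 := hD1.integrable_smul_left_of_hasCompactSupport (𝕜 := ℝ) (hφ i).continuous (hφc i)
    refine (h1.inner_const (𝕜 := ℝ) (b i)).congr (ae_of_all _ fun x => ?_)
    simp only [inner_smul_left]
    simp [mul_comm]
  have hint2 : ∀ i, Integrable fun x => w x * fderiv ℝ (fun x => fderiv ℝ ψ x (b i)) x (b i) :=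
    fun i => by
      refine hw1.integrable_smul_right_of_hasCompactSupport
        (g := fun x => fderiv ℝ (fun x => fderiv ℝ ψ x (b i)) x (b i)) ?_ ?_
      · exact (((hφ i).fderiv_right (m := ∞) (by simp)).clm_apply contDiff_const).continuous
      · exact (hφc i).fderiv_apply (𝕜 := ℝ) (b i)
  simp only [hsum]
  rw [integral_finsetSum _ fun i _ => hint1 i]
  have hpart : ∀ i, ∫ x, inner ℝ (Dw x) (b i) * fderiv ℝ ψ x (b i) =
      -∫ x, w x * fderiv ℝ (fun x => fderiv ℝ ψ x (b i)) x (b i) := fun i => by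
    rw [hwD _ (hφ i) (hφc i) (b i), neg_neg]
  simp only [hpart]
  rw [Finset.sum_neg_distrib, ← integral_finsetSum _ fun i _ => hint2 i]
  congr 1
  refine integral_congr_ae (hwr.mono fun x hx => ?_)
  rcases lt_or_ge ‖x‖ r with hxr | hxr
  · have hopen : IsOpen {y : EuclideanSpace ℝ (Fin n) | ‖y‖ < r} :=
      isOpen_lt continuous_norm continuous_const
    have hfd : Differentiable ℝ f := hf.differentiable (by simp)
    have hf' : ContDiff ℝ ∞ (deriv f) := (contDiff_infty_iff_deriv.1 hf).2
    have h1 : ∀ i, ∀ y, ‖y‖ < r → fderiv ℝ ψ y (b i) = deriv f (inner ℝ y e) * inner ℝ e (b i) := by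
      intro i y hy
      have h2 : ψ =ᶠ[𝓝 y] fun y => f (inner ℝ y e) := by
        filter_upwards [hopen.mem_nhds hy] with z hz using hψr z hz
      rw [h2.fderiv_eq, (hasFDerivAt_planeWave hfd e y).fderiv]
      simp
    have h3 : ∀ i, fderiv ℝ (fun x => fderiv ℝ ψ x (b i)) x (b i) =
        deriv (deriv f) (inner ℝ x e) * inner ℝ e (b i) ^ 2 := by
      intro i
      have h4 : (fun x => fderiv ℝ ψ x (b i)) =ᶠ[𝓝 x]
          fun y => deriv f (inner ℝ y e) * inner ℝ e (b i) := by
        filter_upwards [hopen.mem_nhds hxr] with z hz using h1 i z hz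
      rw [h4.fderiv_eq, ((hasFDerivAt_planeWave (hf'.differentiable (by simp)) e x).mul_const
        (inner ℝ e (b i))).fderiv]
      simp
      ring
    simp only [h3]
    rw [← Finset.mul_sum, ← Finset.mul_sum]
    have h5 : ∑ i, inner ℝ e (b i) ^ 2 = 1 := by
      have := b.sum_sq_norm_inner_left e
      rw [he] at this
      simpa [real_inner_comm] using this
    rw [h5, mul_one]
  · simp [hx hxr]

variable {R : ℝ} {T : EReal} {h w wt : ℝ → EuclideanSpace ℝ (Fin n) → ℝ}
  {w₀ w₁ : EuclideanSpace ℝ (Fin n) → ℝ}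

/-- The plane-wave form of the equation: `s ↦ ∫ w(s) f(x · e)` is the pairing of the Radon
transform of `w(s)` in direction `e` with `f`, and satisfies the weak one-dimensional wave
equation. -/
theorem SolvesWave.integral_planeWave (hR : 0 < R) (hs : SolvesWave T h w₀ w₁ w wt)
    (hh : IsConeSource R T h) (hcw : VanishesOutsideCone R T w) (hct : VanishesOutsideCone R T wt)
    {f : ℝ → ℝ} (hf : ContDiff ℝ ∞ f) {e : EuclideanSpace ℝ (Fin n)} (he : ‖e‖ = 1)
    {t : ℝ} (ht : t ∈ timeInterval T) :
    ∫ x, wt t x * f (inner ℝ x e) = (∫ x, wt 0 x * f (inner ℝ x e)) +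
      ∫ s in (0 : ℝ)..t, ((∫ x, h s x * f (inner ℝ x e)) +
        ∫ x, w s x * deriv (deriv f) (inner ℝ x e)) := by
  obtain ⟨hw2, hwt2, hd, -, -, Dw, hDw2, hgrad, hweak⟩ := hs
  have ht0 : 0 ≤ t := ht.1
  set χ : ContDiffBump (0 : EuclideanSpace ℝ (Fin n)) :=
    ⟨t + R + 1, t + R + 2, by linarith, by linarith⟩ with hχ
  set ψ : EuclideanSpace ℝ (Fin n) → ℝ := fun x => χ x * f (inner ℝ x e) with hψ
  have hψs : ContDiff ℝ ∞ ψ := by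
    refine χ.contDiff.mul (hf.comp ?_)
    exact contDiff_id.inner ℝ contDiff_const
  have hψc : HasCompactSupport ψ := χ.hasCompactSupport.mul_right
  have hψr : ∀ x, ‖x‖ < t + R + 1 → ψ x = f (inner ℝ x e) := fun x hx => by
    have : χ x = 1 := χ.one_of_mem_closedBall (by
      rw [mem_closedBall_zero_iff]
      exact hx.le)
    simp [hψ, this]
  have hrep : ∀ s ∈ timeInterval T, s ≤ t → ∀ m : ℝ → EuclideanSpace ℝ (Fin n) → ℝ,
      VanishesOutsideCone R T m → ∫ x, m s x * ψ x = ∫ x, m s x * f (inner ℝ x e) := by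
    intro s hs hst m hm
    refine integral_congr_ae ((hm s hs).mono fun x hx => ?_)
    rcases lt_or_ge ‖x‖ (t + R + 1) with hxr | hxr
    · simp only [hψr x hxr]
    · simp only [hx (by linarith), zero_mul]
  have h0 : (0 : ℝ) ∈ timeInterval T := mem_timeInterval_of_le ht le_rfl ht0
  have key := hweak ψ hψs hψc t ht
  rw [hrep t ht le_rfl wt hct, hrep 0 h0 ht0 wt hct] at key
  rw [key]
  congr 1
  refine intervalIntegral.integral_congr fun s hs => ?_
  rw [Set.uIcc_of_le ht0] at hs
  have hsT := Icc_subset_timeInterval ht hs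
  rw [hrep s hsT hs.2 h hh.vanishes, integral_fderiv_eq_neg_integral_of_planeWave
    (hgrad s hsT) hf he hψs hψc hψr ((hcw s hsT).mono fun x hx hxr => hx (by linarith [hs.2])),
    sub_neg_eq_add]

theorem SolvesWave.hasDerivWithinAt_planeWave (hR : 0 < R) (hs : SolvesWave T h w₀ w₁ w wt)
    (hh : IsConeSource R T h) (hcw : VanishesOutsideCone R T w) (hct : VanishesOutsideCone R T wt)
    {f : ℝ → ℝ} (hf : ContDiff ℝ ∞ f) {e : EuclideanSpace ℝ (Fin n)} (he : ‖e‖ = 1)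
    {t : ℝ} (ht : t ∈ timeInterval T) :
    HasDerivWithinAt (fun s => ∫ x, wt s x * f (inner ℝ x e))
      ((∫ x, h t x * f (inner ℝ x e)) + ∫ x, w t x * deriv (deriv f) (inner ℝ x e))
      (timeInterval T) t := by
  have hf'' : ContDiff ℝ ∞ (deriv (deriv f)) :=
    (contDiff_infty_iff_deriv.1 (contDiff_infty_iff_deriv.1 hf).2).2
  have hc : ∀ {g : ℝ → ℝ}, ContDiff ℝ ∞ g →
      Continuous fun x : EuclideanSpace ℝ (Fin n) => g (inner ℝ x e) := fun hg =>
    hg.continuous.comp (by fun_prop)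
  have hH : ContinuousOn (fun s => (∫ x, h s x * f (inner ℝ x e)) +
      ∫ x, w s x * deriv (deriv f) (inner ℝ x e)) (timeInterval T) :=
    (hh.continuousOn _ (hc hf)).add (continuousOn_integral_mul hs.1 hcw (hc hf''))
  have h1 := (hasDerivWithinAt_integral_timeInterval hH ht).const_add
    (∫ x, wt 0 x * f (inner ℝ x e))
  exact h1.congr (fun s hsT => hs.integral_planeWave hR hh hcw hct hf he hsT)
    (hs.integral_planeWave hR hh hcw hct hf he ht)

theorem abs_taylor_two_le {f : ℝ → ℝ} (hf : ContDiff ℝ ∞ f) (N : ℝ) :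
    ∃ K, 0 ≤ K ∧ ∀ a, |a| ≤ N → ∀ d, |d| ≤ 1 → |f (a - d) - f a + d * deriv f a| ≤ K * d ^ 2 := by
  have hf1 : Differentiable ℝ f := hf.differentiable (by simp)
  have hf' := (contDiff_infty_iff_deriv.1 hf).2
  have hf1' : Differentiable ℝ (deriv f) := hf'.differentiable (by simp)
  have hf'' := (contDiff_infty_iff_deriv.1 hf').2
  obtain ⟨K, hK⟩ := (isCompact_Icc (a := -N - 1) (b := N + 1)).exists_bound_of_continuousOn
    hf''.continuous.continuousOn
  refine ⟨max K 0, le_max_right _ _, fun a ha d hd => ?_⟩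
  have ha' := abs_le.1 ha
  have hbound : ∀ x ∈ Set.Icc (-N - 1) (N + 1), ‖deriv (deriv f) x‖ ≤ max K 0 := fun x hx =>
    (hK x hx).trans (le_max_left _ _)
  have haI : a ∈ Set.Icc (-N - 1) (N + 1) := ⟨by linarith, by linarith⟩
  have h1 : ∀ x ∈ Set.uIcc 0 d, ‖deriv f a - deriv f (a - x)‖ ≤ max K 0 * |d| := fun x hx => by
    have hx' : |x| ≤ |d| := by
      rcases le_total 0 d with h | h
      · rw [Set.uIcc_of_le h] at hx
        rw [abs_of_nonneg hx.1, abs_of_nonneg h]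
        exact hx.2
      · rw [Set.uIcc_of_ge h] at hx
        rw [abs_of_nonpos hx.2, abs_of_nonpos h]
        linarith [hx.1]
    have hx1 := abs_le.1 (hx'.trans hd)
    have := (convex_Icc (-N - 1) (N + 1)).norm_image_sub_le_of_norm_deriv_le
      (fun y _ => hf1' y) hbound (x := a - x) (y := a) ⟨by linarith, by linarith⟩ haI
    refine this.trans (mul_le_mul_of_nonneg_left ?_ (le_max_right _ _))
    simpa using hx'
  have h2 : ∀ x ∈ Set.uIcc 0 d, HasDerivWithinAt (fun x => f (a - x) - f a + x * deriv f a)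
      (deriv f a - deriv f (a - x)) (Set.uIcc 0 d) x := fun x _ => by
    have h3 : HasDerivAt (fun x => f (a - x)) (-deriv f (a - x)) x :=
      HasDerivAt.comp_const_sub a x (hf1 _).hasDerivAt
    refine (((h3.sub_const (f a)).add ((hasDerivAt_id x).mul_const (deriv f a))
      ).hasDerivWithinAt).congr_deriv ?_
    ring
  have h4 := (convex_uIcc 0 d).norm_image_sub_le_of_norm_hasDerivWithin_le h2 h1
    Set.left_mem_uIcc Set.right_mem_uIcc
  simp only [sub_zero, zero_mul, add_zero, sub_self, Real.norm_eq_abs] at h4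
  refine h4.trans (le_of_eq ?_)
  rw [mul_assoc, ← sq, sq_abs]

/-- Product rule for the pairing of `m(s)` with a plane wave travelling at unit speed. -/
theorem hasDerivWithinAt_integral_travelling {m : ℝ → EuclideanSpace ℝ (Fin n) → ℝ}
    (hm : ContinuousInLp T 2 m) (hc : VanishesOutsideCone R T m) {f : ℝ → ℝ} (hf : ContDiff ℝ ∞ f)
    {e : EuclideanSpace ℝ (Fin n)} (he : ‖e‖ = 1) {t s₀ D : ℝ} (hs₀ : s₀ ∈ timeInterval T)
    (hD : HasDerivWithinAt (fun s => ∫ x, m s x * f (inner ℝ x e + (t - s₀))) D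
      (timeInterval T) s₀) :
    HasDerivWithinAt (fun s => ∫ x, m s x * f (inner ℝ x e + (t - s)))
      (D - ∫ x, m s₀ x * deriv f (inner ℝ x e + (t - s₀))) (timeInterval T) s₀ := by
  have hf' := (contDiff_infty_iff_deriv.1 hf).2
  have hcont : ∀ {g : ℝ → ℝ}, ContDiff ℝ ∞ g → ∀ c : ℝ,
      Continuous fun x : EuclideanSpace ℝ (Fin n) => g (inner ℝ x e + c) := fun hg c =>
    hg.continuous.comp (by fun_prop)
  set A' : ℝ → ℝ := fun s => ∫ x, m s x * deriv f (inner ℝ x e + (t - s₀)) with hA'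
  set rem : ℝ → ℝ := fun s => ∫ x, m s x * (f (inner ℝ x e + (t - s)) -
    f (inner ℝ x e + (t - s₀)) + (s - s₀) * deriv f (inner ℝ x e + (t - s₀))) with hrem
  have hA'c : ContinuousOn A' (timeInterval T) := continuousOn_integral_mul hm hc (hcont hf' _)
  have hmid : HasDerivWithinAt (fun s => (s - s₀) * A' s) (A' s₀) (timeInterval T) s₀ := by
    rw [hasDerivWithinAt_iff_tendsto_slope]
    have h1 : Tendsto A' (𝓝[timeInterval T \ {s₀}] s₀) (𝓝 (A' s₀)) :=
      (hA'c s₀ hs₀).mono_left (nhdsWithin_mono _ Set.sdiff_subset)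
    refine h1.congr' ?_
    filter_upwards [eventually_mem_nhdsWithin] with s hs
    have : s - s₀ ≠ 0 := sub_ne_zero.2 (by simpa using hs.2)
    rw [slope_def_field]
    field_simp
    simp
  have hremd : HasDerivWithinAt rem 0 (timeInterval T) s₀ := by
    obtain ⟨K, hK0, hK⟩ := abs_taylor_two_le hf (s₀ + 1 + R + |t - s₀|)
    have hLc := continuousOn_integral_mul (R := R) hm.abs (fun s hs => (hc s hs).mono fun x hx h => by
      simp only [hx h, abs_zero]) (continuous_const (y := (1 : ℝ))) s₀ hs₀
    have hbd : ∀ᶠ s in 𝓝[timeInterval T] s₀, ∫ x, |m s x| * 1 < (∫ x, |m s₀ x| * 1) + 1 :=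
      hLc.eventually (eventually_lt_nhds (by linarith))
    have hO : rem =O[𝓝[timeInterval T] s₀] fun s => ‖s - s₀‖ ^ 2 := by
      refine Asymptotics.IsBigO.of_bound (K * ((∫ x, |m s₀ x| * 1) + 1)) ?_
      have hnear : ∀ᶠ s in 𝓝[timeInterval T] s₀, |s - s₀| < 1 :=
        eventually_nhdsWithin_of_eventually_nhds (by
          have := Metric.ball_mem_nhds s₀ one_pos
          filter_upwards [this] with s hs
          rwa [Metric.mem_ball, Real.dist_eq] at hs)
      filter_upwards [hbd, hnear, eventually_mem_nhdsWithin] with s hs1 hs2 hsT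
      have hint : Integrable fun x => |m s x| := (integrable_of_cone (hm.1 s hsT) (hc s hsT)).abs
      have h2 : ‖rem s‖ ≤ ∫ x, K * (s - s₀) ^ 2 * (|m s x| * 1) := by
        refine norm_integral_le_of_norm_le ?_ ?_
        · simpa using hint.const_mul _
        · filter_upwards [hc s hsT] with x hx
          rcases lt_or_ge (s + R) ‖x‖ with hxs | hxs
          · rw [hx hxs]
            simp
          · have h3 : |inner ℝ x e + (t - s₀)| ≤ s₀ + 1 + R + |t - s₀| := by
              refine (abs_add_le _ _).trans (add_le_add ?_ le_rfl)
              refine (abs_real_inner_le_norm _ _).trans ?_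
              rw [he, mul_one]
              linarith [(abs_lt.1 hs2).2]
            have h4 := hK _ h3 (s - s₀) hs2.le
            have h5 : inner ℝ x e + (t - s₀) - (s - s₀) = inner ℝ x e + (t - s) := by ring
            rw [h5] at h4
            rw [norm_mul, Real.norm_eq_abs, Real.norm_eq_abs, mul_one, mul_comm]
            exact mul_le_mul_of_nonneg_right h4 (abs_nonneg _)
      refine h2.trans ?_
      rw [integral_const_mul, norm_pow, norm_norm, Real.norm_eq_abs, sq_abs]
      nlinarith [mul_nonneg hK0 (sq_nonneg (s - s₀))]
    exact (hO.hasFDerivWithinAt hs₀ one_lt_two).hasDerivWithinAt.congr_deriv (by simp)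
  have hsplit : ∀ s ∈ timeInterval T, ∫ x, m s x * f (inner ℝ x e + (t - s)) =
      (∫ x, m s x * f (inner ℝ x e + (t - s₀))) - (s - s₀) * A' s + rem s := by
    intro s hsT
    have i1 := integrable_mul_of_cone (hm.1 s hsT) (hc s hsT) (hcont hf (t - s₀))
    have i2 : Integrable fun x => (s - s₀) * (m s x * deriv f (inner ℝ x e + (t - s₀))) :=
      (integrable_mul_of_cone (hm.1 s hsT) (hc s hsT) (hcont hf' (t - s₀))).const_mul _
    have i12 : Integrable fun x => m s x * f (inner ℝ x e + (t - s₀)) -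
        (s - s₀) * (m s x * deriv f (inner ℝ x e + (t - s₀))) := i1.sub i2
    have i3 : Integrable fun x => m s x * (f (inner ℝ x e + (t - s)) -
        f (inner ℝ x e + (t - s₀)) + (s - s₀) * deriv f (inner ℝ x e + (t - s₀))) :=
      integrable_mul_of_cone (hm.1 s hsT) (hc s hsT)
        (((hcont hf (t - s)).sub (hcont hf (t - s₀))).add
          ((hcont hf' (t - s₀)).const_mul (s - s₀)))
    rw [hA', hrem]
    simp only
    rw [← integral_const_mul, ← integral_sub i1 i2, ← integral_add i12 i3]
    refine integral_congr_ae (ae_of_all _ fun x => ?_)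
    simp only
    ring
  refine (((hD.sub hmid).add hremd).congr_of_mem hsplit hs₀).congr_deriv ?_
  ring

/-- Along a characteristic of the one-dimensional wave equation, the combination of `w_t` and `w` that
travels with it changes only through the source. -/
theorem SolvesWave.hasDerivWithinAt_travelling (hR : 0 < R) (hs : SolvesWave T h w₀ w₁ w wt)
    (hh : IsConeSource R T h) (hcw : VanishesOutsideCone R T w) (hct : VanishesOutsideCone R T wt)
    {f : ℝ → ℝ} (hf : ContDiff ℝ ∞ f) {e : EuclideanSpace ℝ (Fin n)} (he : ‖e‖ = 1)
    (t : ℝ) {s₀ : ℝ} (hs₀ : s₀ ∈ timeInterval T) :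
    HasDerivWithinAt (fun s => (∫ x, wt s x * f (inner ℝ x e + (t - s))) +
      ∫ x, w s x * deriv f (inner ℝ x e + (t - s)))
      (∫ x, h s₀ x * f (inner ℝ x e + (t - s₀))) (timeInterval T) s₀ := by
  have hf' := (contDiff_infty_iff_deriv.1 hf).2
  have hshift : ContDiff ℝ ∞ fun ρ => f (ρ + (t - s₀)) := hf.comp (contDiff_id.add contDiff_const)
  have e1 : deriv (fun ρ => f (ρ + (t - s₀))) = fun ρ => deriv f (ρ + (t - s₀)) := by
    funext ρ
    exact deriv_comp_add_const (f := f) (t - s₀) ρ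
  have e2 : deriv (fun ρ => deriv f (ρ + (t - s₀))) = fun ρ => deriv (deriv f) (ρ + (t - s₀)) := by
    funext ρ
    exact deriv_comp_add_const (f := deriv f) (t - s₀) ρ
  have h1 := hs.hasDerivWithinAt_planeWave hR hh hcw hct hshift he hs₀
  simp only [e1, e2] at h1
  have h2 := hasDerivWithinAt_integral_travelling hs.2.1 hct hf he hs₀ h1
  have h3 := hasDerivWithinAt_integral_mul hs.1 hs.2.1 hs.2.2.1 hcw hct
    (g := fun x => deriv f (inner ℝ x e + (t - s₀)))
    (hf'.continuous.comp (by fun_prop)) hs₀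
  have h4 := hasDerivWithinAt_integral_travelling hs.1 hcw hf' he hs₀ h3
  refine (h2.add h4).congr_deriv ?_
  ring

end PlaneWave

/-! ### Lower bounds for plane averages and for the mean -/

section LowerBound

variable {n : ℕ} {R : ℝ} {T : EReal} {h w wt : ℝ → EuclideanSpace ℝ (Fin n) → ℝ}
  {w₀ w₁ : EuclideanSpace ℝ (Fin n) → ℝ}

/-- Integration by parts in time: the substitution `y = 2 s + R` turns the contribution of the
source into an integral over the distance `y = t - ρ` of the plane `ρ` to the light cone. -/
theorem integral_mul_primitive_eq {H φ : ℝ → ℝ} (R : ℝ) {t : ℝ} (ht : 0 ≤ t) (hR : 0 < R)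
    (hH : ContinuousOn H (Set.Icc 0 t)) (hφ : Continuous φ) (hφs : ∀ ρ ≤ 0, φ ρ = 0) :
    ∫ s in (0 : ℝ)..t, H s * ∫ r in (0 : ℝ)..(t - 2 * s - R), φ r =
      ∫ y in R..(2 * t + R), φ (t - y) * ∫ s in (0 : ℝ)..((y - R) / 2), H s := by
  set F : ℝ → ℝ := fun ρ => ∫ r in (0 : ℝ)..ρ, φ r with hF
  have hFd : ∀ ρ, HasDerivAt F (φ ρ) ρ := fun ρ => (hφ.integral_hasStrictDerivAt 0 ρ).hasDerivAt
  have hFneg : ∀ ρ ≤ 0, F ρ = 0 := fun ρ hρ => by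
    rw [hF]
    simp only
    rw [intervalIntegral.integral_symm, neg_eq_zero]
    rw [intervalIntegral.integral_congr (g := fun _ => (0 : ℝ)) fun r hr => ?_]
    · simp
    · rw [Set.uIcc_of_le hρ] at hr
      exact hφs r hr.2
  set H' := Set.IccExtend ht (fun s => H s.1) with hH'
  have hc : Continuous H' := hH.domRestrict.Icc_extend'
  have heq : ∀ s ∈ Set.Icc 0 t, H' s = H s := fun s hs => Set.IccExtend_of_mem ht _ hs
  set V : ℝ → ℝ := fun s => ∫ r in (0 : ℝ)..s, H' r with hV
  have hVd : ∀ s, HasDerivAt V (H' s) s := fun s => (hc.integral_hasStrictDerivAt 0 s).hasDerivAt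
  have hVeq : ∀ s ∈ Set.Icc 0 t, ∫ r in (0 : ℝ)..s, H r = V s := fun s hs => by
    refine intervalIntegral.integral_congr fun r hr => ?_
    rw [Set.uIcc_of_le hs.1] at hr
    exact (heq r ⟨hr.1, hr.2.trans hs.2⟩).symm
  have hGd : ∀ s, HasDerivAt (fun s => F (t - 2 * s - R)) (-2 * φ (t - 2 * s - R)) s := fun s => by
    have h1 : HasDerivAt (fun s : ℝ => t - 2 * s - R) (-2) s := by
      have := (((hasDerivAt_id s).const_mul 2).const_sub t).sub_const R
      simpa using this
    refine ((hFd _).comp s h1).congr_deriv ?_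
    ring
  have hparts := intervalIntegral.integral_mul_deriv_eq_deriv_mul (a := 0) (b := t)
    (u := V) (v := fun s => F (t - 2 * s - R)) (u' := H') (v' := fun s => -2 * φ (t - 2 * s - R))
    (fun s _ => hVd s) (fun s _ => hGd s) (hc.intervalIntegrable _ _)
    ((Continuous.intervalIntegrable (by fun_prop)) _ _)
  have hV0 : V 0 = 0 := by simp [hV]
  have hFt : F (t - 2 * t - R) = 0 := hFneg _ (by linarith)
  rw [hV0, hFt] at hparts
  have hL : ∫ s in (0 : ℝ)..t, H s * F (t - 2 * s - R) =
      ∫ s in (0 : ℝ)..t, H' s * F (t - 2 * s - R) := by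
    refine intervalIntegral.integral_congr fun s hs => ?_
    rw [Set.uIcc_of_le ht] at hs
    simp only [heq s hs]
  have hRt : ∫ y in R..(2 * t + R), φ (t - y) * ∫ s in (0 : ℝ)..((y - R) / 2), H s =
      ∫ y in R..(2 * t + R), φ (t - y) * V ((y - R) / 2) := by
    refine intervalIntegral.integral_congr fun y hy => ?_
    rw [Set.uIcc_of_le (by linarith)] at hy
    rw [hVeq _ ⟨by linarith [hy.1], by linarith [hy.2]⟩]
  have hsub := intervalIntegral.smul_integral_comp_mul_add (a := 0) (b := t)
    (fun y => φ (t - y) * V ((y - R) / 2)) 2 R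
  rw [hL, hRt]
  simp only [smul_eq_mul, mul_zero, zero_add] at hsub
  rw [← hsub, ← intervalIntegral.integral_const_mul]
  have : ∫ s in (0 : ℝ)..t, H' s * F (t - 2 * s - R) =
      -∫ s in (0 : ℝ)..t, V s * (-2 * φ (t - 2 * s - R)) := by
    rw [hparts]
    ring
  rw [this, ← intervalIntegral.integral_neg]
  refine intervalIntegral.integral_congr fun s _ => ?_
  have e1 : t - (2 * s + R) = t - 2 * s - R := by ring
  have e2 : (2 * s + R - R) / 2 = s := by ring
  rw [e1, e2]
  ring

/-- Lower bound for plane averages of a solution: by finite speed of propagation, the plane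
`x · e = ρ` at time `t` sees the whole source up to time `(t - ρ - R) / 2`. The proof compares
left- and right-travelling waves with profile a primitive of `φ`. -/
theorem SolvesWave.le_integral_planeWave (hR : 0 < R) (hs : SolvesWave T h w₀ w₁ w wt)
    (hh : IsConeSource R T h) (hcw : VanishesOutsideCone R T w) (hct : VanishesOutsideCone R T wt)
    (hw0 : ∀ᵐ x, 0 ≤ w 0 x) {φ : ℝ → ℝ} (hφ : ContDiff ℝ ∞ φ) (hφ0 : ∀ ρ, 0 ≤ φ ρ)
    (hφs : ∀ ρ ≤ 0, φ ρ = 0) {e : EuclideanSpace ℝ (Fin n)} (he : ‖e‖ = 1)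
    {t : ℝ} (ht : t ∈ timeInterval T) :
    (∫ x, wt 0 x * ((∫ r in (0 : ℝ)..(inner ℝ x e + t), φ r) -
        ∫ r in (0 : ℝ)..(inner ℝ x e - t), φ r)) / 2 +
      (∫ y in R..(2 * t + R), φ (t - y) * ∫ s in (0 : ℝ)..((y - R) / 2), ∫ x, h s x) / 2 ≤
      ∫ x, w t x * φ (inner ℝ x e) := by
  have ht0 : 0 ≤ t := ht.1
  have h0T : (0 : ℝ) ∈ timeInterval T := mem_timeInterval_of_le ht le_rfl ht0
  have hsub := Icc_subset_timeInterval ht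
  set H : ℝ → ℝ := fun s => ∫ x, h s x with hH
  have hHc : ContinuousOn H (Set.Icc 0 t) := hh.continuousOn_integral.mono hsub
  rw [← integral_mul_primitive_eq R ht0 hR hHc hφ.continuous hφs]
  set F : ℝ → ℝ := fun ρ => ∫ r in (0 : ℝ)..ρ, φ r with hF
  have hFd : ∀ ρ, HasDerivAt F (φ ρ) ρ := fun ρ =>
    (hφ.continuous.integral_hasStrictDerivAt 0 ρ).hasDerivAt
  have hF' : deriv F = φ := funext fun ρ => (hFd ρ).deriv
  have hFs : ContDiff ℝ ∞ F := contDiff_infty_iff_deriv.2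
    ⟨fun ρ => (hFd ρ).differentiableAt, by rwa [hF']⟩
  have hFm : Monotone F := monotone_of_deriv_nonneg (fun ρ => (hFd ρ).differentiableAt)
    (fun ρ => by rw [hF']; exact hφ0 ρ)
  have hFneg : ∀ ρ ≤ 0, F ρ = 0 := fun ρ hρ => by
    rw [hF]
    simp only
    rw [intervalIntegral.integral_symm, neg_eq_zero]
    rw [intervalIntegral.integral_congr (g := fun _ => (0 : ℝ)) fun r hr => ?_]
    · simp
    · rw [Set.uIcc_of_le hρ] at hr
      exact hφs r hr.2
  have hGs : ContDiff ℝ ∞ fun ρ => F (-ρ) := hFs.comp contDiff_neg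
  have hG' : deriv (fun ρ => F (-ρ)) = fun ρ => -φ (-ρ) := by
    funext ρ
    rw [deriv_comp_neg, hF']
  have he' : ‖-e‖ = 1 := by rwa [norm_neg]
  have hP := fun s (hs' : s ∈ timeInterval T) =>
    hs.hasDerivWithinAt_travelling hR hh hcw hct hFs he t hs'
  have hQ := fun s (hs' : s ∈ timeInterval T) =>
    hs.hasDerivWithinAt_travelling hR hh hcw hct hGs he' t hs'
  simp only [hF'] at hP
  simp only [hG'] at hQ
  have arg : ∀ (x : EuclideanSpace ℝ (Fin n)) (s : ℝ),
      -(inner ℝ x (-e) + (t - s)) = inner ℝ x e - (t - s) := fun x s => by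
    rw [inner_neg_right]
    ring
  simp only [arg] at hQ
  have hZ := fun s hs' => (hP s hs').sub (hQ s hs')
  have hcx : ∀ {g : ℝ → ℝ}, Continuous g → ∀ c : ℝ,
      Continuous fun x : EuclideanSpace ℝ (Fin n) => g (inner ℝ x e + c) := fun hg c =>
    hg.comp (by fun_prop)
  have hcx' : ∀ {g : ℝ → ℝ}, Continuous g → ∀ c : ℝ,
      Continuous fun x : EuclideanSpace ℝ (Fin n) => g (inner ℝ x e - c) := fun hg c =>
    hg.comp (by fun_prop)
  have hmain := intervalIntegral.integral_le_sub_of_hasDeriv_right_of_le ht0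
    (φ := fun s => H s * F (t - 2 * s - R))
    (fun s hs' => (hZ s (hsub hs')).continuousWithinAt.mono hsub)
    (fun s hs' => by
      refine (hZ s (hsub ⟨hs'.1.le, hs'.2.le⟩)).mono_of_mem_nhdsWithin ?_
      refine mem_of_superset (Ioo_mem_nhdsGT hs'.2) fun r hr => hsub ⟨?_, hr.2.le⟩
      exact hs'.1.le.trans hr.1.le)
    (by
      refine ContinuousOn.integrableOn_Icc (hHc.mul (Continuous.continuousOn ?_))
      exact hFs.continuous.comp (by fun_prop))
    (fun s hs' => by
      have hsT := hsub ⟨hs'.1.le, hs'.2.le⟩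
      rw [← integral_sub (hh.integrable_mul hsT (hcx hFs.continuous _))
        (hh.integrable_mul hsT (hcx' hFs.continuous _)), hH]
      simp only
      rw [← integral_mul_const]
      refine integral_mono_ae ((hh.integrable _ hsT).mul_const _)
        ((hh.integrable_mul hsT (hcx hFs.continuous _)).sub
          (hh.integrable_mul hsT (hcx' hFs.continuous _))) ?_
      filter_upwards [hh.vanishes s hsT] with x hx
      rcases lt_or_ge (s + R) ‖x‖ with hxs | hxs
      · simp [hx hxs]
      · rw [← mul_sub]
        refine mul_le_mul_of_nonneg_left ?_ (hh.nonneg s x)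
        have hin : |inner ℝ x e| ≤ s + R := by
          refine (abs_real_inner_le_norm x e).trans ?_
          rwa [he, mul_one]
        have hin' := abs_le.1 hin
        rcases le_total 0 (t - 2 * s - R) with hts | hts
        · rw [hFneg (inner ℝ x e - (t - s)) (by linarith), sub_zero]
          exact hFm (by linarith)
        · rw [hFneg _ hts, sub_nonneg]
          exact hFm (by linarith [hs'.2]))
  simp only [Pi.sub_apply, sub_self, add_zero, sub_zero] at hmain
  have i0 : ∫ x, wt 0 x * (F (inner ℝ x e + t) - F (inner ℝ x e - t)) =
      (∫ x, wt 0 x * F (inner ℝ x e + t)) - ∫ x, wt 0 x * F (inner ℝ x e - t) := by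
    rw [← integral_sub (integrable_mul_of_cone (hs.2.1.1 0 h0T) (hct 0 h0T) (hcx hFs.continuous _))
      (integrable_mul_of_cone (hs.2.1.1 0 h0T) (hct 0 h0T) (hcx' hFs.continuous _))]
    simp only [mul_sub]
  have p1 : 0 ≤ ∫ x, w 0 x * φ (inner ℝ x e + t) :=
    integral_nonneg_of_ae (hw0.mono fun x hx => mul_nonneg hx (hφ0 _))
  have p2 : 0 ≤ ∫ x, w 0 x * φ (inner ℝ x e - t) :=
    integral_nonneg_of_ae (hw0.mono fun x hx => mul_nonneg hx (hφ0 _))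
  have n1 : ∀ s c, ∫ x, w s x * -φ (inner ℝ x e - c) = -∫ x, w s x * φ (inner ℝ x e - c) := by
    intro s c
    rw [← integral_neg]
    simp only [mul_neg]
  have n2 : ∫ x, w t x * -φ (inner ℝ x e) = -∫ x, w t x * φ (inner ℝ x e) := by
    simpa using n1 t 0
  rw [n1, n2] at hmain
  rw [i0]
  linarith

theorem uniqueDiffOn_timeInterval (hT : 0 < T) : UniqueDiffOn ℝ (timeInterval T) := by
  obtain ⟨t', h1, h2⟩ := exists_lt_mem_timeInterval (T := T) (t := 0) ⟨le_rfl, by simpa using hT⟩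
  refine uniqueDiffOn_convex ?_ ⟨t' / 2, ?_⟩
  · refine Set.OrdConnected.convex ⟨fun x hx y hy z hz => ?_⟩
    exact mem_timeInterval_of_le hy (hx.1.trans hz.1) hz.2
  · refine mem_interior.2 ⟨Set.Ioo 0 t', fun s hs => mem_timeInterval_of_le h2 hs.1.le hs.2.le,
      isOpen_Ioo, ?_⟩
    constructor <;> linarith

theorem timeInterval_mem_nhds {t : ℝ} (ht : t ∈ timeInterval T) (ht0 : 0 < t) :
    timeInterval T ∈ 𝓝 t := by
  obtain ⟨t', h1, h2⟩ := exists_lt_mem_timeInterval ht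
  exact mem_of_superset (Ioo_mem_nhds ht0 h1) fun s hs =>
    mem_timeInterval_of_le h2 hs.1.le hs.2.le

theorem SolvesWave.hasDerivWithinAt_mean (hs : SolvesWave T h w₀ w₁ w wt)
    (hcw : VanishesOutsideCone R T w) (hct : VanishesOutsideCone R T wt)
    {t : ℝ} (ht : t ∈ timeInterval T) :
    HasDerivWithinAt (mean w) (mean wt t) (timeInterval T) t := by
  have h1 := hasDerivWithinAt_integral_mul hs.1 hs.2.1 hs.2.2.1 hcw hct
    (continuous_const (y := (1 : ℝ))) ht
  simp only [mul_one] at h1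
  exact h1

theorem SolvesWave.hasDerivWithinAt_mean_deriv (hn : 0 < n) (hR : 0 < R)
    (hs : SolvesWave T h w₀ w₁ w wt) (hh : IsConeSource R T h)
    (hcw : VanishesOutsideCone R T w) (hct : VanishesOutsideCone R T wt)
    {t : ℝ} (ht : t ∈ timeInterval T) :
    HasDerivWithinAt (mean wt) (∫ x, h t x) (timeInterval T) t := by
  have he : ‖(EuclideanSpace.single (⟨0, hn⟩ : Fin n) (1 : ℝ))‖ = 1 := by simp
  have h1 := hs.hasDerivWithinAt_planeWave hR hh hcw hct
    (contDiff_const (c := (1 : ℝ))) he ht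
  simp only [mul_one] at h1
  exact HasDerivWithinAt.congr_deriv (f := mean wt) h1 (by simp)

theorem SolvesWave.contDiffOn_mean (hn : 0 < n) (hR : 0 < R) (hT : 0 < T)
    (hs : SolvesWave T h w₀ w₁ w wt) (hh : IsConeSource R T h)
    (hcw : VanishesOutsideCone R T w) (hct : VanishesOutsideCone R T wt) :
    ContDiffOn ℝ 2 (mean w) (timeInterval T) := by
  have hu := uniqueDiffOn_timeInterval hT
  have h1 := fun t (ht : t ∈ timeInterval T) => hs.hasDerivWithinAt_mean hcw hct ht
  have h2 := fun t (ht : t ∈ timeInterval T) => hs.hasDerivWithinAt_mean_deriv hn hR hh hcw hct ht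
  have e1 : Set.EqOn (derivWithin (mean w) (timeInterval T)) (mean wt) (timeInterval T) :=
    fun t ht => (h1 t ht).derivWithin (hu t ht)
  have e2 : Set.EqOn (derivWithin (mean wt) (timeInterval T)) (fun t => ∫ x, h t x)
      (timeInterval T) := fun t ht => (h2 t ht).derivWithin (hu t ht)
  have c1 : ContDiffOn ℝ 1 (mean wt) (timeInterval T) := by
    rw [show (1 : WithTop ℕ∞) = 0 + 1 from rfl, contDiffOn_succ_iff_derivWithin hu]
    refine ⟨fun t ht => (h2 t ht).differentiableWithinAt, by simp, ?_⟩
    rw [contDiffOn_zero]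
    exact hh.continuousOn_integral.congr e2
  rw [show (2 : WithTop ℕ∞) = 1 + 1 from by norm_num, contDiffOn_succ_iff_derivWithin hu]
  exact ⟨fun t ht => (h1 t ht).differentiableWithinAt, by simp, c1.congr e1⟩

theorem SolvesWave.deriv_deriv_mean (hn : 0 < n) (hR : 0 < R)
    (hs : SolvesWave T h w₀ w₁ w wt) (hh : IsConeSource R T h)
    (hcw : VanishesOutsideCone R T w) (hct : VanishesOutsideCone R T wt)
    {t : ℝ} (ht : t ∈ timeInterval T) (ht0 : 0 < t) :
    deriv (deriv (mean w)) t = ∫ x, h t x := by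
  obtain ⟨t', h1, h2⟩ := exists_lt_mem_timeInterval ht
  have e : deriv (mean w) =ᶠ[𝓝 t] mean wt := by
    filter_upwards [Ioo_mem_nhds ht0 h1] with s hsI
    have hsT := mem_timeInterval_of_le h2 hsI.1.le hsI.2.le
    exact ((hs.hasDerivWithinAt_mean hcw hct hsT).hasDerivAt
      (timeInterval_mem_nhds hsT hsI.1)).deriv
  rw [e.deriv_eq]
  exact ((hs.hasDerivWithinAt_mean_deriv hn hR hh hcw hct ht).hasDerivAt
    (timeInterval_mem_nhds ht ht0)).deriv

/-- The mean of a solution with non-negative data dominates `∫₀ᵗ (t - s) ∫ h(s)`, and the free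
motion `t ∫ w₁`. -/
theorem SolvesWave.le_mean (hn : 0 < n) (hR : 0 < R)
    (hs : SolvesWave T h w₀ w₁ w wt) (hh : IsConeSource R T h)
    (hcw : VanishesOutsideCone R T w) (hct : VanishesOutsideCone R T wt)
    (hw0 : ∀ᵐ x, 0 ≤ w 0 x) {t : ℝ} (ht : t ∈ timeInterval T) :
    t * mean wt 0 + ∫ s in (0 : ℝ)..t, (t - s) * ∫ x, h s x ≤ mean w t := by
  have ht0 : 0 ≤ t := ht.1
  have hsub := Icc_subset_timeInterval ht
  have hZ : ∀ s ∈ timeInterval T, HasDerivWithinAt (fun s => (t - s) * mean wt s + mean w s)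
      ((t - s) * ∫ x, h s x) (timeInterval T) s := fun s hsT => by
    have h1 : HasDerivWithinAt (fun s : ℝ => t - s) (-1) (timeInterval T) s :=
      ((hasDerivAt_id s).const_sub t).hasDerivWithinAt
    refine ((h1.mul (hs.hasDerivWithinAt_mean_deriv hn hR hh hcw hct hsT)).add
      (hs.hasDerivWithinAt_mean hcw hct hsT)).congr_deriv ?_
    ring
  have hmain := intervalIntegral.integral_le_sub_of_hasDeriv_right_of_le ht0
    (φ := fun s => (t - s) * ∫ x, h s x)
    (fun s hs' => (hZ s (hsub hs')).continuousWithinAt.mono hsub)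
    (fun s hs' => by
      refine (hZ s (hsub ⟨hs'.1.le, hs'.2.le⟩)).mono_of_mem_nhdsWithin ?_
      refine mem_of_superset (Ioo_mem_nhdsGT hs'.2) fun r hr => hsub ⟨?_, hr.2.le⟩
      exact hs'.1.le.trans hr.1.le)
    (ContinuousOn.integrableOn_Icc
      ((by fun_prop : Continuous fun s : ℝ => t - s).continuousOn.mul
        (hh.continuousOn_integral.mono hsub)))
    (fun s _ => le_rfl)
  have p : 0 ≤ mean w 0 := integral_nonneg_of_ae hw0
  simp only [sub_self, zero_mul, zero_add, sub_zero] at hmain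
  linarith

end LowerBound

/-! ### Kato's argument -/

/-- Hölder's inequality on a ball. -/
theorem rpow_integral_abs_le (n : ℕ) {r : ℝ} (hr : 1 < r) : ∃ V : ℝ, 0 < V ∧
    ∀ ρ : ℝ, 0 < ρ → ∀ f : EuclideanSpace ℝ (Fin n) → ℝ, MemLp f (ENNReal.ofReal r) volume →
      (∀ᵐ x, ρ < ‖x‖ → f x = 0) →
      (∫ x, |f x|) ^ r ≤ (V * ρ ^ n) ^ (r - 1) * ∫ x, |f x| ^ r := by
  set V := volume.real (Metric.ball (0 : EuclideanSpace ℝ (Fin n)) 1) with hV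
  have hVpos : 0 < V := by
    rw [hV, measureReal_def]
    exact ENNReal.toReal_pos (Metric.measure_ball_pos _ _ one_pos).ne' measure_ball_lt_top.ne
  refine ⟨V, hVpos, fun ρ hρ f hf hf0 => ?_⟩
  have hr0 : 0 < r := by linarith
  have hc : r.HolderConjugate (r / (r - 1)) := Real.HolderConjugate.conjExponent hr
  set B := Metric.closedBall (0 : EuclideanSpace ℝ (Fin n)) ρ with hB
  have hvol : volume.real B = V * ρ ^ n := by
    rw [hB, measureReal_def, Measure.addHaar_closedBall _ _ hρ.le, ENNReal.toReal_mul,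
      ENNReal.toReal_ofReal (by positivity), mul_comm]
    simp [hV, measureReal_def]
  have hBfin : IsFiniteMeasure (volume.restrict B) := ⟨by simpa using measure_closedBall_lt_top⟩
  have h1 : ∫ x, |f x| = ∫ x in B, |f x| * 1 := by
    rw [← integral_indicator measurableSet_closedBall]
    refine integral_congr_ae (hf0.mono fun x hx => ?_)
    by_cases h : x ∈ B
    · rw [Set.indicator_of_mem h, mul_one]
    · rw [Set.indicator_of_notMem h]
      simp only [hx (by simpa [hB] using h), abs_zero]
  have h2 := integral_mul_le_Lp_mul_Lq_of_nonneg hc (μ := volume.restrict B)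
    (f := fun x => |f x|) (g := fun _ => (1 : ℝ)) (ae_of_all _ fun x => abs_nonneg _)
    (ae_of_all _ fun x => zero_le_one) (hf.abs.restrict B) (memLp_const 1)
  rw [← h1] at h2
  have hint : Integrable fun x => |f x| ^ r := by
    have h := hf.integrable_norm_rpow (by simpa using hr0) ENNReal.ofReal_ne_top
    simpa [ENNReal.toReal_ofReal hr0.le] using h
  have h3 : ∫ x in B, |f x| ^ r ≤ ∫ x, |f x| ^ r :=
    setIntegral_le_integral hint (ae_of_all _ fun x => by positivity)
  have h4 : ∫ _ in B, (1 : ℝ) ^ (r / (r - 1)) = V * ρ ^ n := by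
    rw [← hvol]
    simp
  rw [h4] at h2
  have hI0 : 0 ≤ ∫ x in B, |f x| ^ r := integral_nonneg fun x => by positivity
  calc (∫ x, |f x|) ^ r
      ≤ ((∫ x in B, |f x| ^ r) ^ (1 / r) * (V * ρ ^ n) ^ (1 / (r / (r - 1)))) ^ r :=
        Real.rpow_le_rpow (integral_nonneg fun x => abs_nonneg _) h2 hr0.le
    _ = (V * ρ ^ n) ^ (r - 1) * ∫ x in B, |f x| ^ r := by
        rw [Real.mul_rpow (by positivity) (by positivity), ← Real.rpow_mul hI0,
          ← Real.rpow_mul (by positivity), one_div_mul_cancel hr0.ne', Real.rpow_one, mul_comm]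
        congr 2
        have : r - 1 ≠ 0 := by linarith
        field_simp
    _ ≤ _ := mul_le_mul_of_nonneg_left h3 (by positivity)

/-- The form of `rpow_le_of_le_plane_averages` with Bochner integrals, for functions of any sign. -/
theorem rpow_le_of_le_integral_planeWave (k : ℕ) (hk : 2 ≤ k) {p p' : ℝ}
    (hp : p.HolderConjugate p') :
    ∃ c : ℝ, 0 < c ∧ ∀ M : ℝ, 0 < M → ∀ φ : ℝ → ℝ, Continuous φ → (∀ ρ, 0 ≤ φ ρ) →
      (∀ ρ, φ ρ ≠ 0 → M / 32 ≤ ρ ∧ ρ < M) →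
      ∀ w : EuclideanSpace ℝ (Fin (k + 1)) → ℝ, MemLp w (ENNReal.ofReal p) volume →
      (∀ᵐ x, M ≤ ‖x‖ → w x = 0) →
      ∀ J I : ℝ, 0 ≤ J → 0 ≤ I → (∀ e : EuclideanSpace ℝ (Fin (k + 1)), ‖e‖ = 1 →
        J ≤ ∫ x, w x * φ (inner ℝ x e)) →
      ∫⁻ ρ, ENNReal.ofReal (φ ρ ^ p' * (M - ρ) ^ ((k : ℝ) * p' / 2)) ≤ ENNReal.ofReal I →
      J ^ p ≤ c * M ^ (-((k : ℝ) * (1 - p / 2))) * (∫ x, |w x| ^ p) * I ^ (p - 1) := by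
  obtain ⟨c, hc, H⟩ := rpow_le_of_le_plane_averages k hk hp
  refine ⟨c, hc, fun M hM φ hφ hφ0 hsupp w hw hw0 J I hJ hI hplane hφI => ?_⟩
  have hp0 : 0 < p := hp.pos
  have hp1 : 0 ≤ p - 1 := hp.sub_one_pos.le
  set f : EuclideanSpace ℝ (Fin (k + 1)) → ℝ≥0∞ :=
    (Metric.ball (0 : EuclideanSpace ℝ (Fin (k + 1))) M).indicator fun x => ‖hw.1.mk w x‖ₑ with hf
  have hfm : Measurable f := hw.1.stronglyMeasurable_mk.measurable.enorm.indicator measurableSet_ball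
  have hfw : f =ᵐ[volume] fun x => ‖w x‖ₑ := by
    filter_upwards [hw.1.ae_eq_mk, hw0] with x h1 h2
    by_cases hx : x ∈ Metric.ball (0 : EuclideanSpace ℝ (Fin (k + 1))) M
    · rw [hf, Set.indicator_of_mem hx, ← h1]
    · rw [hf, Set.indicator_of_notMem hx, h2 (by simpa using hx), enorm_zero]
  have hf0 : ∀ x, M ≤ ‖x‖ → f x = 0 := fun x hx => by
    rw [hf, Set.indicator_of_notMem (by simpa using hx)]
  have key := H M hM φ hφ.measurable hφ0 hsupp f hfm hf0 (ENNReal.ofReal J) (fun e he => by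
    refine (ENNReal.ofReal_le_ofReal (hplane e he)).trans ((Real.ofReal_le_enorm _).trans
      ((enorm_integral_le_lintegral_enorm _).trans (le_of_eq ?_)))
    refine lintegral_congr_ae (hfw.mono fun x hx => ?_)
    simp only [hx, enorm_mul]
    congr 1
    rw [Real.enorm_eq_ofReal (hφ0 _)])
  have hint : Integrable fun x => |w x| ^ p := by
    have h := hw.integrable_norm_rpow (by simpa using hp0) ENNReal.ofReal_ne_top
    simpa [ENNReal.toReal_ofReal hp0.le] using h
  have hfp : ∫⁻ x, f x ^ p = ENNReal.ofReal (∫ x, |w x| ^ p) := by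
    rw [ofReal_integral_eq_lintegral_ofReal hint (ae_of_all _ fun x => by positivity)]
    refine lintegral_congr_ae (hfw.mono fun x hx => ?_)
    simp only [hx]
    rw [Real.enorm_eq_ofReal_abs, ENNReal.ofReal_rpow_of_nonneg (abs_nonneg _) hp0.le]
  rw [hfp, ENNReal.ofReal_rpow_of_nonneg hJ hp0.le] at key
  have key2 := key.trans (mul_le_mul_right (ENNReal.rpow_le_rpow hφI hp1) _)
  rw [ENNReal.ofReal_rpow_of_nonneg hI hp1, ← ENNReal.ofReal_mul (by positivity),
    ← ENNReal.ofReal_mul (by positivity)] at key2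
  exact (ENNReal.ofReal_le_ofReal_iff (by positivity)).1 key2

theorem mul_le_integral_of_le {g : ℝ → ℝ} {t a b c : ℝ} (ha : 0 ≤ a) (hab : a ≤ b) (hbt : b ≤ t)
    (hg : ContinuousOn g (Set.Icc 0 t)) (hg0 : ∀ s ∈ Set.Icc 0 t, 0 ≤ g s)
    (hc : ∀ s ∈ Set.Icc a b, c ≤ g s) : (b - a) * c ≤ ∫ s in (0 : ℝ)..t, g s := by
  have hint : ∀ x y, 0 ≤ x → x ≤ y → y ≤ t → IntervalIntegrable g volume x y :=
    fun x y hx hxy hy => (hg.mono fun s hs => by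
      rw [Set.uIcc_of_le hxy] at hs
      exact ⟨hx.trans hs.1, hs.2.trans hy⟩).intervalIntegrable
  calc (b - a) * c = ∫ _ in a..b, c := by simp
    _ ≤ ∫ s in a..b, g s :=
        intervalIntegral.integral_mono_on hab (by simp) (hint a b ha hab hbt) hc
    _ ≤ ∫ s in (0 : ℝ)..t, g s := by
        refine intervalIntegral.integral_mono_interval ha hab hbt ?_ (hint 0 t le_rfl
          (ha.trans (hab.trans hbt)) le_rfl)
        filter_upwards [ae_restrict_mem measurableSet_Ioc] with s hs
        exact hg0 s ⟨hs.1.le, hs.2⟩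

/-- Kato's argument: if the second derivative `∫ h` of the mean of `u` is bounded below, then so is
the mean, and by Hölder's inequality on the ball of radius `t + R` also `∫ |u|^q`. -/
theorem kato_lower_bound (n : ℕ) {q m : ℝ} (hq : 1 < q) (hm : 0 ≤ m) : ∃ c : ℝ, 0 < c ∧
    ∀ (R : ℝ) (T : EReal) (h u ut : ℝ → EuclideanSpace ℝ (Fin n) → ℝ)
      (u₀ u₁ : EuclideanSpace ℝ (Fin n) → ℝ), 0 < n → 0 < R → SolvesWave T h u₀ u₁ u ut →
      IsConeSource R T h → VanishesOutsideCone R T u → VanishesOutsideCone R T ut →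
      ContinuousInLp T (ENNReal.ofReal q) u → (∀ᵐ x, 0 ≤ u 0 x) → 0 ≤ mean ut 0 →
      ∀ A β b K : ℝ, 0 ≤ A → 0 < β → 0 ≤ b → 0 ≤ K →
      (∀ s ∈ timeInterval T, A * R ≤ s →
        K * (s - A * R) ^ m * Real.log (1 + (s - A * R) / (β * R)) ^ b ≤ ∫ x, h s x) →
      ∀ t ∈ timeInterval T, A * R ≤ t →
        c * K ^ q * (t - A * R) ^ ((m + 2) * q) * (t + R) ^ (-((n : ℝ) * (q - 1))) *
          Real.log (1 + (t - A * R) / (2 * β * R)) ^ (b * q) ≤ ∫ x, |u t x| ^ q := by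
  obtain ⟨V, hV, hHolder⟩ := rpow_integral_abs_le n hq
  refine ⟨(16 * 2 ^ m) ^ (-q) * V ^ (-(q - 1)), by positivity, ?_⟩
  intro R T h u ut u₀ u₁ hn hR hs hh hcu hct huq hu0 hut0 A β b K hA hβ hb hK hyp t ht hAt
  have ht0 : 0 ≤ t := ht.1
  have hq0 : 0 < q := by linarith
  have hAR : 0 ≤ A * R := by positivity
  set η := t - A * R with hη
  have hη0 : 0 ≤ η := by rw [hη]; linarith
  set L := Real.log (1 + η / (2 * β * R)) with hL
  have hL0 : 0 ≤ L := Real.log_nonneg (by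
    have : 0 ≤ η / (2 * β * R) := by positivity
    linarith)
  set H : ℝ → ℝ := fun s => ∫ x, h s x with hH
  have hHc : ContinuousOn H (Set.Icc 0 t) :=
    hh.continuousOn_integral.mono (Icc_subset_timeInterval ht)
  have hH0 : ∀ s, 0 ≤ H s := fun s => integral_nonneg (hh.nonneg s)
  -- restrict the double time integral to `A R + η / 2 ≤ s ≤ A R + 3 η / 4`, where `t - s ≥ η / 4`
  have hU : η ^ 2 / 16 * (K * (η / 2) ^ m * L ^ b) ≤ mean u t := by
    refine le_trans ?_ (hs.le_mean hn hR hh hcu hct hu0 ht)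
    have h1 := mul_le_integral_of_le (g := fun s => (t - s) * H s) (t := t)
      (a := A * R + η / 2) (b := A * R + 3 * η / 4) (c := η / 4 * (K * (η / 2) ^ m * L ^ b))
      (by positivity) (by linarith) (by linarith)
      ((by fun_prop : Continuous fun s : ℝ => t - s).continuousOn.mul hHc)
      (fun s hs' => mul_nonneg (by linarith [hs'.2]) (hH0 s))
      (fun s hs' => by
        have hsA : A * R ≤ s := by linarith [hs'.1]
        have hsT := mem_timeInterval_of_le ht (hAR.trans hsA) (by linarith [hs'.2])
        refine mul_le_mul (by linarith [hs'.2]) ?_ (by positivity) (by linarith [hs'.2])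
        refine le_trans ?_ (hyp s hsT hsA)
        have h2 : η / 2 ≤ s - A * R := by linarith [hs'.1]
        refine mul_le_mul (mul_le_mul_of_nonneg_left
          (Real.rpow_le_rpow (by positivity) h2 hm) hK) ?_ (by positivity)
          (mul_nonneg hK (Real.rpow_nonneg (by linarith) _))
        refine Real.rpow_le_rpow hL0 (Real.log_le_log (by positivity) ?_) hb
        have h3 : η / (2 * β * R) = η / 2 / (β * R) := by
          field_simp
        rw [h3]
        gcongr)
    have h4 : 0 ≤ t * mean ut 0 := mul_nonneg ht0 hut0
    linarith
  have hU2 : mean u t ≤ ∫ x, |u t x| := (le_abs_self _).trans (abs_integral_le_integral_abs)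
  have htR : 0 < t + R := by linarith
  have hmain := (Real.rpow_le_rpow (by positivity) (hU.trans hU2) hq0.le).trans
    (hHolder (t + R) htR (u t) (huq.1 t ht) (hcu t ht))
  have e1 : (η ^ 2 / 16 * (K * (η / 2) ^ m * L ^ b)) ^ q =
      (16 * 2 ^ m) ^ (-q) * (K ^ q * η ^ ((m + 2) * q) * L ^ (b * q)) := by
    have : η ^ 2 / 16 * (K * (η / 2) ^ m * L ^ b) =
        (16 * 2 ^ m)⁻¹ * (K * η ^ (m + 2) * L ^ b) := by
      rw [Real.div_rpow hη0 (by norm_num), Real.rpow_add_of_nonneg hη0 hm (by norm_num),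
        Real.rpow_ofNat]
      field_simp
    rw [this, Real.mul_rpow (by positivity) (by positivity), Real.inv_rpow (by positivity),
      ← Real.rpow_neg (by positivity), Real.mul_rpow (x := K * η ^ (m + 2)) (by positivity)
      (by positivity), Real.mul_rpow hK (by positivity), ← Real.rpow_mul hη0, ← Real.rpow_mul hL0]
  have e2 : (V * (t + R) ^ n) ^ (q - 1) =
      (V ^ (-(q - 1)) * (t + R) ^ (-((n : ℝ) * (q - 1))))⁻¹ := by
    rw [Real.mul_rpow hV.le (by positivity), Real.rpow_neg hV.le, Real.rpow_neg htR.le, mul_inv,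
      inv_inv, inv_inv, ← Real.rpow_natCast, ← Real.rpow_mul htR.le]
  rw [e1, e2] at hmain
  have hpos2 : 0 < V ^ (-(q - 1)) * (t + R) ^ (-((n : ℝ) * (q - 1))) := by positivity
  rw [inv_mul_eq_div, le_div_iff₀ hpos2] at hmain
  refine le_trans (le_of_eq ?_) hmain
  ring

/-! ### One step of the iteration -/

/-- The properties of a solution of the system with non-negative data that the lower bounds use. -/
structure IsConeSolution {n : ℕ} (p q R : ℝ) (T : EReal)
    (u ut v vt : ℝ → EuclideanSpace ℝ (Fin n) → ℝ) : Prop where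
  R_pos : 0 < R
  solves_u : ∃ u₀ u₁, SolvesWave T (fun t x => |v t x| ^ p) u₀ u₁ u ut
  solves_v : ∃ v₀ v₁, SolvesWave T (fun t x => |u t x| ^ q) v₀ v₁ v vt
  source_u : IsConeSource R T fun t x => |u t x| ^ q
  source_v : IsConeSource R T fun t x => |v t x| ^ p
  cone_u : VanishesOutsideCone R T u
  cone_ut : VanishesOutsideCone R T ut
  cone_v : VanishesOutsideCone R T v
  cone_vt : VanishesOutsideCone R T vt
  continuous_u : ContinuousInLp T (ENNReal.ofReal q) u
  continuous_v : ContinuousInLp T (ENNReal.ofReal p) v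
  u_zero_nonneg : ∀ᵐ x, 0 ≤ u 0 x
  ut_zero_nonneg : ∀ᵐ x, 0 ≤ ut 0 x
  v_zero_nonneg : ∀ᵐ x, 0 ≤ v 0 x
  vt_zero_nonneg : ∀ᵐ x, 0 ≤ vt 0 x

/-- The logarithm gained in the iteration, as a function of the distance `y` to the light cone. -/
noncomputable def logGain (A β R y : ℝ) : ℝ := Real.log (1 + (y - (2 * A + 1) * R) / (8 * β * R))

theorem logGain_pos {A β R y : ℝ} (hβ : 0 < β) (hR : 0 < R) (hy : (2 * A + 1) * R < y) :
    0 < logGain A β R y := by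
  refine Real.log_pos ?_
  have : 0 < (y - (2 * A + 1) * R) / (8 * β * R) := div_pos (by linarith) (by positivity)
  linarith

/-- Lower bound for the mass that the source of the second equation has emitted up to the time
`(y - R) / 2`, from which it reaches the plane at distance `y` from the light cone. The condition
`(17 A / 8 + 1) R ≤ y` keeps this time away from `A R` by a fixed fraction of `y`. -/
theorem integral_source_lower_bound (k : ℕ) {p q m l : ℝ} (hq : 1 < q) (hm : 0 ≤ m)
    (hl : (m + 2) * q + 1 - ((k + 1 : ℕ) : ℝ) * (q - 1) = l) : ∃ c : ℝ, 0 < c ∧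
    ∀ (R : ℝ) (T : EReal) (u ut v vt : ℝ → EuclideanSpace ℝ (Fin (k + 1)) → ℝ),
      IsConeSolution p q R T u ut v vt →
      ∀ A β b K : ℝ, 1 ≤ A → 0 < β → 0 ≤ b → 0 ≤ K →
      (∀ s ∈ timeInterval T, A * R ≤ s →
        K * (s - A * R) ^ m * Real.log (1 + (s - A * R) / (β * R)) ^ b ≤ ∫ x, |v s x| ^ p) →
      ∀ y : ℝ, (17 * A / 8 + 1) * R ≤ y → (y - R) / 2 ∈ timeInterval T →
        c * K ^ q * (y ^ l * logGain A β R y ^ (b * q)) ≤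
          ∫ s in (0 : ℝ)..((y - R) / 2), ∫ x, |u s x| ^ q := by
  obtain ⟨c, hc, H⟩ := kato_lower_bound (k + 1) hq hm
  refine ⟨c * 100 ^ (-((m + 2) * q + 1)), by positivity, ?_⟩
  intro R T u ut v vt hsol A β b K hA hβ hb hK hyp y hy hyT
  have hR := hsol.R_pos
  obtain ⟨u₀, u₁, hs⟩ := hsol.solves_u
  have hA0 : 0 < A := by linarith
  have hAR : R ≤ A * R := by nlinarith
  have hbd := H R T _ u ut u₀ u₁ (Nat.succ_pos k) hR hs hsol.source_v hsol.cone_u hsol.cone_ut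
    hsol.continuous_u hsol.u_zero_nonneg (integral_nonneg_of_ae hsol.ut_zero_nonneg)
    A β b K hA0.le hβ hb hK hyp
  set S := (y - R) / 2 with hS
  set η := S - A * R with hη
  have hy0 : 0 < y := by nlinarith
  have hηy : y / 50 ≤ η := by rw [hη, hS]; nlinarith
  have hη0 : 0 < η := lt_of_lt_of_le (by positivity) hηy
  have hkq : 0 ≤ ((k + 1 : ℕ) : ℝ) * (q - 1) := mul_nonneg (Nat.cast_nonneg _) (by linarith)
  have hL : Real.log (1 + η / 2 / (2 * β * R)) = logGain A β R y := by
    unfold logGain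
    congr 2
    rw [hη, hS]
    field_simp
    ring
  have hL0 : 0 ≤ logGain A β R y := (logGain_pos hβ hR (by nlinarith)).le
  have h1 := mul_le_integral_of_le (g := fun s => ∫ x, |u s x| ^ q) (t := S)
    (a := A * R + η / 2) (b := S)
    (c := c * K ^ q * (η / 2) ^ ((m + 2) * q) * y ^ (-(((k + 1 : ℕ) : ℝ) * (q - 1))) *
      logGain A β R y ^ (b * q))
    (by positivity) (by linarith) le_rfl
    (hsol.source_u.continuousOn_integral.mono (Icc_subset_timeInterval hyT))
    (fun s _ => integral_nonneg fun x => by positivity)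
    (fun s hs' => by
      have hsA : A * R ≤ s := by linarith [hs'.1]
      have hsT := mem_timeInterval_of_le hyT (by linarith) hs'.2
      refine le_trans ?_ (hbd s hsT hsA)
      have h2 : η / 2 ≤ s - A * R := by linarith [hs'.1]
      have hKq : 0 ≤ c * K ^ q := by positivity
      have h4 : 0 < s + R := by linarith
      refine mul_le_mul (mul_le_mul (mul_le_mul_of_nonneg_left
        (Real.rpow_le_rpow (by positivity) h2 (by positivity)) hKq) ?_ (by positivity)
        (by positivity)) ?_ (by positivity) (by positivity)
      · exact Real.rpow_le_rpow_of_nonpos h4 (by linarith [hs'.2]) (by linarith)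
      · rw [← hL]
        refine Real.rpow_le_rpow (by rw [hL]; exact hL0) (Real.log_le_log (by positivity) ?_)
          (by positivity)
        gcongr)
  refine le_trans ?_ h1
  have e1 : S - (A * R + η / 2) = η / 2 := by rw [hη]; ring
  have e2 : y ^ l = y ^ ((m + 2) * q + 1) * y ^ (-(((k + 1 : ℕ) : ℝ) * (q - 1))) := by
    rw [← Real.rpow_add hy0, ← hl]
    congr 1
  have e3 : 100 ^ (-((m + 2) * q + 1)) * y ^ ((m + 2) * q + 1) ≤ η / 2 * (η / 2) ^ ((m + 2) * q) := by
    have : η / 2 * (η / 2) ^ ((m + 2) * q) = (η / 2) ^ ((m + 2) * q + 1) := by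
      rw [Real.rpow_add_one (by positivity)]
      ring
    rw [this, Real.rpow_neg (by norm_num), inv_mul_eq_div, ← Real.div_rpow hy0.le (by norm_num)]
    exact Real.rpow_le_rpow (by positivity) (by linarith) (by positivity)
  rw [e1, e2]
  calc c * 100 ^ (-((m + 2) * q + 1)) * K ^ q * (y ^ ((m + 2) * q + 1) *
        y ^ (-(((k + 1 : ℕ) : ℝ) * (q - 1))) * logGain A β R y ^ (b * q))
      = (100 ^ (-((m + 2) * q + 1)) * y ^ ((m + 2) * q + 1)) * (c * K ^ q *
        y ^ (-(((k + 1 : ℕ) : ℝ) * (q - 1))) * logGain A β R y ^ (b * q)) := by ring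
    _ ≤ (η / 2 * (η / 2) ^ ((m + 2) * q)) * (c * K ^ q *
        y ^ (-(((k + 1 : ℕ) : ℝ) * (q - 1))) * logGain A β R y ^ (b * q)) :=
        mul_le_mul_of_nonneg_right e3 (by positivity)
    _ = _ := by ring

theorem contDiff_bump_mul_rpow {c : ℝ} (θ : ContDiffBump c) {A β R : ℝ} (hA : 0 ≤ A) (hβ : 0 < β)
    (hR : 0 < R) (hθ : ∀ y ∈ Metric.closedBall c θ.rOut, (2 * A + 1) * R < y) (α γ : ℝ) :
    ContDiff ℝ ∞ fun y => θ y * (y ^ α * logGain A β R y ^ γ) := by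
  refine contDiff_iff_contDiffAt.2 fun y => ?_
  by_cases hy1 : y ∈ Metric.closedBall c θ.rOut
  swap
  · refine contDiffAt_const (c := (0 : ℝ)).congr_of_eventuallyEq ?_
    filter_upwards [Metric.isClosed_closedBall.isOpen_compl.mem_nhds hy1] with z hz
    rw [θ.zero_of_le_dist (not_le.1 (mt Metric.mem_closedBall.2 hz)).le, zero_mul]
  have hy2 := hθ y hy1
  have hy0 : 0 < y := lt_of_le_of_lt (by positivity) hy2
  have hL := logGain_pos hβ hR hy2
  have harg : 1 + (y - (2 * A + 1) * R) / (8 * β * R) ≠ 0 := by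
    have : 0 < (y - (2 * A + 1) * R) / (8 * β * R) := div_pos (by linarith) (by positivity)
    linarith
  refine θ.contDiff.contDiffAt.mul ((contDiffAt_id.rpow_const_of_ne hy0.ne').mul ?_)
  refine ContDiffAt.rpow_const_of_ne ?_ hL.ne'
  unfold logGain
  refine ContDiffAt.log ?_ harg
  fun_prop

set_option maxHeartbeats 1000000 in
/-- One step of the iteration. The plane averages of `v(t)` are taken against a power of `y = t - ρ`
times a power of the logarithm, cut off to `(9 A / 4 + 1) R ≤ y ≤ 7 t / 8`. The powers are those for
which the pairing with the source and the weighted norm of the test function are both multiples of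
the same integral `I`, and the critical relation between `p` and `q` makes the weight in this integral
exactly `1 / y`. Integrating it produces one more logarithm. -/
theorem iteration_step (k : ℕ) (hk : 2 ≤ k) {p q : ℝ} (hp : 1 < p) (hp2 : p ≤ 2) (hq : 1 < q)
    (hcrit : ((k : ℝ) * (1 - p / 2) + 2) * q + 1 - ((k + 1 : ℕ) : ℝ) * (q - 1) =
      (k : ℝ) / 2 - 1 / p) : ∃ c : ℝ, 0 < c ∧
    ∀ (R : ℝ) (T : EReal) (u ut v vt : ℝ → EuclideanSpace ℝ (Fin (k + 1)) → ℝ),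
      IsConeSolution p q R T u ut v vt →
      ∀ A β b K : ℝ, 1 ≤ A → 0 < β → 0 ≤ b → 0 ≤ K →
      (∀ s ∈ timeInterval T, A * R ≤ s →
        K * (s - A * R) ^ ((k : ℝ) * (1 - p / 2)) *
          Real.log (1 + (s - A * R) / (β * R)) ^ b ≤ ∫ x, |v s x| ^ p) →
      ∀ t ∈ timeInterval T, (9 * A / 4 + 1) * R < 7 * t / 8 →
        c * K ^ (p * q) * t ^ ((k : ℝ) * (1 - p / 2)) *
          ∫ y in ((9 * A / 4 + 1) * R)..(7 * t / 8), y ^ (-1 : ℝ) * logGain A β R y ^ (b * p * q) ≤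
        ∫ x, |v t x| ^ p := by
  set m : ℝ := (k : ℝ) * (1 - p / 2) with hm
  have hm0 : 0 ≤ m := mul_nonneg (Nat.cast_nonneg _) (by linarith)
  set l : ℝ := (k : ℝ) / 2 - 1 / p with hl
  have hconj : p.HolderConjugate (p / (p - 1)) := Real.HolderConjugate.conjExponent hp
  set p' := p / (p - 1) with hp'
  have hp'1 : 1 < p' := hconj.symm.lt
  have hp'0 : 0 < p' := by linarith
  have hpp' : (p - 1) * p' = p := hconj.sub_one_mul_conj
  obtain ⟨c₁, hc₁, H₁⟩ := integral_source_lower_bound k (p := p) hq hm0 hcrit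
  obtain ⟨c₂, hc₂, H₂⟩ := rpow_le_of_le_integral_planeWave k hk hconj
  set d : ℝ := 3 ^ ((k : ℝ) * p' / 2) with hd
  have hd0 : 0 < d := by positivity
  refine ⟨(c₁ / 2) ^ p * (c₂ * d ^ (p - 1))⁻¹, by positivity, ?_⟩
  intro R T u ut v vt hsol A β b K hA hβ hb hK hyp t ht hAt
  have hR := hsol.R_pos
  obtain ⟨v₀, v₁, hs⟩ := hsol.solves_v
  have hA0 : 0 < A := by linarith
  have hAR : R ≤ A * R := by nlinarith
  have ht0 : 0 < t := by nlinarith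
  set y₀ := (9 * A / 4 + 1) * R with hy₀
  set y₁ := 7 * t / 8 with hy₁
  -- the width of the transition of the cut-off, which leaves its support in
  -- `(17 A / 8 + 1) R ≤ y ≤ 15 t / 16`
  set δ := min (A * R / 8) (t / 16) with hδ
  have hδ0 : 0 < δ := lt_min (by positivity) (by positivity)
  have hδ1 : δ ≤ A * R / 8 := min_le_left _ _
  have hδ2 : δ ≤ t / 16 := min_le_right _ _
  set θ : ContDiffBump ((y₀ + y₁) / 2) :=
    ⟨(y₁ - y₀) / 2, (y₁ - y₀) / 2 + δ, by linarith, by linarith⟩ with hθ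
  have hball : ∀ y ∈ Metric.closedBall ((y₀ + y₁) / 2) θ.rOut,
      (17 * A / 8 + 1) * R ≤ y ∧ y ≤ 15 * t / 16 := fun y hy => by
    rw [Metric.mem_closedBall, Real.dist_eq] at hy
    have hy' : |y - (y₀ + y₁) / 2| ≤ (y₁ - y₀) / 2 + δ := hy
    rw [abs_le] at hy'
    constructor
    · nlinarith [hy'.1]
    · linarith [hy'.2]
  have hθsupp : ∀ y, θ y ≠ 0 → (17 * A / 8 + 1) * R ≤ y ∧ y ≤ 15 * t / 16 := fun y hy => by
    refine hball y ?_
    by_contra hcon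
    rw [Metric.mem_closedBall, not_le] at hcon
    exact hy (θ.zero_of_le_dist hcon.le)
  have hθ0 : ∀ y, 0 ≤ θ y := fun y => θ.nonneg
  have hθ1 : ∀ y, θ y ≤ 1 := fun y => θ.le_one
  have hball' : ∀ y ∈ Metric.closedBall ((y₀ + y₁) / 2) θ.rOut, (2 * A + 1) * R < y :=
    fun y hy => by nlinarith [(hball y hy).1]
  have hpos : ∀ y, θ y ≠ 0 → 0 < y ∧ 0 < logGain A β R y := fun y hy => by
    have h := hθsupp y hy
    exact ⟨by nlinarith [h.1], logGain_pos hβ hR (by nlinarith [h.1])⟩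
  set χ : ℝ → ℝ := fun y => θ y * (y ^ (-(l + 1)) * logGain A β R y ^ (b * q * (p - 1))) with hχ
  set g : ℝ → ℝ := fun y => θ y * (y ^ (-1 : ℝ) * logGain A β R y ^ (b * p * q)) with hg
  have hχs : ContDiff ℝ ∞ χ := contDiff_bump_mul_rpow θ hA0.le hβ hR hball' _ _
  have hgs : ContDiff ℝ ∞ g := contDiff_bump_mul_rpow θ hA0.le hβ hR hball' _ _
  have hχ0 : ∀ y, 0 ≤ χ y := fun y => by
    by_cases h : θ y = 0
    · simp [hχ, h]
    · obtain ⟨h1, h2⟩ := hpos y h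
      exact mul_nonneg (hθ0 y) (by positivity)
  have hg0 : ∀ y, 0 ≤ g y := fun y => by
    by_cases h : θ y = 0
    · simp [hg, h]
    · obtain ⟨h1, h2⟩ := hpos y h
      exact mul_nonneg (hθ0 y) (by positivity)
  set φ : ℝ → ℝ := fun ρ => χ (t - ρ) with hφ
  have hφs : ContDiff ℝ ∞ φ := hχs.comp (contDiff_const.sub contDiff_id)
  have hχθ : ∀ y, χ y ≠ 0 → θ y ≠ 0 := fun y hy h => hy (by simp [hχ, h])
  have hgθ : ∀ y, g y ≠ 0 → θ y ≠ 0 := fun y hy h => hy (by simp [hg, h])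
  have hφneg : ∀ ρ ≤ 0, φ ρ = 0 := fun ρ hρ => by
    by_contra hcon
    have := (hθsupp _ (hχθ _ hcon)).2
    linarith
  set I : ℝ := ∫ y in R..(2 * t + R), g y with hI
  have hIle : ∫ y in y₀..y₁, y ^ (-1 : ℝ) * logGain A β R y ^ (b * p * q) ≤ I := by
    have e : ∫ y in y₀..y₁, y ^ (-1 : ℝ) * logGain A β R y ^ (b * p * q) = ∫ y in y₀..y₁, g y := by
      refine intervalIntegral.integral_congr fun y hy => ?_
      rw [Set.uIcc_of_le hAt.le] at hy
      have : θ y = 1 := θ.one_of_mem_closedBall (by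
        rw [Metric.mem_closedBall, Real.dist_eq, abs_le]
        change -((y₁ - y₀) / 2) ≤ _ ∧ _ ≤ (y₁ - y₀) / 2
        constructor <;> linarith [hy.1, hy.2])
      simp [hg, this]
    rw [e]
    exact intervalIntegral.integral_mono_interval (by nlinarith) hAt.le (by linarith)
      (ae_of_all _ hg0) (hgs.continuous.intervalIntegrable _ _)
  have hI0 : 0 ≤ I := intervalIntegral.integral_nonneg (by linarith) fun y _ => hg0 y
  -- the plane averages of `v(t)` against `φ`
  set J : ℝ := c₁ * K ^ q * I / 2 with hJ
  have hJ0 : 0 ≤ J := by positivity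
  have hplane : ∀ e : EuclideanSpace ℝ (Fin (k + 1)), ‖e‖ = 1 →
      J ≤ ∫ x, v t x * φ (inner ℝ x e) := by
    intro e he
    refine le_trans ?_ (hs.le_integral_planeWave hR hsol.source_u hsol.cone_v hsol.cone_vt
      hsol.v_zero_nonneg hφs (fun ρ => hχ0 _) hφneg he ht)
    have hfree : 0 ≤ ∫ x, vt 0 x * ((∫ r in (0 : ℝ)..(inner ℝ x e + t), φ r) -
        ∫ r in (0 : ℝ)..(inner ℝ x e - t), φ r) := by
      refine integral_nonneg_of_ae (hsol.vt_zero_nonneg.mono fun x hx => mul_nonneg hx ?_)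
      rw [intervalIntegral.integral_interval_sub_left (hφs.continuous.intervalIntegrable _ _)
        (hφs.continuous.intervalIntegrable _ _)]
      exact intervalIntegral.integral_nonneg (by linarith) fun r _ => hχ0 _
    have hsource : c₁ * K ^ q * I ≤ ∫ y in R..(2 * t + R), φ (t - y) *
        ∫ s in (0 : ℝ)..((y - R) / 2), ∫ x, |u s x| ^ q := by
      rw [hI, ← intervalIntegral.integral_const_mul]
      have hV : ContinuousOn (fun s => ∫ r in (0 : ℝ)..s, ∫ x, |u r x| ^ q) (timeInterval T) :=
        fun s hsT => (hasDerivWithinAt_integral_timeInterval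
          hsol.source_u.continuousOn_integral hsT).continuousWithinAt
      refine intervalIntegral.integral_mono_on (by linarith)
        ((hgs.continuous.const_mul _).intervalIntegrable _ _) ?_ fun y hy => ?_
      · refine ContinuousOn.intervalIntegrable (ContinuousOn.mul
          (hφs.continuous.comp (by fun_prop)).continuousOn
          (hV.comp (by fun_prop) fun y hy => ?_))
        rw [Set.uIcc_of_le (by linarith)] at hy
        exact mem_timeInterval_of_le ht (by linarith [hy.1]) (by linarith [hy.2])
      · by_cases h : θ y = 0
        · simp [hg, hφ, hχ, h]
        obtain ⟨hy0, hL0⟩ := hpos y h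
        have hyT : (y - R) / 2 ∈ timeInterval T :=
          mem_timeInterval_of_le ht (by linarith [hy.1]) (by linarith [hy.2])
        have hbd := H₁ R T u ut v vt hsol A β b K hA hβ hb hK hyp y (hθsupp y h).1 hyT
        have e1 : φ (t - y) = χ y := by simp [hφ]
        rw [e1]
        refine le_trans (le_of_eq ?_) (mul_le_mul_of_nonneg_left hbd (hχ0 y))
        simp only [hg, hχ]
        have e2 : y ^ (-1 : ℝ) = y ^ (-(l + 1)) * y ^ l := by
          rw [← Real.rpow_add hy0]
          congr 1
          ring
        have e3 : logGain A β R y ^ (b * p * q) =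
            logGain A β R y ^ (b * q * (p - 1)) * logGain A β R y ^ (b * q) := by
          rw [← Real.rpow_add hL0]
          congr 1
          ring
        rw [e2, e3]
        ring
    rw [hJ]
    linarith
  -- the norm of the test function
  -- the radius `t + 2 R` rather than `t + R` makes `M - ρ = y + 2 R` comparable to `y`
  set M := t + 2 * R with hM
  have hM0 : 0 < M := by linarith
  have hφM : ∀ ρ, φ ρ ≠ 0 → M / 32 ≤ ρ ∧ ρ < M := fun ρ hρ => by
    have h := hθsupp _ (hχθ _ hρ)
    constructor
    · linarith [h.2]
    · nlinarith [h.1]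
  have hnorm : ∫⁻ ρ, ENNReal.ofReal (φ ρ ^ p' * (M - ρ) ^ ((k : ℝ) * p' / 2)) ≤
      ENNReal.ofReal (d * I) := by
    have hgi : Integrable g := by
      refine hgs.continuous.integrable_of_hasCompactSupport ?_
      exact θ.hasCompactSupport.mul_right
    have hIeq : I = ∫ y, g y := by
      rw [hI, intervalIntegral.integral_of_le (by linarith)]
      refine setIntegral_eq_integral_of_forall_compl_eq_zero fun y hy => ?_
      by_contra hcon
      have h := hθsupp y (hgθ y hcon)
      exact hy ⟨by nlinarith [h.1], by linarith [h.2]⟩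
    have h1 : ∫⁻ ρ, ENNReal.ofReal (φ ρ ^ p' * (M - ρ) ^ ((k : ℝ) * p' / 2)) ≤
        ∫⁻ ρ, ENNReal.ofReal (d * g (t - ρ)) := by
      refine lintegral_mono fun ρ => ENNReal.ofReal_le_ofReal ?_
      set y := t - ρ with hy
      have e0 : φ ρ = χ y := rfl
      rw [e0]
      by_cases h : θ y = 0
      · have : χ y = 0 := by simp [hχ, h]
        rw [this, Real.zero_rpow hp'0.ne', zero_mul]
        exact mul_nonneg hd0.le (hg0 _)
      obtain ⟨hy0, hL0⟩ := hpos y h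
      have hyR : R ≤ y := by nlinarith [(hθsupp y h).1]
      have hMρ : M - ρ ≤ 3 * y := by rw [hM]; linarith
      have hMρ0 : 0 ≤ M - ρ := by rw [hM]; linarith
      have e1 : (M - ρ) ^ ((k : ℝ) * p' / 2) ≤ d * y ^ ((k : ℝ) * p' / 2) := by
        rw [hd, ← Real.mul_rpow (by norm_num) hy0.le]
        exact Real.rpow_le_rpow hMρ0 hMρ (by positivity)
      have e2 : χ y ^ p' = θ y ^ p' * (y ^ (-(l + 1) * p') * logGain A β R y ^ (b * p * q)) := by
        simp only [hχ]
        rw [Real.mul_rpow (hθ0 y) (by positivity), Real.mul_rpow (by positivity) (by positivity),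
          ← Real.rpow_mul hy0.le, ← Real.rpow_mul hL0.le]
        congr 3
        linear_combination (b * q) * hpp'
      have e3 : θ y ^ p' ≤ θ y := by
        have := Real.rpow_le_rpow_of_exponent_ge (lt_of_le_of_ne (hθ0 y) (Ne.symm h)) (hθ1 y)
          hp'1.le
        rwa [Real.rpow_one] at this
      have e4 : y ^ (-1 : ℝ) = y ^ (-(l + 1) * p') * y ^ ((k : ℝ) * p' / 2) := by
        rw [← Real.rpow_add hy0]
        congr 1
        rw [hl]
        have h5 : p' * (1 / p - 1) = -1 := by
          have : p' = p / (p - 1) := hp'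
          have h6 : p - 1 ≠ 0 := by linarith
          rw [this]
          field_simp
          ring
        linear_combination -h5
      calc χ y ^ p' * (M - ρ) ^ ((k : ℝ) * p' / 2)
          ≤ (θ y * (y ^ (-(l + 1) * p') * logGain A β R y ^ (b * p * q))) *
            (d * y ^ ((k : ℝ) * p' / 2)) := by
            rw [e2]
            exact mul_le_mul (mul_le_mul_of_nonneg_right e3 (by positivity)) e1
              (by positivity) (mul_nonneg (hθ0 y) (by positivity))
        _ = d * g y := by
            simp only [hg]
            rw [e4]
            ring
    refine h1.trans (le_of_eq ?_)
    rw [lintegral_sub_left_eq_self (fun y => ENNReal.ofReal (d * g y)) t,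
      ← ofReal_integral_eq_lintegral_ofReal (hgi.const_mul d)
        (ae_of_all _ fun y => mul_nonneg hd0.le (hg0 y)), integral_const_mul, hIeq]
  have hfinal := H₂ M hM0 φ hφs.continuous (fun ρ => hχ0 _) hφM (v t) (hsol.continuous_v.1 t ht)
    ((hsol.cone_v t ht).mono fun x hx hMx => hx (by rw [hM] at hMx; linarith)) J (d * I) hJ0
    (by positivity) hplane hnorm
  have hW0 : 0 ≤ ∫ x, |v t x| ^ p := integral_nonneg fun x => by positivity
  rcases hI0.eq_or_lt with hIz | hIpos
  · have h1 : c₁ * K ^ q * I / 2 = 0 := by rw [← hIz]; ring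
    have h2 : ∫ y in y₀..y₁, y ^ (-1 : ℝ) * logGain A β R y ^ (b * p * q) ≤ 0 := by rwa [hIz]
    exact (mul_nonpos_of_nonneg_of_nonpos (by positivity) h2).trans hW0
  · have e1 : J ^ p = (c₁ / 2) ^ p * K ^ (p * q) * I ^ (p - 1) * I := by
      rw [hJ, show c₁ * K ^ q * I / 2 = (c₁ / 2) * K ^ q * I by ring,
        Real.mul_rpow (by positivity) hI0, Real.mul_rpow (by positivity) (by positivity),
        ← Real.rpow_mul hK, mul_comm q p, mul_assoc _ (I ^ (p - 1)), ← Real.rpow_add_one hIpos.ne']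
      congr 2
      ring
    have e2 : (d * I) ^ (p - 1) = d ^ (p - 1) * I ^ (p - 1) := Real.mul_rpow hd0.le hI0
    rw [e1, e2, Real.rpow_neg hM0.le] at hfinal
    have h3 : (c₁ / 2) ^ p * (c₂ * d ^ (p - 1))⁻¹ * K ^ (p * q) * M ^ m * I ≤
        ∫ x, |v t x| ^ p := by
      have hX : 0 < c₂ * (M ^ m)⁻¹ * d ^ (p - 1) * I ^ (p - 1) := by positivity
      refine le_of_mul_le_mul_left ?_ hX
      refine le_trans (le_of_eq ?_) (hfinal.trans (le_of_eq ?_))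
      · field_simp
      · ring
    refine le_trans ?_ h3
    have h4 : t ^ m ≤ M ^ m := Real.rpow_le_rpow ht0.le (by linarith) hm0
    refine mul_le_mul (mul_le_mul_of_nonneg_left h4 (by positivity)) hIle ?_ (by positivity)
    refine intervalIntegral.integral_nonneg hAt.le fun y hy => ?_
    have hy0 : 0 < y := by nlinarith [hy.1]
    have := logGain_pos (A := A) hβ hR (y := y) (by nlinarith [hy.1])
    positivity

/-! ### The iteration -/

/-- The gain of one logarithm. The weight `1 / y` dominates the derivative of `logGain`, so the
integral is at least a difference of powers of `logGain`, which superadditivity of `x ↦ x^(κ+1)`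
bounds below by the power of the difference. -/
theorem log_rpow_le_integral {A A' β β' R κ t : ℝ} (hA : 0 < A) (hβ : 0 < β) (hAβ : 2 * A + 1 ≤ 8 * β)
    (hA' : 9 * A / 4 + 1 ≤ 7 * A' / 8) (hβ' : 8 / 7 * (8 * β + A / 4) ≤ β') (hR : 0 < R)
    (hκ : 0 ≤ κ) (ht : A' * R ≤ t) :
    Real.log (1 + (t - A' * R) / (β' * R)) ^ (κ + 1) / (κ + 1) ≤
      ∫ y in ((9 * A / 4 + 1) * R)..(7 * t / 8), y ^ (-1 : ℝ) * logGain A β R y ^ κ := by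
  set y₀ := (9 * A / 4 + 1) * R with hy₀
  set y₁ := 7 * t / 8 with hy₁
  have h01 : y₀ ≤ y₁ := by
    rw [hy₀, hy₁]
    nlinarith
  have hAR : 0 < A * R := by positivity
  have hgt : ∀ y ∈ Set.Icc y₀ y₁, (2 * A + 1) * R < y := fun y hy => by
    have := hy.1
    rw [hy₀] at this
    nlinarith
  have hpos : ∀ y ∈ Set.Icc y₀ y₁, 0 < y := fun y hy =>
    lt_trans (by positivity) (hgt y hy)
  have hden : ∀ y ∈ Set.Icc y₀ y₁, 0 < 8 * β * R + (y - (2 * A + 1) * R) := fun y hy => by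
    have := hgt y hy
    have : 0 < 8 * β * R := by positivity
    linarith
  have hL : ∀ y ∈ Set.Icc y₀ y₁, 0 < logGain A β R y := fun y hy => logGain_pos hβ hR (hgt y hy)
  have hLeq : ∀ y, logGain A β R y =
      Real.log ((8 * β * R + (y - (2 * A + 1) * R)) / (8 * β * R)) := fun y => by
    unfold logGain
    congr 1
    field_simp
  have hLd : ∀ y ∈ Set.Icc y₀ y₁, HasDerivAt (logGain A β R)
      (8 * β * R + (y - (2 * A + 1) * R))⁻¹ y := fun y hy => by
    have h1 : HasDerivAt (fun y => 1 + (y - (2 * A + 1) * R) / (8 * β * R)) (1 / (8 * β * R)) y :=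
      (((hasDerivAt_id y).sub_const _).div_const _).const_add 1
    have h0 : 1 + (y - (2 * A + 1) * R) / (8 * β * R) =
        (8 * β * R + (y - (2 * A + 1) * R)) / (8 * β * R) := by field_simp
    have h2 := h1.log (by
      rw [h0]
      exact (div_pos (hden y hy) (by positivity)).ne')
    refine h2.congr_deriv ?_
    rw [h0]
    have := (hden y hy).ne'
    field_simp
  have hcL : ContinuousOn (logGain A β R) (Set.Icc y₀ y₁) := fun y hy =>
    (hLd y hy).continuousAt.continuousWithinAt
  have hcLκ : ContinuousOn (fun y => logGain A β R y ^ κ) (Set.Icc y₀ y₁) :=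
    hcL.rpow_const fun y hy => Or.inl (hL y hy).ne'
  have hci : ContinuousOn (fun y => (8 * β * R + (y - (2 * A + 1) * R))⁻¹ * logGain A β R y ^ κ)
      (Set.Icc y₀ y₁) :=
    (ContinuousOn.inv₀ (by fun_prop) fun y hy => (hden y hy).ne').mul hcLκ
  have hcj : ContinuousOn (fun y : ℝ => y ^ (-1 : ℝ) * logGain A β R y ^ κ) (Set.Icc y₀ y₁) :=
    (continuousOn_id.rpow_const fun y hy => Or.inl (hpos y hy).ne').mul hcLκ
  have hG : ∫ y in y₀..y₁, (8 * β * R + (y - (2 * A + 1) * R))⁻¹ * logGain A β R y ^ κ =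
      logGain A β R y₁ ^ (κ + 1) / (κ + 1) - logGain A β R y₀ ^ (κ + 1) / (κ + 1) := by
    refine intervalIntegral.integral_eq_sub_of_hasDerivAt (f := fun y =>
      logGain A β R y ^ (κ + 1) / (κ + 1)) (fun y hy => ?_) (hci.intervalIntegrable_of_Icc h01)
    rw [Set.uIcc_of_le h01] at hy
    refine (((hLd y hy).rpow_const (p := κ + 1) (Or.inl (hL y hy).ne')).div_const
      (κ + 1)).congr_deriv ?_
    have : κ + 1 ≠ 0 := by positivity
    rw [add_sub_cancel_right]
    field_simp
  have hmono : ∫ y in y₀..y₁, (8 * β * R + (y - (2 * A + 1) * R))⁻¹ * logGain A β R y ^ κ ≤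
      ∫ y in y₀..y₁, y ^ (-1 : ℝ) * logGain A β R y ^ κ := by
    refine intervalIntegral.integral_mono_on h01 (hci.intervalIntegrable_of_Icc h01)
      (hcj.intervalIntegrable_of_Icc h01) fun y hy => ?_
    rw [Real.rpow_neg_one]
    refine mul_le_mul_of_nonneg_right (inv_anti₀ (hpos y hy) ?_)
      (Real.rpow_nonneg (hL y hy).le _)
    nlinarith
  refine le_trans ?_ hmono
  rw [hG, ← sub_div]
  refine div_le_div_of_nonneg_right ?_ (by positivity)
  have hm0 : y₀ ∈ Set.Icc y₀ y₁ := ⟨le_rfl, h01⟩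
  have hm1 : y₁ ∈ Set.Icc y₀ y₁ := ⟨h01, le_rfl⟩
  have hβ'0 : 0 < β' := lt_of_lt_of_le (by positivity) hβ'
  have harg : 0 ≤ (t - A' * R) / (β' * R) := div_nonneg (by linarith) (by positivity)
  have hlog0 : 0 ≤ Real.log (1 + (t - A' * R) / (β' * R)) := Real.log_nonneg (by linarith)
  have hdiff : Real.log (1 + (t - A' * R) / (β' * R)) ≤ logGain A β R y₁ - logGain A β R y₀ := by
    have hB : 0 < 8 * β + A / 4 := by positivity
    have hd0 : 8 * β * R + (y₀ - (2 * A + 1) * R) = (8 * β + A / 4) * R := by rw [hy₀]; ring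
    rw [hLeq, hLeq, ← Real.log_div
      (div_pos (hden y₁ hm1) (by positivity)).ne' (div_pos (hden y₀ hm0) (by positivity)).ne']
    refine Real.log_le_log (by linarith) ?_
    have e : (8 * β * R + (y₁ - (2 * A + 1) * R)) / (8 * β * R) /
        ((8 * β * R + (y₀ - (2 * A + 1) * R)) / (8 * β * R)) =
        1 + (y₁ - y₀) / ((8 * β + A / 4) * R) := by
      have hne := (mul_pos hB hR).ne'
      rw [div_div_div_cancel_right₀ (by positivity), hd0, div_eq_iff hne, one_add_mul,
        div_mul_cancel₀ _ hne, ← hd0]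
      ring
    rw [e]
    gcongr 1 + ?_
    rw [div_le_div_iff₀ (by positivity) (by positivity)]
    have h1 : 7 / 8 * (t - A' * R) ≤ y₁ - y₀ := by rw [hy₀, hy₁]; nlinarith
    have h2 : (8 * β + A / 4) ≤ 7 / 8 * β' := by linarith
    calc (t - A' * R) * ((8 * β + A / 4) * R) ≤ (t - A' * R) * ((7 / 8 * β') * R) := by gcongr
      _ = 7 / 8 * (t - A' * R) * (β' * R) := by ring
      _ ≤ (y₁ - y₀) * (β' * R) := by gcongr
  have hsup := Real.add_rpow_le_rpow_add (a := logGain A β R y₁ - logGain A β R y₀)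
    (b := logGain A β R y₀) (hlog0.trans hdiff) (hL y₀ hm0).le (p := κ + 1) (by linarith)
  rw [sub_add_cancel] at hsup
  have := Real.rpow_le_rpow hlog0 hdiff (z := κ + 1) (by positivity)
  linarith

/-- For `p < q` the first term in the maximum is the larger one, so `criticalF = 0` is the identity
`q + 2 + p⁻¹ = (n - 1) (pq - 1) / 2`. Together with `n ≥ 4` it forces `p < 2`. -/
theorem lt_two_and_exponent_eq_of_criticalF {k : ℕ} (hk : 3 ≤ k) {p q : ℝ} (hp : 1 < p) (hpq : p < q)
    (hF : criticalF p q (k + 1) = 0) : p < 2 ∧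
    ((k : ℝ) * (1 - p / 2) + 2) * q + 1 - ((k + 1 : ℕ) : ℝ) * (q - 1) = (k : ℝ) / 2 - 1 / p := by
  have hp0 : 0 < p := by linarith
  have hD : 0 < p * q - 1 := by nlinarith
  have hpi : q⁻¹ ≤ p⁻¹ := inv_anti₀ hp0 hpq.le
  have hmax : (p + 2 + q⁻¹) / (p * q - 1) ≤ (q + 2 + p⁻¹) / (p * q - 1) := by
    gcongr
  rw [criticalF, max_eq_left hmax, sub_eq_zero, div_eq_iff hD.ne'] at hF
  push_cast at hF ⊢
  have hk' : (3 : ℝ) ≤ k := by exact_mod_cast hk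
  constructor
  · by_contra! h
    have h1 : p⁻¹ ≤ 2⁻¹ := inv_anti₀ (by norm_num) h
    nlinarith
  · rw [one_div]
    linarith

/-- The exponent `((pq)^j - 1) / (pq - 1)` of the logarithm, as a function of `r = pq`. -/
noncomputable def logExponent (r : ℝ) (j : ℕ) : ℝ := (r ^ j - 1) / (r - 1)

theorem logExponent_one {r : ℝ} (hr : 1 < r) : logExponent r 1 = 1 := by
  rw [logExponent, pow_one, div_self (by linarith)]

theorem logExponent_succ {r : ℝ} (hr : 1 < r) (j : ℕ) :
    logExponent r (j + 1) = logExponent r j * r + 1 := by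
  have : r - 1 ≠ 0 := by linarith
  unfold logExponent
  field_simp
  ring

theorem one_le_logExponent {r : ℝ} (hr : 1 < r) (j : ℕ) : 1 ≤ logExponent r (j + 1) := by
  rw [logExponent, le_div_iff₀ (by linarith)]
  have := pow_le_pow_right₀ hr.le (Nat.succ_le_succ (Nat.zero_le j))
  simp only [Nat.succ_eq_add_one, zero_add, pow_one] at this
  linarith

/-- The sequence `S_j`. It sums the logarithms of the factors `c / logExponent (pq) (j + 1)` lost in
each step of the iteration, discounted by the powers of `r = pq` to which they are raised later. -/
noncomputable def lossSum (c r : ℝ) (j : ℕ) : ℝ :=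
  ∑ i ∈ Finset.range (j - 1), (Real.log c - Real.log (logExponent r (i + 2))) / r ^ (i + 1)

theorem tendsto_lossSum {r : ℝ} (c : ℝ) (hr : 1 < r) : ∃ L, Tendsto (lossSum c r) atTop (𝓝 L) := by
  have hr0 : 0 < r := by linarith
  have hsum : Summable fun i : ℕ =>
      (Real.log c - Real.log (logExponent r (i + 2))) / r ^ (i + 1) := by
    have hi : ‖r⁻¹‖ < 1 := by
      rw [Real.norm_of_nonneg (by positivity)]
      exact inv_lt_one_of_one_lt₀ hr
    have h1 := (summable_pow_mul_geometric_of_norm_lt_one 1 hi).mul_left (r⁻¹ * Real.log r)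
    have h2 := (summable_geometric_of_norm_lt_one hi).mul_left
      (r⁻¹ * (|Real.log c| + 2 * Real.log r + |Real.log (r - 1)|))
    refine Summable.of_norm_bounded (h1.add h2) fun i => ?_
    have hb := one_le_logExponent hr (i + 1)
    have hb0 : 0 ≤ Real.log (logExponent r (i + 2)) := Real.log_nonneg hb
    have hb1 : Real.log (logExponent r (i + 2)) ≤ (i + 2) * Real.log r + |Real.log (r - 1)| := by
      have : logExponent r (i + 2) ≤ r ^ (i + 2) / (r - 1) :=
        div_le_div_of_nonneg_right (by linarith) (by linarith)
      refine (Real.log_le_log (by linarith) this).trans ?_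
      rw [Real.log_div (by positivity) (by linarith), Real.log_pow]
      push_cast
      linarith [neg_abs_le (Real.log (r - 1))]
    rw [norm_div, Real.norm_of_nonneg (pow_nonneg hr0.le _), div_eq_inv_mul, ← inv_pow, pow_succ,
      pow_one]
    have h3 : ‖Real.log c - Real.log (logExponent r (i + 2))‖ ≤
        |Real.log c| + ((i + 2) * Real.log r + |Real.log (r - 1)|) := by
      refine (norm_sub_le _ _).trans ?_
      rw [Real.norm_eq_abs, Real.norm_of_nonneg hb0]
      linarith
    calc r⁻¹ ^ i * r⁻¹ * ‖Real.log c - Real.log (logExponent r (i + 2))‖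
        ≤ r⁻¹ ^ i * r⁻¹ * (|Real.log c| + ((i + 2) * Real.log r + |Real.log (r - 1)|)) := by gcongr
      _ = _ := by ring
  refine ⟨_, (hsum.hasSum.tendsto_sum_nat).comp (tendsto_sub_atTop_nat 1)⟩

theorem lossSum_add_two (c r : ℝ) (j : ℕ) : lossSum c r (j + 2) = lossSum c r (j + 1) +
    (Real.log c - Real.log (logExponent r (j + 2))) / r ^ (j + 1) := by
  simp only [lossSum, Nat.add_succ_sub_one, Finset.sum_range_succ, add_zero]

theorem C_succ_eq {p q Ct ε c : ℝ} (hCt : 0 < Ct) (hε : 0 < ε) (j : ℕ) :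
    C p q Ct ε (lossSum c (p * q)) (j + 1) =
      Real.exp ((p * q) ^ j * (Real.log (Ct * ε ^ (p ^ 2 * q)) + lossSum c (p * q) (j + 1))) := by
  unfold C
  split_ifs with h
  · obtain rfl : j = 0 := by omega
    rw [pow_zero, one_mul, lossSum]
    simp only [zero_add, Nat.sub_self, Finset.range_zero, Finset.sum_empty, add_zero]
    rw [Real.exp_log (by positivity)]
  · rw [Nat.add_sub_cancel]

/-- The constants satisfy the recursion that the iteration step produces. -/
theorem C_add_two_eq {p q Ct ε c : ℝ} (hCt : 0 < Ct) (hε : 0 < ε) (hc : 0 < c) (hr : 1 < p * q)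
    (j : ℕ) : C p q Ct ε (lossSum c (p * q)) (j + 2) =
      c * C p q Ct ε (lossSum c (p * q)) (j + 1) ^ (p * q) / logExponent (p * q) (j + 2) := by
  rw [C_succ_eq hCt hε, C_succ_eq hCt hε, ← Real.exp_mul, lossSum_add_two]
  have hb := one_le_logExponent hr (j + 1)
  have hb0 : 0 < logExponent (p * q) (j + 2) := by linarith
  rw [mul_comm c, ← Real.exp_log hc, ← Real.exp_log hb0, ← Real.exp_add, ← Real.exp_sub,
    Real.exp_log hc, Real.exp_log hb0]
  congr 1
  have : (p * q) ^ (j + 1) ≠ 0 := pow_ne_zero _ (by linarith)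
  rw [mul_add, mul_add, mul_div_cancel₀ _ this]
  ring

theorem a_add_two (j : ℕ) : a (j + 2) = 4 * a (j + 1) + 6 := by
  simp only [a, Nat.add_succ_sub_one, add_zero, pow_succ]
  ring

theorem four_le_a (j : ℕ) : 4 ≤ a (j + 1) := by
  have : (1 : ℝ) ≤ 4 ^ j := one_le_pow₀ (by norm_num)
  simp only [a, Nat.add_succ_sub_one, add_zero]
  linarith

/-- The iteration: a first lower bound without logarithm for `∫ |v|^p` implies bounds with
arbitrarily high powers of the logarithm. -/
theorem iterated_lower_bound (k : ℕ) (hk : 2 ≤ k) {p q : ℝ} (hp : 1 < p) (hp2 : p ≤ 2) (hq : 1 < q)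
    (hcrit : ((k : ℝ) * (1 - p / 2) + 2) * q + 1 - ((k + 1 : ℕ) : ℝ) * (q - 1) =
      (k : ℝ) / 2 - 1 / p) : ∃ c : ℝ, 0 < c ∧
    ∀ (R : ℝ) (T : EReal) (u ut v vt : ℝ → EuclideanSpace ℝ (Fin (k + 1)) → ℝ),
      IsConeSolution p q R T u ut v vt → ∀ K₀ ε : ℝ, 0 < K₀ → 0 < ε →
      (∀ s ∈ timeInterval T, R ≤ s →
        K₀ * ε ^ p * (s - R) ^ ((k : ℝ) * (1 - p / 2)) ≤ ∫ x, |v s x| ^ p) →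
      ∀ j : ℕ, ∀ t ∈ timeInterval T, a (j + 1) * R ≤ t →
        C p q (c * K₀ ^ (p * q)) ε (lossSum c (p * q)) (j + 1) *
          (t - a (j + 1) * R) ^ ((k : ℝ) * (1 - p / 2)) *
          Real.log (1 + (t - a (j + 1) * R) / ((a (j + 1) + 2) * (a (j + 1) - 1) * R)) ^
            logExponent (p * q) (j + 1) ≤ ∫ x, |v t x| ^ p := by
  obtain ⟨c, hc, H⟩ := iteration_step k hk hp hp2 hq hcrit
  refine ⟨c, hc, fun R T u ut v vt hsol K₀ ε hK₀ hε hbase j => ?_⟩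
  have hR := hsol.R_pos
  have hr : 1 < p * q := by nlinarith
  have hm : 0 ≤ (k : ℝ) * (1 - p / 2) := mul_nonneg (Nat.cast_nonneg _) (by linarith)
  have hCt : 0 < c * K₀ ^ (p * q) := by positivity
  -- one application of `iteration_step`, with the integral of the logarithm evaluated
  have step : ∀ A A' β β' b K : ℝ, 1 ≤ A → 0 < β → 0 ≤ b → 0 ≤ K → 2 * A + 1 ≤ 8 * β →
      9 * A / 4 + 1 < 7 * A' / 8 → 8 / 7 * (8 * β + A / 4) ≤ β' →
      (∀ s ∈ timeInterval T, A * R ≤ s →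
        K * (s - A * R) ^ ((k : ℝ) * (1 - p / 2)) *
          Real.log (1 + (s - A * R) / (β * R)) ^ b ≤ ∫ x, |v s x| ^ p) →
      ∀ t ∈ timeInterval T, A' * R ≤ t →
        c * K ^ (p * q) / (b * (p * q) + 1) * (t - A' * R) ^ ((k : ℝ) * (1 - p / 2)) *
          Real.log (1 + (t - A' * R) / (β' * R)) ^ (b * (p * q) + 1) ≤ ∫ x, |v t x| ^ p := by
    intro A A' β β' b K hA hβ hb hK h1 h2 h3 hyp t ht htA
    refine le_trans ?_ (H R T u ut v vt hsol A β b K hA hβ hb hK hyp t ht (by nlinarith))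
    have hint := log_rpow_le_integral (R := R) (κ := b * p * q) (t := t) (by linarith) hβ h1 h2.le
      h3 hR (by positivity) htA
    have hβ'0 : 0 < β' := by linarith
    have h4 : (t - A' * R) ^ ((k : ℝ) * (1 - p / 2)) ≤ t ^ ((k : ℝ) * (1 - p / 2)) :=
      Real.rpow_le_rpow (by linarith) (by nlinarith) hm
    have h5 : 0 ≤ (t - A' * R) / (β' * R) := div_nonneg (by linarith) (by positivity)
    have h6 : 0 ≤ Real.log (1 + (t - A' * R) / (β' * R)) := Real.log_nonneg (by linarith)
    have h7 : 0 ≤ t := ht.1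
    rw [mul_assoc b] at hint ⊢
    calc _ = c * K ^ (p * q) * (t - A' * R) ^ ((k : ℝ) * (1 - p / 2)) *
          (Real.log (1 + (t - A' * R) / (β' * R)) ^ (b * (p * q) + 1) / (b * (p * q) + 1)) := by ring
      _ ≤ _ := by gcongr
  induction j with
  | zero =>
    intro t ht hta
    have e4 : a (0 + 1) = 4 := by norm_num [a]
    -- the value of `β` is irrelevant here, since the logarithm has exponent `0`
    have h := step 1 4 1 18 0 (K₀ * ε ^ p) le_rfl one_pos le_rfl (by positivity) (by norm_num)
      (by norm_num) (by norm_num) (fun s hs hsR => by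
        rw [one_mul] at hsR
        simpa using hbase s hs hsR) t ht (by rwa [e4] at hta)
    have e : (K₀ * ε ^ p) ^ (p * q) = K₀ ^ (p * q) * ε ^ (p ^ 2 * q) := by
      rw [Real.mul_rpow hK₀.le (by positivity), ← Real.rpow_mul hε.le]
      congr 2
      ring
    rw [C, if_pos (zero_add 1), e4, zero_add, logExponent_one hr]
    rw [e] at h
    norm_num at h ⊢
    rw [← mul_assoc] at h
    exact h
  | succ j ih =>
    intro t ht hta
    have ha := four_le_a j
    have hb := one_le_logExponent hr j
    have h := step (a (j + 1)) (a (j + 2)) ((a (j + 1) + 2) * (a (j + 1) - 1))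
      ((a (j + 2) + 2) * (a (j + 2) - 1)) (logExponent (p * q) (j + 1))
      (C p q (c * K₀ ^ (p * q)) ε (lossSum c (p * q)) (j + 1)) (by linarith) (by nlinarith)
      (by linarith) (by rw [C_succ_eq hCt hε]; positivity) (by nlinarith)
      (by rw [a_add_two]; linarith) (by rw [a_add_two]; nlinarith) ih t ht hta
    rw [← logExponent_succ hr, ← C_add_two_eq hCt hε hc hr] at h
    exact h

/-! ### The first lower bound -/

/-- Before `t = 3R` the growth of the mean and Hölder's inequality on the ball of radius `4R`
suffice. -/
theorem lower_bound_of_le_three_mul (k : ℕ) {p q m R : ℝ} (hp : 1 < p) (hm : 0 ≤ m) (hR : 0 < R) :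
    ∃ c : ℝ, 0 < c ∧ ∀ (T : EReal) (u ut v vt : ℝ → EuclideanSpace ℝ (Fin (k + 1)) → ℝ),
      IsConeSolution p q R T u ut v vt → ∀ t ∈ timeInterval T, R ≤ t → t ≤ 3 * R →
        c * mean vt 0 ^ p * (t - R) ^ m ≤ ∫ x, |v t x| ^ p := by
  obtain ⟨V, hV, H⟩ := rpow_integral_abs_le (k + 1) hp
  set B := (V * (4 * R) ^ (k + 1)) ^ (p - 1) with hB
  refine ⟨R ^ p / (B * (2 * R) ^ m), by positivity, fun T u ut v vt hsol t ht htR ht3 => ?_⟩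
  obtain ⟨v₀, v₁, hs⟩ := hsol.solves_v
  have hv0 : 0 ≤ mean vt 0 := integral_nonneg_of_ae hsol.vt_zero_nonneg
  have hmean := hs.le_mean (Nat.succ_pos k) hR hsol.source_u hsol.cone_v hsol.cone_vt
    hsol.v_zero_nonneg ht
  have hsrc : 0 ≤ ∫ s in (0 : ℝ)..t, (t - s) * ∫ x, |u s x| ^ q :=
    intervalIntegral.integral_nonneg ht.1 fun s hs' =>
      mul_nonneg (by linarith [hs'.2]) (integral_nonneg fun x => by positivity)
  have habs : mean v t ≤ ∫ x, |v t x| :=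
    (le_abs_self _).trans (abs_integral_le_integral_abs)
  have hle : R * mean vt 0 ≤ ∫ x, |v t x| := by
    have := mul_le_mul_of_nonneg_right htR hv0
    linarith
  have hH := H (t + R) (by linarith) (v t) (hsol.continuous_v.1 t ht) (hsol.cone_v t ht)
  have h1 : (R * mean vt 0) ^ p ≤ (∫ x, |v t x|) ^ p :=
    Real.rpow_le_rpow (by positivity) hle (by linarith)
  have hY : 0 ≤ ∫ x, |v t x| ^ p := integral_nonneg fun x => by positivity
  have h2 : (V * (t + R) ^ (k + 1)) ^ (p - 1) ≤ B := by
    refine Real.rpow_le_rpow (mul_nonneg hV.le (pow_nonneg (by linarith) _)) ?_ (by linarith)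
    exact mul_le_mul_of_nonneg_left (pow_le_pow_left₀ (by linarith) (by linarith) _) hV.le
  have h3 : (R * mean vt 0) ^ p ≤ B * ∫ x, |v t x| ^ p :=
    h1.trans (hH.trans (mul_le_mul_of_nonneg_right h2 hY))
  have h4 : (t - R) ^ m ≤ (2 * R) ^ m := Real.rpow_le_rpow (by linarith) (by linarith) hm
  rw [Real.mul_rpow hR.le hv0] at h3
  rw [div_mul_eq_mul_div, div_mul_eq_mul_div, div_le_iff₀ (by positivity)]
  calc R ^ p * mean vt 0 ^ p * (t - R) ^ m ≤ R ^ p * mean vt 0 ^ p * (2 * R) ^ m := by gcongr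
    _ ≤ (B * ∫ x, |v t x| ^ p) * (2 * R) ^ m := by gcongr
    _ = _ := by ring

/-- After `t = 3R` the initial velocity, transported by plane waves, is seen through a bump
supported in a shell of width `R` behind the light cone. -/
theorem lower_bound_of_three_mul_le (k : ℕ) (hk : 2 ≤ k) {p q R : ℝ} (hp : 1 < p) (hp2 : p ≤ 2)
    (hR : 0 < R) :
    ∃ c : ℝ, 0 < c ∧ ∀ (T : EReal) (u ut v vt : ℝ → EuclideanSpace ℝ (Fin (k + 1)) → ℝ),
      IsConeSolution p q R T u ut v vt → ∀ t ∈ timeInterval T, 3 * R ≤ t →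
        c * mean vt 0 ^ p * (t - R) ^ ((k : ℝ) * (1 - p / 2)) ≤ ∫ x, |v t x| ^ p := by
  have hconj : p.HolderConjugate (p / (p - 1)) := Real.HolderConjugate.conjExponent hp
  set p' := p / (p - 1) with hp'
  have hp'0 : 0 < p' := hconj.symm.pos
  obtain ⟨c, hc, H⟩ := rpow_le_of_le_integral_planeWave k hk hconj
  set m : ℝ := (k : ℝ) * (1 - p / 2) with hm
  have hm0 : 0 ≤ m := mul_nonneg (Nat.cast_nonneg _) (by linarith)
  set I := (4 * R) ^ ((k : ℝ) * p' / 2) * R with hI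
  have hI0 : 0 < I := by positivity
  refine ⟨(R / 4) ^ p / (c * I ^ (p - 1)), by positivity, fun T u ut v vt hsol t ht ht3 => ?_⟩
  obtain ⟨v₀, v₁, hs⟩ := hsol.solves_v
  have hv0 : 0 ≤ mean vt 0 := integral_nonneg_of_ae hsol.vt_zero_nonneg
  have hT0 : (0 : ℝ) ∈ timeInterval T := mem_timeInterval_of_le ht le_rfl ht.1
  -- supported in `[t - 2 R, t - R]`, equal to `1` on an interval of length `R / 2`
  let θ : ContDiffBump (t - 3 * R / 2) := ⟨R / 4, R / 2, by positivity, by linarith⟩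
  have hθs : ∀ ρ, θ ρ ≠ 0 → t - 2 * R < ρ ∧ ρ < t - R := fun ρ hρ => by
    have h : ρ ∈ Metric.ball (t - 3 * R / 2) (R / 2) := by
      have : ρ ∈ Function.support θ := hρ
      rwa [θ.support_eq] at this
    rw [Metric.mem_ball, Real.dist_eq, abs_lt] at h
    constructor <;> linarith [h.1, h.2]
  have hθz : ∀ ρ, ρ ≤ t - 2 * R → θ ρ = 0 := fun ρ hρ => by
    by_contra h
    linarith [(hθs ρ h).1]
  have hθi : ∀ x y : ℝ, IntervalIntegrable θ volume x y := fun x y =>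
    θ.continuous.intervalIntegrable x y
  have hprim_neg : ∀ ρ ≤ 0, ∫ r in (0 : ℝ)..ρ, θ r = 0 := fun ρ hρ => by
    rw [intervalIntegral.integral_symm, neg_eq_zero]
    refine intervalIntegral.integral_zero_ae (ae_of_all _ fun r hr => hθz r ?_)
    rw [Set.uIoc_of_le hρ] at hr
    linarith [hr.2]
  have hprim : ∀ ρ, t - R ≤ ρ → R / 2 ≤ ∫ r in (0 : ℝ)..ρ, θ r := fun ρ hρ => by
    have h := mul_le_integral_of_le (g := θ) (t := ρ) (a := t - 3 * R / 2 - R / 4)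
      (b := t - 3 * R / 2 + R / 4) (c := 1) (by linarith) (by linarith) (by linarith)
      θ.continuous.continuousOn (fun _ _ => θ.nonneg) (fun r hr => by
        refine (θ.one_of_mem_closedBall ?_).ge
        have hin : θ.rIn = R / 4 := rfl
        rw [Metric.mem_closedBall, Real.dist_eq, abs_le, hin]
        constructor <;> linarith [hr.1, hr.2])
    linarith
  have hJ : ∀ e : EuclideanSpace ℝ (Fin (k + 1)), ‖e‖ = 1 →
      R / 4 * mean vt 0 ≤ ∫ x, v t x * θ (inner ℝ x e) := fun e he => by
    refine le_trans ?_ (hs.le_integral_planeWave hR hsol.source_u hsol.cone_v hsol.cone_vt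
      hsol.v_zero_nonneg θ.contDiff (fun ρ => θ.nonneg) (fun ρ hρ => hθz ρ (by linarith)) he ht)
    have hsrc : 0 ≤ ∫ y in R..(2 * t + R), θ (t - y) *
        ∫ s in (0 : ℝ)..((y - R) / 2), ∫ x, |u s x| ^ q :=
      intervalIntegral.integral_nonneg (by linarith) fun y hy => mul_nonneg θ.nonneg
        (intervalIntegral.integral_nonneg (by linarith [hy.1]) fun s _ =>
          integral_nonneg fun x => by positivity)
    have hcont : Continuous fun ρ : ℝ => ∫ r in (0 : ℝ)..ρ, θ r :=
      intervalIntegral.continuous_primitive hθi 0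
    have hvt2 := hs.2.1.1 0 hT0
    have hcone : ∀ᵐ x, 0 + R < ‖x‖ → vt 0 x = 0 := hsol.cone_vt 0 hT0
    have hdata : R / 2 * mean vt 0 ≤ ∫ x, vt 0 x * ((∫ r in (0 : ℝ)..(inner ℝ x e + t), θ r) -
        ∫ r in (0 : ℝ)..(inner ℝ x e - t), θ r) := by
      rw [mean, ← integral_const_mul]
      refine integral_mono_ae ((integrable_of_cone hvt2 hcone).const_mul _)
        (integrable_mul_of_cone hvt2 hcone ((hcont.comp (by fun_prop)).sub
          (hcont.comp (by fun_prop)))) ?_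
      filter_upwards [hcone, hsol.vt_zero_nonneg] with x hx hx0
      by_cases hxR : 0 + R < ‖x‖
      · simp [hx hxR]
      · have hin : |inner ℝ x e| ≤ R := by
          refine (abs_real_inner_le_norm x e).trans ?_
          rw [he]
          linarith
        rw [abs_le] at hin
        rw [hprim_neg (inner ℝ x e - t) (by linarith), sub_zero, mul_comm]
        exact mul_le_mul_of_nonneg_left (hprim _ (by linarith)) hx0
    linarith
  have hIle : ∫⁻ ρ, ENNReal.ofReal (θ ρ ^ p' * (t + 2 * R - ρ) ^ ((k : ℝ) * p' / 2)) ≤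
      ENNReal.ofReal I := by
    calc _ ≤ ∫⁻ ρ, (Set.Icc (t - 2 * R) (t - R)).indicator
          (fun _ => ENNReal.ofReal ((4 * R) ^ ((k : ℝ) * p' / 2))) ρ := by
          refine lintegral_mono fun ρ => ?_
          by_cases h : θ ρ = 0
          · rw [h, Real.zero_rpow hp'0.ne', zero_mul, ENNReal.ofReal_zero]
            exact zero_le
          · have h1 := hθs ρ h
            rw [Set.indicator_of_mem (Set.mem_Icc.2 ⟨h1.1.le, h1.2.le⟩)]
            refine ENNReal.ofReal_le_ofReal ?_
            calc _ ≤ 1 * (4 * R) ^ ((k : ℝ) * p' / 2) :=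
                  mul_le_mul (Real.rpow_le_one θ.nonneg θ.le_one hp'0.le)
                    (Real.rpow_le_rpow (by linarith) (by linarith) (by positivity))
                    (Real.rpow_nonneg (by linarith) _) zero_le_one
              _ = _ := one_mul _
      _ = ENNReal.ofReal I := by
          rw [lintegral_indicator_const measurableSet_Icc, Real.volume_Icc, hI,
            ENNReal.ofReal_mul (by positivity)]
          congr 2
          ring
  have hM : 0 < t + 2 * R := by linarith
  have hmain := H (t + 2 * R) hM θ θ.continuous (fun ρ => θ.nonneg)
    (fun ρ hρ => by
      have := hθs ρ hρ
      constructor <;> linarith [this.1, this.2])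
    (v t) (hsol.continuous_v.1 t ht)
    (by
      filter_upwards [hsol.cone_v t ht] with x hx hxM
      exact hx (by linarith))
    (R / 4 * mean vt 0) I (by positivity) hI0.le hJ hIle
  rw [Real.mul_rpow (by positivity) hv0, Real.rpow_neg hM.le] at hmain
  have h4 : (t - R) ^ m ≤ (t + 2 * R) ^ m := Real.rpow_le_rpow (by linarith) (by linarith) hm0
  have h5 : 0 ≤ (t - R) ^ m := Real.rpow_nonneg (by linarith) _
  rw [div_mul_eq_mul_div, div_mul_eq_mul_div, div_le_iff₀ (by positivity)]
  calc (R / 4) ^ p * mean vt 0 ^ p * (t - R) ^ m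
      ≤ (c * ((t + 2 * R) ^ m)⁻¹ * (∫ x, |v t x| ^ p) * I ^ (p - 1)) * (t + 2 * R) ^ m := by
        gcongr
    _ = _ := by field_simp

/-- The start of the iteration, driven by the initial velocity of `v` alone. -/
theorem first_lower_bound (k : ℕ) (hk : 2 ≤ k) {p q R : ℝ} (hp : 1 < p) (hp2 : p ≤ 2)
    (hR : 0 < R) :
    ∃ c : ℝ, 0 < c ∧ ∀ (T : EReal) (u ut v vt : ℝ → EuclideanSpace ℝ (Fin (k + 1)) → ℝ),
      IsConeSolution p q R T u ut v vt → ∀ t ∈ timeInterval T, R ≤ t →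
        c * mean vt 0 ^ p * (t - R) ^ ((k : ℝ) * (1 - p / 2)) ≤ ∫ x, |v t x| ^ p := by
  have hm0 : 0 ≤ (k : ℝ) * (1 - p / 2) := mul_nonneg (Nat.cast_nonneg _) (by linarith)
  obtain ⟨c₁, hc₁, H₁⟩ := lower_bound_of_le_three_mul k (q := q) hp hm0 hR
  obtain ⟨c₂, hc₂, H₂⟩ := lower_bound_of_three_mul_le k hk (q := q) hp hp2 hR
  refine ⟨min c₁ c₂, lt_min hc₁ hc₂, fun T u ut v vt hsol t ht htR => ?_⟩
  have hv0 : 0 ≤ mean vt 0 := integral_nonneg_of_ae hsol.vt_zero_nonneg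
  have h0 : 0 ≤ (t - R) ^ ((k : ℝ) * (1 - p / 2)) := Real.rpow_nonneg (by linarith) _
  rcases le_total t (3 * R) with h | h
  · refine le_trans ?_ (H₁ T u ut v vt hsol t ht htR h)
    gcongr
    exact min_le_left _ _
  · refine le_trans ?_ (H₂ T u ut v vt hsol t ht h)
    gcongr
    exact min_le_right _ _

theorem AdmissibleData.integral_pos {n : ℕ} {R : ℝ} {f g : EuclideanSpace ℝ (Fin n) → ℝ}
    (h : AdmissibleData R f g) : 0 < ∫ x, g x := by
  have hnn : 0 ≤ᵐ[volume] g := h.nonneg.mono fun x hx => hx.2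
  have hi : Integrable g := integrable_of_cone h.memL2 (h.vanish.mono fun x hx hxR => (hx hxR).2)
  refine lt_of_le_of_ne (integral_nonneg_of_ae hnn) fun h0 => h.ne_zero ?_
  exact (integral_eq_zero_iff_of_nonneg_ae hnn hi).1 h0.symm

theorem IsSolution.isConeSolution {n : ℕ} {p q ε R : ℝ} {f₁ g₁ f₂ g₂ : EuclideanSpace ℝ (Fin n) → ℝ}
    {T : EReal} {u ut v vt : ℝ → EuclideanSpace ℝ (Fin n) → ℝ} (hp : 1 < p) (hp2 : p ≤ 2)
    (hq : 1 < q) (hR : 0 < R) (hε : 0 < ε) (h₁ : AdmissibleData R f₁ g₁)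
    (h₂ : AdmissibleData R f₂ g₂) (hs : IsSolution p q ε f₁ g₁ f₂ g₂ T u ut v vt)
    (hc : SupportedInCone R T u ut v vt) : IsConeSolution p q R T u ut v vt := by
  have hcu : VanishesOutsideCone R T u := fun t ht => (hc t ht).mono fun x hx h => (hx h).1
  have hcv : VanishesOutsideCone R T v := fun t ht => (hc t ht).mono fun x hx h => (hx h).2.1
  have hv : ContinuousInLp T (ENNReal.ofReal p) v :=
    ContinuousInLp.of_two (by linarith) hp2 hs.eq_v.1 hcv
  exact {
    R_pos := hR
    solves_u := ⟨_, _, hs.eq_u⟩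
    solves_v := ⟨_, _, hs.eq_v⟩
    source_u := isConeSource_rpow hq.le hs.continuous_Lq hcu
    source_v := isConeSource_rpow hp.le hv hcv
    cone_u := hcu
    cone_ut := fun t ht => (hc t ht).mono fun x hx h => (hx h).2.2.1
    cone_v := hcv
    cone_vt := fun t ht => (hc t ht).mono fun x hx h => (hx h).2.2.2
    continuous_u := hs.continuous_Lq
    continuous_v := hv
    u_zero_nonneg := by
      filter_upwards [hs.eq_u.2.2.2.1, h₁.nonneg] with x hx hx'
      rw [hx]
      exact mul_nonneg hε.le hx'.1
    ut_zero_nonneg := by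
      filter_upwards [hs.eq_u.2.2.2.2.1, h₁.nonneg] with x hx hx'
      rw [hx]
      exact mul_nonneg hε.le hx'.2
    v_zero_nonneg := by
      filter_upwards [hs.eq_v.2.2.2.1, h₂.nonneg] with x hx hx'
      rw [hx]
      exact mul_nonneg hε.le hx'.1
    vt_zero_nonneg := by
      filter_upwards [hs.eq_v.2.2.2.2.1, h₂.nonneg] with x hx hx'
      rw [hx]
      exact mul_nonneg hε.le hx'.2 }

end WaveSystem

theorem proposition3p1 (n : ℕ) (hn : 4 ≤ n) (p q : ℝ) (hp : 1 < p) (hpq : p < q)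
    (hF : WaveSystem.criticalF p q n = 0) :
    ∃ S : ℕ → ℝ, (∃ L : ℝ, Tendsto S atTop (𝓝 L)) ∧
      ∀ R : ℝ, 0 < R → ∀ f₂ g₂ : EuclideanSpace ℝ (Fin n) → ℝ,
        WaveSystem.AdmissibleData R f₂ g₂ →
        ∃ Ct : ℝ, 0 < Ct ∧
          ∀ f₁ g₁ : EuclideanSpace ℝ (Fin n) → ℝ,
            WaveSystem.AdmissibleData R f₁ g₁ → MemLp f₁ (ENNReal.ofReal q) volume →
          ∀ ε : ℝ, 0 < ε → ∀ T : EReal, 0 < T →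
          ∀ u ut v vt : ℝ → EuclideanSpace ℝ (Fin n) → ℝ,
            WaveSystem.IsSolution p q ε f₁ g₁ f₂ g₂ T u ut v vt →
            WaveSystem.SupportedInCone R T u ut v vt →
            ContDiffOn ℝ 2 (WaveSystem.mean u) (WaveSystem.timeInterval T) ∧
            ∀ j : ℕ, 1 ≤ j → ∀ t ∈ WaveSystem.timeInterval T, WaveSystem.a j * R ≤ t →
              WaveSystem.C p q Ct ε S j *
                  (t - WaveSystem.a j * R) ^ ((n : ℝ) - 1 - ((n : ℝ) - 1) * p / 2) *
                  (Real.log ((t + (WaveSystem.a j ^ 2 - 2) * R) /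
                    ((WaveSystem.a j + 2) * (WaveSystem.a j - 1) * R)))
                    ^ (((p * q) ^ j - 1) / (p * q - 1))
                ≤ deriv (deriv (WaveSystem.mean u)) t := by
  obtain ⟨k, rfl⟩ : ∃ k, n = k + 1 := ⟨n - 1, by omega⟩
  have hk : 3 ≤ k := by omega
  have hq : 1 < q := hp.trans hpq
  obtain ⟨hp2, hcrit⟩ := WaveSystem.lt_two_and_exponent_eq_of_criticalF hk hp hpq hF
  obtain ⟨c, hc, H⟩ := WaveSystem.iterated_lower_bound k (by omega) hp hp2.le hq hcrit
  refine ⟨WaveSystem.lossSum c (p * q), WaveSystem.tendsto_lossSum c (by nlinarith),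
    fun R hR f₂ g₂ h₂ => ?_⟩
  obtain ⟨K, hK, H₁⟩ := WaveSystem.first_lower_bound k (by omega) (q := q) hp hp2.le hR
  have hG := h₂.integral_pos
  have hKG : 0 < K * (∫ x, g₂ x) ^ p := by positivity
  refine ⟨c * (K * (∫ x, g₂ x) ^ p) ^ (p * q), by positivity, ?_⟩
  intro f₁ g₁ h₁ _ ε hε T hT u ut v vt hs hcone
  have hsol := hs.isConeSolution hp hp2.le hq hR hε h₁ h₂ hcone
  refine ⟨hs.eq_u.contDiffOn_mean (Nat.succ_pos k) hR hT hsol.source_v hsol.cone_u hsol.cone_ut,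
    fun j hj t ht hta => ?_⟩
  obtain ⟨i, rfl⟩ : ∃ i, j = i + 1 := ⟨j - 1, by omega⟩
  have ha := WaveSystem.four_le_a i
  have hv0 : WaveSystem.mean vt 0 = ε * ∫ x, g₂ x := by
    rw [WaveSystem.mean, integral_congr_ae hs.eq_v.2.2.2.2.1, integral_const_mul]
  have hbound := H R T u ut v vt hsol (K * (∫ x, g₂ x) ^ p) ε hKG hε (fun s hsT hsR => by
    have := H₁ T u ut v vt hsol s hsT hsR
    rw [hv0, Real.mul_rpow hε.le hG.le] at this
    rwa [mul_assoc K, mul_comm (_ ^ p) (ε ^ p)]) i t ht hta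
  -- `t ≥ a_j R > 0` is an interior point, where `deriv` is not a junk value
  rw [hs.eq_u.deriv_deriv_mean (Nat.succ_pos k) hR hsol.source_v hsol.cone_u hsol.cone_ut ht
    (by nlinarith)]
  have e1 : ((k + 1 : ℕ) : ℝ) - 1 - (((k + 1 : ℕ) : ℝ) - 1) * p / 2 = k * (1 - p / 2) := by
    push_cast
    ring
  have e2 : (t + (WaveSystem.a (i + 1) ^ 2 - 2) * R) /
      ((WaveSystem.a (i + 1) + 2) * (WaveSystem.a (i + 1) - 1) * R) =
      1 + (t - WaveSystem.a (i + 1) * R) /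
        ((WaveSystem.a (i + 1) + 2) * (WaveSystem.a (i + 1) - 1) * R) := by
    have h1 : WaveSystem.a (i + 1) + 2 ≠ 0 := by linarith
    have h2 : WaveSystem.a (i + 1) - 1 ≠ 0 := by linarith
    field_simp
    ring
  rw [e1, e2]
  exact hbound
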